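/- Let $k$ be a field of characteristic $p \geq 3$. Let $H_4$ be Sweedler's Hopf algebra over $k$, with basis $1, g, x, gx$, relations $g^2 = 1$, $x^2 = 0$, $xg = -gx$, and coalgebra structure $\Delta(g) = g \otimes g$, $\Delta(x) = x \otimes 1 + g \otimes x$. Let $A := k\langle y \mid y^p = y\rangle$ be the $p$-dimensional Hopf algebra generated by a primitive element $y$. A crossed system $(A, H_4, \triangleright, f)$ consists of a weak action $\triangleright : H_4 \otimes A \to A$ (that is, $h \triangleright 1 = \varepsilon(h)1$, $1 \triangleright a = a$, $h \triangleright (ab) = (h_{(1)} \triangleright a)(h_{(2)} \triangleright b)$) and a linear map $f : H_4 \otimes H_4 \to A$ such that the tensor product coalgebra $A \otimes H_4$ is a Hopf algebra with unit $1 \otimes 1$ and multiplication $$(a \# h)(c \# h') = a\,(h_{(1)} \triangleright c)\, f(h_{(2)}, h'_{(1)}) \,\#\, h_{(3)} h'_{(2)};$$ this Hopf algebra is the crossed product $A \# H_4$. Let $\mathrm{Crp}(H_4, A)$ be the set of Hopf algebra isomorphism types of all crossed products $A \# H_4$. Let $\mathcal{H}^2(H_4, A)$ be the set of crossed systems modulo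 the relation $(\triangleright, f) \approx (\triangleright', f')$, which holds iff there is a coalgebra map $r : H_4 \to A$ with $r(1) = 1$ and $r(h_{(1)}) \otimes h_{(2)} = r(h_{(2)}) \otimes h_{(1)}$ such that, for all $a \in A$ and $h, h' \in H_4$, $$h \triangleright' a = r(h_{(1)})(h_{(2)} \triangleright a)\, S(r(h_{(3)})), \qquad f'(h,h') = r(h_{(1)})\bigl(h_{(2)} \triangleright r(h'_{(1)})\bigr) f(h_{(3)}, h'_{(2)})\, S\bigl(r(h_{(4)} h'_{(3)})\bigr).$$ For $q \in k^*$ let $A_{(q)}$ be the Hopf algebra generated by $g$ and $x$ subject to $$g^2 = 1, \qquad x^{2p} = q^{p-1} x^2, \qquad xg = -gx,$$ with $\Delta(g) = g \otimes g$ and $\Delta(x) = x \otimes 1 + g \otimes x$. For a positive integer $d$ let $U_d(k)$ be the group of $d$-th roots of unity in $k$. Then: (1) A Hopf algebra $E$ is isomorphic to a crossed product $A \# H_4$ if and only if $E \cong A \otimes H_4$ or $E \cong A_{(q)}$ for some $q \in k^*$. Each $A_{(q)}$ with $q \in k^*$ has dimension $4p$. There are group isomorphisms $\mathrm{Aut}_{\mathrm{Hopf}}(A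 \otimes H_4) \cong \mathbb{F}_p^* \times k^*$ and, for all $q \in k^*$, $\mathrm{Aut}_{\mathrm{Hopf}}(A_{(q)}) \cong U_{2(p-1)}(k)$. (2) There is a bijection $\mathrm{Crp}(H_4, A) \cong k/{\sim}$, where $q \sim q'$ iff $\alpha q = \beta^2 q'$ for some $(\alpha, \beta) \in \mathbb{F}_p^* \times k^*$. It sends the type of $A \otimes H_4$ to the class of $0$ and the type of $A_{(q)}$ to the class of $q$, for each $q \in k^*$. (3) The relation $\approx$ is an equivalence relation, and there is a bijection $\mathcal{H}^2(H_4, A) \cong k$ that sends the class of $(\triangleright, f)$ to the scalar $q$ with $f(x, x) = q\,y$. -/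

import Mathlib

open scoped TensorProduct Polynomial

noncomputable section

namespace HopfCrossed

universe u v w

/-! ## Groups of Hopf algebra automorphisms -/

section Aut

variable (k : Type u) [CommSemiring k] (B : Type v) [Semiring B] [Bialgebra k B]

/-- The group of Hopf algebra automorphisms (a bialgebra isomorphism between Hopf algebras
commutes with the antipodes), with composition as multiplication. -/
instance instGroupBialgAut : Group (B ≃ₐc[k] B) where
  mul φ ψ := ψ.trans φ
  one := BialgEquiv.refl k B
  inv φ := φ.symm
  mul_assoc _ _ _ := rfl
  one_mul _ := rfl
  mul_one _ := rfl
  inv_mul_cancel φ := by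
    apply DFunLike.ext
    intro b
    exact φ.symm_apply_apply b

end Aut

/-! ## Antipodes on algebras given by generators -/

section Antipode

variable {k : Type u} [CommRing k] {B : Type v} [Ring B] [Bialgebra k B]

/-- An anti-multiplicative map, as a linear map. -/
def antiLin (S : B →ₐ[k] Bᵐᵒᵖ) : B →ₗ[k] B :=
  (MulOpposite.opLinearEquiv k).symm.toLinearMap ∘ₗ S.toLinearMap

@[simp] lemma antiLin_apply (S : B →ₐ[k] Bᵐᵒᵖ) (b : B) :
    antiLin S b = (S b).unop := rfl

lemma antiLin_left (S : B →ₐ[k] Bᵐᵒᵖ) (X Y : B ⊗[k] B) (c : k)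
    (hX : LinearMap.mul' k B ((antiLin S).rTensor B X) = algebraMap k B c) :
    LinearMap.mul' k B ((antiLin S).rTensor B (X * Y)) =
      c • LinearMap.mul' k B ((antiLin S).rTensor B Y) := by
  induction Y with
  | zero => simp
  | add Y Z hY hZ => simp only [mul_add, map_add, hY, hZ, smul_add]
  | tmul y y' =>
    have key : ∀ X : B ⊗[k] B, LinearMap.mul' k B ((antiLin S).rTensor B (X * (y ⊗ₜ[k] y'))) =
        (S y).unop * LinearMap.mul' k B ((antiLin S).rTensor B X) * y' := by
      intro X
      induction X with
      | zero => simp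
      | add X Z hX hZ => simp only [add_mul, mul_add, map_add, hX, hZ]
      | tmul x x' => simp [mul_assoc]
    rw [key, hX]
    simp [Algebra.algebraMap_eq_smul_one]

lemma antiLin_right (S : B →ₐ[k] Bᵐᵒᵖ) (X Y : B ⊗[k] B) (c : k)
    (hY : LinearMap.mul' k B ((antiLin S).lTensor B Y) = algebraMap k B c) :
    LinearMap.mul' k B ((antiLin S).lTensor B (X * Y)) =
      c • LinearMap.mul' k B ((antiLin S).lTensor B X) := by
  induction X with
  | zero => simp
  | add X Z hX hZ => simp only [add_mul, map_add, hX, hZ, smul_add]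
  | tmul x x' =>
    have key : ∀ Y : B ⊗[k] B, LinearMap.mul' k B ((antiLin S).lTensor B ((x ⊗ₜ[k] x') * Y)) =
        x * LinearMap.mul' k B ((antiLin S).lTensor B Y) * (S x').unop := by
      intro Y
      induction Y with
      | zero => simp
      | add X Z hX hZ => simp only [add_mul, mul_add, map_add, hX, hZ]
      | tmul y y' => simp [mul_assoc]
    rw [key, hY]
    simp [Algebra.algebraMap_eq_smul_one]

/-- An algebra map `S : B → Bᵒᵖ` that satisfies the antipode identities on a set of algebra
generators of the bialgebra `B` is an antipode. -/
abbrev hopfOfGenerators (S : B →ₐ[k] Bᵐᵒᵖ) (s : Set B) (hs : Algebra.adjoin k s = ⊤)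
    (hl : ∀ b ∈ s, LinearMap.mul' k B ((antiLin S).rTensor B (Coalgebra.comul (R := k) b)) =
      algebraMap k B (Coalgebra.counit (R := k) b))
    (hr : ∀ b ∈ s, LinearMap.mul' k B ((antiLin S).lTensor B (Coalgebra.comul (R := k) b)) =
      algebraMap k B (Coalgebra.counit (R := k) b)) :
    HopfAlgebra k B where
  antipode := antiLin S
  mul_antipode_rTensor_comul := by
    ext b
    have hb : b ∈ Algebra.adjoin k s := hs ▸ Algebra.mem_top
    simp only [LinearMap.comp_apply, Algebra.linearMap_apply]
    induction hb using Algebra.adjoin_induction with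
    | mem x hx => exact hl x hx
    | algebraMap r => simp [Algebra.TensorProduct.algebraMap_apply]
    | add x y _ _ hx hy => simp only [map_add, hx, hy]
    | mul x y _ _ hx hy =>
      rw [Bialgebra.comul_mul, antiLin_left S _ _ _ hx, hy, Bialgebra.counit_mul, map_mul,
        Algebra.smul_def]
  mul_antipode_lTensor_comul := by
    ext b
    have hb : b ∈ Algebra.adjoin k s := hs ▸ Algebra.mem_top
    simp only [LinearMap.comp_apply, Algebra.linearMap_apply]
    induction hb using Algebra.adjoin_induction with
    | mem x hx => exact hr x hx
    | algebraMap r => simp [Algebra.TensorProduct.algebraMap_apply]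
    | add x y _ _ hx hy => simp only [map_add, hx, hy]
    | mul x y _ _ hx hy =>
      rw [Bialgebra.comul_mul, antiLin_right S _ _ _ hy, hx, Bialgebra.counit_mul, mul_comm,
        map_mul, Algebra.smul_def]

end Antipode

/-! ## Sweedler's four-dimensional Hopf algebra -/

section Sweedler

variable (k : Type u) [Field k]

/-- Sweedler's Hopf algebra `H₄`: the algebra with basis `1, g, x, gx` and `g² = 1`, `x² = 0`,
`xg = -gx`, i.e. the generalised quaternion algebra with `i = g`, `j = x`, `ij = gx`. -/
abbrev H4 : Type u := QuaternionAlgebra k 1 0 0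

namespace H4

/-- The generator `g`. -/
def g : H4 k := (⟨0, 1, 0, 0⟩ : QuaternionAlgebra k 1 0 0)
/-- The generator `x`. -/
def x : H4 k := (⟨0, 0, 1, 0⟩ : QuaternionAlgebra k 1 0 0)

/-- `1, g, x, gx` is a basis of `H₄`. -/
def basis : Module.Basis (Fin 4) k (H4 k) := QuaternionAlgebra.basisOneIJK 1 0 0

lemma g_mul_g : g k * g k = 1 := by
  have h : (⟨0, 1, 0, 0⟩ : QuaternionAlgebra k 1 0 0) * ⟨0, 1, 0, 0⟩ = 1 := by
    ext <;> simp
  exact h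

lemma x_mul_x : x k * x k = 0 := by
  have h : (⟨0, 0, 1, 0⟩ : QuaternionAlgebra k 1 0 0) * ⟨0, 0, 1, 0⟩ = 0 := by
    ext <;> simp
  exact h

lemma x_mul_g : x k * g k = -(g k * x k) := by
  have h : (⟨0, 0, 1, 0⟩ : QuaternionAlgebra k 1 0 0) * ⟨0, 1, 0, 0⟩ =
      -(⟨0, 1, 0, 0⟩ * ⟨0, 0, 1, 0⟩) := by
    ext <;> simp
  exact h

lemma basis_eq : ⇑(basis k) = ![1, g k, x k, g k * x k] := by
  have h : (⟨0, 1, 0, 0⟩ : QuaternionAlgebra k 1 0 0) * ⟨0, 0, 1, 0⟩ = ⟨0, 0, 0, 1⟩ := by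
    ext <;> simp
  have h' : g k * x k = (⟨0, 0, 0, 1⟩ : QuaternionAlgebra k 1 0 0) := h
  have h1 : (1 : H4 k) = (⟨1, 0, 0, 0⟩ : QuaternionAlgebra k 1 0 0) := rfl
  rw [h']
  funext i
  have key : ∀ b : QuaternionAlgebra k 1 0 0,
      ⇑((QuaternionAlgebra.basisOneIJK (1 : k) 0 0).repr b) = ⇑(Finsupp.single i (1 : k)) →
        basis k i = b := by
    intro b hb
    apply (QuaternionAlgebra.basisOneIJK (1 : k) 0 0).repr.injective
    exact ((QuaternionAlgebra.basisOneIJK (1 : k) 0 0).repr_self i).trans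
      (DFunLike.coe_injective hb).symm
  refine key _ ?_
  rw [QuaternionAlgebra.coe_basisOneIJK_repr]
  funext j
  fin_cases i <;> fin_cases j <;> simp [g, x]

variable {k}

section lift
variable {B : Type v} [Ring B] [Algebra k B] (G X : B)
  (hG : G * G = 1) (hX : X * X = 0) (hXG : X * G = -(G * X))

/-- Algebra maps out of `H₄` are given by elements that satisfy the defining relations. -/
def lift : H4 k →ₐ[k] B :=
  QuaternionAlgebra.Basis.liftHom (c₁ := (1 : k)) (c₂ := 0) (c₃ := 0)
    { i := G, j := X, k := G * X, i_mul_i := by simp [hG], j_mul_j := by simp [hX]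
      i_mul_j := rfl, j_mul_i := by simp [hXG] }

@[simp] lemma lift_g : lift (k := k) G X hG hX hXG (g k) = G := by
  rw [lift, g, QuaternionAlgebra.Basis.liftHom_apply]
  simp [QuaternionAlgebra.Basis.lift]

@[simp] lemma lift_x : lift (k := k) G X hG hX hXG (x k) = X := by
  rw [lift, x, QuaternionAlgebra.Basis.liftHom_apply]
  simp [QuaternionAlgebra.Basis.lift]

end lift

lemma hom_ext {B : Type v} [Ring B] [Algebra k B] {φ ψ : H4 k →ₐ[k] B}
    (hg : φ (g k) = ψ (g k)) (hx : φ (x k) = ψ (x k)) : φ = ψ :=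
  QuaternionAlgebra.hom_ext hg hx

lemma adjoin_eq_top : Algebra.adjoin k {g k, x k} = ⊤ := by
  rw [eq_top_iff]
  intro b _
  have hb := (basis k).sum_repr b
  have hg : g k ∈ Algebra.adjoin k {g k, x k} := Algebra.subset_adjoin (by simp)
  have hx : x k ∈ Algebra.adjoin k {g k, x k} := Algebra.subset_adjoin (by simp)
  rw [← hb, basis_eq]
  refine Subalgebra.sum_mem _ fun i _ => Subalgebra.smul_mem _ ?_ _
  fin_cases i
  · exact one_mem _
  · exact hg
  · exact hx
  · exact mul_mem hg hx

/-- `Δ(g) = g ⊗ g`, `Δ(x) = x ⊗ 1 + g ⊗ x`. -/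
def comulHom : H4 k →ₐ[k] H4 k ⊗[k] H4 k :=
  lift (g k ⊗ₜ g k) (x k ⊗ₜ 1 + g k ⊗ₜ x k)
    (by simp [g_mul_g, Algebra.TensorProduct.one_def])
    (by simp [mul_add, add_mul, g_mul_g, x_mul_x, x_mul_g, TensorProduct.neg_tmul])
    (by
      simp only [mul_add, add_mul, Algebra.TensorProduct.tmul_mul_tmul, x_mul_g, mul_one, one_mul,
        TensorProduct.neg_tmul, TensorProduct.tmul_neg, neg_add])

/-- `ε(g) = 1`, `ε(x) = 0`. -/
def counitHom : H4 k →ₐ[k] k := lift 1 0 (by simp) (by simp) (by simp)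

instance : Bialgebra k (H4 k) :=
  Bialgebra.ofAlgHom comulHom counitHom
    (hom_ext (by simp [comulHom])
      (by simp [comulHom, TensorProduct.add_tmul, TensorProduct.tmul_add,
        Algebra.TensorProduct.one_def, add_assoc]))
    (hom_ext (by simp [comulHom, counitHom]) (by simp [comulHom, counitHom]))
    (hom_ext (by simp [comulHom, counitHom]) (by simp [comulHom, counitHom]))

@[simp] lemma comul_g : Coalgebra.comul (R := k) (g k) = g k ⊗ₜ[k] g k :=
  (by change comulHom (k := k) (g k) = _; simp [comulHom])

@[simp] lemma comul_x :
    Coalgebra.comul (R := k) (x k) = x k ⊗ₜ[k] 1 + g k ⊗ₜ[k] x k :=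
  (by change comulHom (k := k) (x k) = _; simp [comulHom])

@[simp] lemma counit_g : Coalgebra.counit (R := k) (g k) = 1 :=
  (by change counitHom (g k) = _; simp [counitHom])

@[simp] lemma counit_x : Coalgebra.counit (R := k) (x k) = 0 :=
  (by change counitHom (x k) = _; simp [counitHom])

/-- `S(g) = g`, `S(x) = -gx`, extended anti-multiplicatively. -/
def antipodeHom : H4 k →ₐ[k] (H4 k)ᵐᵒᵖ :=
  lift (MulOpposite.op (g k)) (MulOpposite.op (-(g k * x k)))
    (by rw [← MulOpposite.op_mul, g_mul_g, MulOpposite.op_one])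
    (by
      rw [← MulOpposite.op_mul, MulOpposite.op_eq_zero_iff, neg_mul_neg, mul_assoc,
        ← mul_assoc (x k), x_mul_g, neg_mul, mul_assoc, x_mul_x]
      simp)
    (by
      rw [← MulOpposite.op_mul, ← MulOpposite.op_mul, ← MulOpposite.op_neg]
      congr 1
      rw [mul_neg, neg_mul, neg_neg, mul_assoc, x_mul_g, mul_neg])

instance : HopfAlgebra k (H4 k) :=
  hopfOfGenerators antipodeHom {g k, x k} adjoin_eq_top
    (by
      rintro b (rfl | rfl)
      · simp [antipodeHom, g_mul_g]
      · simp [antipodeHom])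
    (by
      rintro b (rfl | rfl)
      · simp [antipodeHom, g_mul_g]
      · simp [antipodeHom, ← mul_assoc, g_mul_g])

end H4
end Sweedler

/-! ## Frobenius identities -/

section Frobenius

lemma add_pow_char_of_comm (k : Type u) [Field k] (p : ℕ) [Fact p.Prime] [CharP k p]
    {B : Type v} [Ring B] [Algebra k B] {a b : B} (h : Commute a b) : (a + b) ^ p = a ^ p + b ^ p := by
  nontriviality B
  have : CharP B p := charP_of_injective_algebraMap (FaithfulSMul.algebraMap_injective k B) p
  exact add_pow_char_of_commute p h

lemma neg_pow_char (k : Type u) [Field k] (p : ℕ) [Fact p.Prime] [CharP k p]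
    {B : Type v} [Ring B] [Algebra k B] (a : B) : (-a) ^ p = -a ^ p := by
  nontriviality B
  have : CharP B p := charP_of_injective_algebraMap (FaithfulSMul.algebraMap_injective k B) p
  rw [neg_pow, neg_one_pow_char, neg_one_mul]

end Frobenius

/-! ## The Hopf algebra `k⟨y | y ^ p = y⟩` -/

section PrimAlg

variable (k : Type u) [Field k] (p : ℕ)

/-- The algebra `k⟨y | y ^ p = y⟩`. -/
abbrev PrimAlg : Type u := AdjoinRoot (Polynomial.X ^ p - Polynomial.X : k[X])

namespace PrimAlg

/-- The generator `y`. -/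
def y : PrimAlg k p := AdjoinRoot.root _

lemma y_pow : y k p ^ p = y k p := by
  have h := AdjoinRoot.eval₂_root (Polynomial.X ^ p - Polynomial.X : k[X])
  rw [Polynomial.eval₂_sub, Polynomial.eval₂_X_pow, Polynomial.eval₂_X, sub_eq_zero] at h
  exact h

variable {k p}

/-- Algebra maps out of `k⟨y | y ^ p = y⟩`. -/
def lift {B : Type v} [CommRing B] [Algebra k B] (Y : B) (hY : Y ^ p = Y) : PrimAlg k p →ₐ[k] B :=
  AdjoinRoot.liftAlgHom _ (Algebra.ofId k B) Y (by simp [hY])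

@[simp] lemma lift_y {B : Type v} [CommRing B] [Algebra k B] (Y : B) (hY : Y ^ p = Y) :
    lift (k := k) Y hY (y k p) = Y := by
  simp [lift, y]

lemma hom_ext {B : Type v} [Ring B] [Algebra k B] {φ ψ : PrimAlg k p →ₐ[k] B}
    (hy : φ (y k p) = ψ (y k p)) : φ = ψ :=
  AdjoinRoot.algHom_ext hy

variable [Fact p.Prime] [CharP k p]

/-- `Δ(y) = y ⊗ 1 + 1 ⊗ y`. -/
def comulHom : PrimAlg k p →ₐ[k] PrimAlg k p ⊗[k] PrimAlg k p :=
  lift (y k p ⊗ₜ 1 + 1 ⊗ₜ y k p) (by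
    rw [add_pow_char_of_comm k p (Commute.all _ _)]
    simp [Algebra.TensorProduct.tmul_pow, y_pow])

/-- `ε(y) = 0`. -/
def counitHom : PrimAlg k p →ₐ[k] k := lift 0 (by simp [(Fact.out : p.Prime).ne_zero])

instance : Bialgebra k (PrimAlg k p) :=
  Bialgebra.ofAlgHom comulHom counitHom
    (hom_ext (by simp [comulHom, TensorProduct.add_tmul, TensorProduct.tmul_add,
        Algebra.TensorProduct.one_def, add_assoc]))
    (hom_ext (by simp [comulHom, counitHom]))
    (hom_ext (by simp [comulHom, counitHom]))

@[simp] lemma comul_y :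
    Coalgebra.comul (R := k) (y k p) = y k p ⊗ₜ[k] 1 + 1 ⊗ₜ[k] y k p :=
  (by change comulHom (y k p) = _; simp [comulHom])

@[simp] lemma counit_y : Coalgebra.counit (R := k) (y k p) = 0 :=
  (by change counitHom (y k p) = _; simp [counitHom])

/-- `S(y) = -y`. -/
def antipodeHom : PrimAlg k p →ₐ[k] PrimAlg k p :=
  lift (-y k p) (by rw [neg_pow_char k p, y_pow])

instance : HopfAlgebra k (PrimAlg k p) :=
  HopfAlgebra.ofAlgHom antipodeHom
    (hom_ext (by simp [antipodeHom]))
    (hom_ext (by simp [antipodeHom]))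

end PrimAlg
end PrimAlg

/-! ## The Hopf algebras `A_(q)` -/

section Aq

/-- The two generators `g` and `x`. -/
inductive AqGen : Type
  | g
  | x

variable (k : Type u) [Field k] (p : ℕ) (q : k)

/-- The relations `g² = 1`, `x ^ (2p) = q ^ (p - 1) x²`, `xg = -gx`. -/
inductive AqRel : FreeAlgebra k AqGen → FreeAlgebra k AqGen → Prop
  | g_sq : AqRel (FreeAlgebra.ι k AqGen.g ^ 2) 1
  | x_pow : AqRel (FreeAlgebra.ι k AqGen.x ^ (2 * p)) (q ^ (p - 1) • FreeAlgebra.ι k AqGen.x ^ 2)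
  | x_g : AqRel (FreeAlgebra.ι k AqGen.x * FreeAlgebra.ι k AqGen.g)
      (-(FreeAlgebra.ι k AqGen.g * FreeAlgebra.ι k AqGen.x))

/-- The algebra `A_(q)` generated by `g` and `x` subject to `g² = 1`,
`x ^ (2p) = q ^ (p - 1) x²`, `xg = -gx`. -/
def Aq : Type u := RingQuot (AqRel k p q)

namespace Aq

instance : Ring (Aq k p q) := inferInstanceAs (Ring (RingQuot (AqRel k p q)))
instance : Algebra k (Aq k p q) := inferInstanceAs (Algebra k (RingQuot (AqRel k p q)))

/-- The quotient map from the free algebra. -/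
def mk : FreeAlgebra k AqGen →ₐ[k] Aq k p q := RingQuot.mkAlgHom k (AqRel k p q)

lemma mk_rel {a b : FreeAlgebra k AqGen} (h : AqRel k p q a b) : mk k p q a = mk k p q b :=
  RingQuot.mkAlgHom_rel k h

/-- The generator `g`. -/
def g : Aq k p q := mk k p q (FreeAlgebra.ι k AqGen.g)

/-- The generator `x`. -/
def x : Aq k p q := mk k p q (FreeAlgebra.ι k AqGen.x)

lemma g_sq : g k p q ^ 2 = 1 := by
  simpa [g] using mk_rel k p q (AqRel.g_sq (k := k) (p := p) (q := q))

lemma x_pow : x k p q ^ (2 * p) = q ^ (p - 1) • x k p q ^ 2 := by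
  simpa [x] using mk_rel k p q (AqRel.x_pow (k := k) (p := p) (q := q))

lemma x_mul_g : x k p q * g k p q = -(g k p q * x k p q) := by
  simpa [g, x] using mk_rel k p q (AqRel.x_g (k := k) (p := p) (q := q))

lemma g_mul_g : g k p q * g k p q = 1 := by rw [← pow_two, g_sq]

variable {k p q}

section lift
variable {B : Type v} [Ring B] [Algebra k B] (G X : B)
  (hG : G ^ 2 = 1) (hX : X ^ (2 * p) = q ^ (p - 1) • X ^ 2) (hXG : X * G = -(G * X))

/-- Algebra maps out of `A_(q)` are given by elements that satisfy the defining relations. -/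
def lift : Aq k p q →ₐ[k] B :=
  RingQuot.liftAlgHom k (s := AqRel k p q)
    ⟨FreeAlgebra.lift k (fun i => match i with | .g => G | .x => X), by
      intro a b h
      cases h <;> simp [hG, hX, hXG]⟩

lemma lift_mk (a : FreeAlgebra k AqGen) : lift G X hG hX hXG (mk k p q a) =
    FreeAlgebra.lift k (fun i => match i with | .g => G | .x => X) a :=
  RingQuot.liftAlgHom_mkAlgHom_apply k _ _ _

@[simp] lemma lift_g : lift G X hG hX hXG (g k p q) = G := by
  simp [g, lift_mk]

@[simp] lemma lift_x : lift G X hG hX hXG (x k p q) = X := by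
  simp [x, lift_mk]

end lift

lemma mk_surjective : Function.Surjective (mk k p q) := RingQuot.mkAlgHom_surjective k (AqRel k p q)

lemma hom_ext {B : Type v} [Ring B] [Algebra k B] {φ ψ : Aq k p q →ₐ[k] B}
    (hg : φ (g k p q) = ψ (g k p q)) (hx : φ (x k p q) = ψ (x k p q)) : φ = ψ := by
  have h : φ.comp (mk k p q) = ψ.comp (mk k p q) := by
    apply FreeAlgebra.hom_ext
    funext i
    cases i
    · exact hg
    · exact hx
  ext b
  obtain ⟨a, rfl⟩ := mk_surjective b
  exact DFunLike.congr_fun h a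

lemma adjoin_eq_top : Algebra.adjoin k {g k p q, x k p q} = ⊤ := by
  have hg : g k p q ∈ Algebra.adjoin k {g k p q, x k p q} := Algebra.subset_adjoin (by simp)
  have hx : x k p q ∈ Algebra.adjoin k {g k p q, x k p q} := Algebra.subset_adjoin (by simp)
  rw [eq_top_iff]
  intro b _
  obtain ⟨a, rfl⟩ := mk_surjective b
  induction a using FreeAlgebra.induction with
  | grade0 r => rw [AlgHom.commutes]; exact Subalgebra.algebraMap_mem _ r
  | grade1 i =>
    cases i
    · exact hg
    · exact hx
  | mul a b ha hb => rw [map_mul]; exact mul_mem (ha trivial) (hb trivial)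
  | add a b ha hb => rw [map_add]; exact add_mem (ha trivial) (hb trivial)

variable [Fact p.Prime] [CharP k p]

/-- `Δ(g) = g ⊗ g`, `Δ(x) = x ⊗ 1 + g ⊗ x`. -/
def comulHom : Aq k p q →ₐ[k] Aq k p q ⊗[k] Aq k p q :=
  lift (g k p q ⊗ₜ g k p q) (x k p q ⊗ₜ 1 + g k p q ⊗ₜ x k p q)
    (by simp [Algebra.TensorProduct.tmul_pow, g_sq, Algebra.TensorProduct.one_def])
    (by
      have h2 : (x k p q ⊗ₜ[k] (1 : Aq k p q) + g k p q ⊗ₜ[k] x k p q) ^ 2 =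
          (x k p q ^ 2) ⊗ₜ[k] 1 + 1 ⊗ₜ[k] (x k p q ^ 2) := by
        simp [pow_two, mul_add, add_mul, g_mul_g, x_mul_g, TensorProduct.neg_tmul]
      rw [pow_mul, h2, add_pow_char_of_comm k p (by simp [Commute, SemiconjBy])]
      simp [Algebra.TensorProduct.tmul_pow, ← pow_mul, x_pow, TensorProduct.smul_tmul'])
    (by
      simp only [mul_add, add_mul, Algebra.TensorProduct.tmul_mul_tmul, x_mul_g, mul_one, one_mul,
        TensorProduct.neg_tmul, TensorProduct.tmul_neg, neg_add])

/-- `ε(g) = 1`, `ε(x) = 0`. -/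
def counitHom : Aq k p q →ₐ[k] k :=
  lift 1 0 (by simp) (by simp [(Fact.out : p.Prime).ne_zero]) (by simp)

instance : Bialgebra k (Aq k p q) :=
  Bialgebra.ofAlgHom comulHom counitHom
    (hom_ext (by simp [comulHom])
      (by simp [comulHom, TensorProduct.add_tmul, TensorProduct.tmul_add,
        Algebra.TensorProduct.one_def, add_assoc]))
    (hom_ext (by simp [comulHom, counitHom]) (by simp [comulHom, counitHom]))
    (hom_ext (by simp [comulHom, counitHom]) (by simp [comulHom, counitHom]))

@[simp] lemma comul_g : Coalgebra.comul (R := k) (g k p q) = g k p q ⊗ₜ[k] g k p q :=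
  (by change comulHom (k := k) (g k p q) = _; simp [comulHom])

@[simp] lemma comul_x :
    Coalgebra.comul (R := k) (x k p q) = x k p q ⊗ₜ[k] 1 + g k p q ⊗ₜ[k] x k p q :=
  (by change comulHom (k := k) (x k p q) = _; simp [comulHom])

@[simp] lemma counit_g : Coalgebra.counit (R := k) (g k p q) = 1 :=
  (by change counitHom (g k p q) = _; simp [counitHom])

@[simp] lemma counit_x : Coalgebra.counit (R := k) (x k p q) = 0 :=
  (by change counitHom (x k p q) = _; simp [counitHom])

/-- `S(g) = g`, `S(x) = -gx`, extended anti-multiplicatively. -/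
def antipodeHom : Aq k p q →ₐ[k] (Aq k p q)ᵐᵒᵖ :=
  lift (MulOpposite.op (g k p q)) (MulOpposite.op (-(g k p q * x k p q)))
    (by rw [← MulOpposite.op_pow, g_sq, MulOpposite.op_one])
    (by
      have h2 : (-(g k p q * x k p q)) ^ 2 = -x k p q ^ 2 := by
        rw [neg_sq, pow_two, mul_assoc, ← mul_assoc (x k p q), x_mul_g, neg_mul, mul_neg,
          mul_assoc, ← mul_assoc (g k p q), g_mul_g, one_mul, pow_two]
      rw [← MulOpposite.op_pow, ← MulOpposite.op_pow, pow_mul, h2, neg_pow_char k p, ← pow_mul,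
        x_pow, ← MulOpposite.op_smul, smul_neg])
    (by
      rw [← MulOpposite.op_mul, ← MulOpposite.op_mul, ← MulOpposite.op_neg]
      congr 1
      rw [mul_neg, neg_mul, neg_neg, mul_assoc, x_mul_g, mul_neg])

instance : HopfAlgebra k (Aq k p q) :=
  hopfOfGenerators antipodeHom {g k p q, x k p q} adjoin_eq_top
    (by
      rintro b (rfl | rfl)
      · simp [antipodeHom, g_mul_g]
      · simp [antipodeHom])
    (by
      rintro b (rfl | rfl)
      · simp [antipodeHom, g_mul_g]
      · simp [antipodeHom, ← mul_assoc, g_mul_g])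

end Aq
end Aq

/-! ## Crossed products of Hopf algebras -/

section Crossed

variable {k : Type u} [Field k] {A : Type v} [Ring A] [HopfAlgebra k A]
  {H : Type w} [Ring H] [HopfAlgebra k H]

open Coalgebra TensorProduct

/-- `h ⊗ c ↦ (h₁ ▷ c) ⊗ h₂`. -/
def crossTwist (act : H ⊗[k] A →ₗ[k] A) : H ⊗[k] A →ₗ[k] A ⊗[k] H :=
  TensorProduct.map act LinearMap.id ∘ₗ (TensorProduct.rightComm k H H A).toLinearMap ∘ₗ
    TensorProduct.map comul LinearMap.id

/-- `h ⊗ g ↦ f(h₁, g₁) ⊗ h₂ g₂`. -/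
def crossCocycle (f : H ⊗[k] H →ₗ[k] A) : H ⊗[k] H →ₗ[k] A ⊗[k] H :=
  TensorProduct.map f (LinearMap.mul' k H) ∘ₗ comul

/-- `a ⊗ (b ⊗ h) ↦ ab ⊗ h`. -/
def crossLeft : A ⊗[k] (A ⊗[k] H) →ₗ[k] A ⊗[k] H :=
  TensorProduct.map (LinearMap.mul' k A) LinearMap.id ∘ₗ
    (TensorProduct.assoc k A A H).symm.toLinearMap

/-- The multiplication `(a # h)(c # g) = a (h₁ ▷ c) f(h₂, g₁) # h₃ g₂` on `A ⊗ H`. -/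
def crossMul (act : H ⊗[k] A →ₗ[k] A) (f : H ⊗[k] H →ₗ[k] A) :
    (A ⊗[k] H) ⊗[k] (A ⊗[k] H) →ₗ[k] A ⊗[k] H :=
  crossLeft ∘ₗ
    TensorProduct.map LinearMap.id
      (crossLeft ∘ₗ TensorProduct.map LinearMap.id (crossCocycle f) ∘ₗ
        (TensorProduct.assoc k A H H).toLinearMap ∘ₗ
        TensorProduct.map (crossTwist act) LinearMap.id ∘ₗ
        (TensorProduct.assoc k H A H).symm.toLinearMap) ∘ₗ
    (TensorProduct.assoc k A H (A ⊗[k] H)).toLinearMap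

/-- The multiplication in Sweedler notation. -/
lemma crossMul_tmul (act : H ⊗[k] A →ₗ[k] A) (f : H ⊗[k] H →ₗ[k] A) (a c : A) (h g : H)
    {ι κ μ : Type*} (R : Coalgebra.Repr k h ι) (T : ∀ i, Coalgebra.Repr k (R.right i) κ)
    (U : Coalgebra.Repr k g μ) :
    crossMul act f ((a ⊗ₜ h) ⊗ₜ (c ⊗ₜ g)) =
      ∑ i ∈ R.index, ∑ j ∈ (T i).index, ∑ l ∈ U.index,
        (a * act (R.left i ⊗ₜ c) * f ((T i).left j ⊗ₜ U.left l)) ⊗ₜ[k]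
          ((T i).right j * U.right l) := by
  simp [crossMul, crossLeft, crossTwist, crossCocycle, ← R.eq, ← (T _).eq, ← U.eq, sum_tmul,
    tmul_sum, mul_assoc]
  exact Finset.sum_congr rfl fun i _ => Finset.sum_comm

variable (k A H)

/-- A crossed system of Hopf algebras `(A, H, ▷, f)`: a weak action `▷` and a linear map `f` such
that `A ⊗ H` with the multiplication `crossMul`, the unit `1 ⊗ 1` and the tensor product
coalgebra structure is a Hopf algebra. -/
@[ext]
structure CrossedSystem where
  /-- The action `h ⊗ a ↦ h ▷ a`. -/
  act : H ⊗[k] A →ₗ[k] A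
  /-- The cocycle. -/
  f : H ⊗[k] H →ₗ[k] A
  act_one : ∀ h : H, act (h ⊗ₜ 1) = algebraMap k A (counit h)
  one_act : ∀ a : A, act (1 ⊗ₜ a) = a
  /-- `h ▷ (ab) = (h₁ ▷ a) (h₂ ▷ b)`. -/
  act_mul : ∀ (h : H) (a b : A), act (h ⊗ₜ (a * b)) =
    LinearMap.mul' k A (TensorProduct.map ((curry act).flip a) ((curry act).flip b) (comul h))
  one_mul' : ∀ u : A ⊗[k] H, crossMul act f ((1 ⊗ₜ 1) ⊗ₜ u) = u
  mul_one' : ∀ u : A ⊗[k] H, crossMul act f (u ⊗ₜ (1 ⊗ₜ 1)) = u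
  mul_assoc' : ∀ u v w : A ⊗[k] H,
    crossMul act f (crossMul act f (u ⊗ₜ v) ⊗ₜ w) = crossMul act f (u ⊗ₜ crossMul act f (v ⊗ₜ w))
  counit_mul' : ∀ u v : A ⊗[k] H,
    counit (R := k) (crossMul act f (u ⊗ₜ v)) = counit (R := k) u * counit (R := k) v
  comul_mul' : ∀ u v : A ⊗[k] H, comul (R := k) (crossMul act f (u ⊗ₜ v)) =
    TensorProduct.map (crossMul act f) (crossMul act f)
      (TensorProduct.tensorTensorTensorComm k (A ⊗[k] H) (A ⊗[k] H) (A ⊗[k] H) (A ⊗[k] H)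
        (comul u ⊗ₜ comul v))
  exists_antipode : ∃ S : A ⊗[k] H →ₗ[k] A ⊗[k] H,
    (∀ u : A ⊗[k] H, crossMul act f (S.rTensor (A ⊗[k] H) (comul u)) =
      counit (R := k) u • (1 ⊗ₜ 1)) ∧
    (∀ u : A ⊗[k] H, crossMul act f (S.lTensor (A ⊗[k] H) (comul u)) =
      counit (R := k) u • (1 ⊗ₜ 1))

variable {k A H}

namespace CrossedSystem

/-- The underlying space `A ⊗ H` of the crossed product `A # H`. -/
def Product (_ : CrossedSystem k A H) : Type (max v w) := A ⊗[k] H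

variable (S : CrossedSystem k A H)

instance : AddCommGroup S.Product := inferInstanceAs (AddCommGroup (A ⊗[k] H))
instance : Module k S.Product := inferInstanceAs (Module k (A ⊗[k] H))

/-- The tensor product coalgebra structure. -/
instance : Coalgebra k S.Product := inferInstanceAs (Coalgebra k (A ⊗[k] H))

/-- The identity map from `A ⊗ H` onto the crossed product. -/
def toProduct : A ⊗[k] H ≃ₗ[k] S.Product := LinearEquiv.refl k (A ⊗[k] H)

/-- The multiplication of the crossed product. -/
def mulLin : S.Product ⊗[k] S.Product →ₗ[k] S.Product := crossMul S.act S.f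

/-- The ring structure of the crossed product. -/
instance : Ring S.Product where
  __ := (inferInstance : AddCommGroup S.Product)
  mul u v := S.mulLin (u ⊗ₜ v)
  one := S.toProduct (1 ⊗ₜ 1)
  left_distrib u v w := by
    change S.mulLin (u ⊗ₜ (v + w)) = S.mulLin (u ⊗ₜ v) + S.mulLin (u ⊗ₜ w)
    rw [tmul_add, map_add]
  right_distrib u v w := by
    change S.mulLin ((u + v) ⊗ₜ w) = S.mulLin (u ⊗ₜ w) + S.mulLin (v ⊗ₜ w)
    rw [add_tmul, map_add]
  zero_mul u := by
    change S.mulLin (0 ⊗ₜ u) = 0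
    rw [zero_tmul, map_zero]
  mul_zero u := by
    change S.mulLin (u ⊗ₜ 0) = 0
    rw [tmul_zero, map_zero]
  mul_assoc := S.mul_assoc'
  one_mul := S.one_mul'
  mul_one := S.mul_one'

lemma mul_def (u v : S.Product) : u * v = S.mulLin (u ⊗ₜ v) := rfl

lemma one_def : (1 : S.Product) = S.toProduct (1 ⊗ₜ 1) := rfl

instance : Algebra k S.Product :=
  Algebra.ofModule
    (fun r u v => by rw [mul_def, mul_def, ← smul_tmul', map_smul])
    (fun r u v => by rw [mul_def, mul_def, tmul_smul, map_smul])

lemma mulLin_eq : S.mulLin = LinearMap.mul' k S.Product := by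
  ext u v
  rfl

lemma tensor_mul (X Y : S.Product ⊗[k] S.Product) :
    X * Y = TensorProduct.map S.mulLin S.mulLin
      (TensorProduct.tensorTensorTensorComm k S.Product S.Product S.Product S.Product (X ⊗ₜ Y)) := by
  induction X with
  | zero => simp
  | add X X' h h' => rw [add_mul, h, h', add_tmul, map_add, map_add]
  | tmul x x' =>
    induction Y with
    | zero => simp
    | add Y Y' h h' => rw [mul_add, h, h', tmul_add, map_add, map_add]
    | tmul y y' => simp [mul_def]

instance : Bialgebra k S.Product :=
  Bialgebra.mk' k S.Product
    (by
      change counit (R := k) ((1 : A) ⊗ₜ[k] (1 : H)) = 1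
      simp)
    (fun {u v} => S.counit_mul' u v)
    (by
      change comul (R := k) ((1 : A) ⊗ₜ[k] (1 : H)) = (1 ⊗ₜ 1) ⊗ₜ (1 ⊗ₜ 1)
      simp [Algebra.TensorProduct.one_def])
    (fun {u v} => by
      rw [tensor_mul]
      exact S.comul_mul' u v)

/-- The Hopf algebra structure of the crossed product `A # H`. -/
instance : HopfAlgebra k S.Product where
  antipode := (Classical.choose S.exists_antipode : A ⊗[k] H →ₗ[k] A ⊗[k] H)
  mul_antipode_rTensor_comul := by
    rw [← mulLin_eq]
    refine LinearMap.ext fun u => ?_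
    refine ((Classical.choose_spec S.exists_antipode).1 u).trans ?_
    simp only [LinearMap.comp_apply, Algebra.linearMap_apply, Algebra.algebraMap_eq_smul_one]
    rfl
  mul_antipode_lTensor_comul := by
    rw [← mulLin_eq]
    refine LinearMap.ext fun u => ?_
    refine ((Classical.choose_spec S.exists_antipode).2 u).trans ?_
    simp only [LinearMap.comp_apply, Algebra.linearMap_apply, Algebra.algebraMap_eq_smul_one]
    rfl

/-- Two crossed systems are cohomologous if there is a unitary cocentral map `r : H → A` with
`h ▷' a = r(h₁) (h₂ ▷ a) S(r(h₃))` and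
`f'(h, g) = r(h₁) (h₂ ▷ r(g₁)) f(h₃, g₂) S(r(h₄ g₃))`; the right-hand sides are written as
convolution products of linear maps on `H` and on `H ⊗ H`. -/
def Cohomologous (S S' : CrossedSystem k A H) : Prop :=
  ∃ r : H →ₗc[k] A, r 1 = 1 ∧
    (∀ h : H, TensorProduct.map r.toLinearMap LinearMap.id (comul (R := k) h) =
      TensorProduct.map r.toLinearMap LinearMap.id (TensorProduct.comm k H H (comul (R := k) h))) ∧
    (∀ a : A, WithConv.toConv ((curry S'.act).flip a) =
      WithConv.toConv r.toLinearMap * WithConv.toConv ((curry S.act).flip a) *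
        WithConv.toConv (HopfAlgebra.antipode k ∘ₗ r.toLinearMap)) ∧
    WithConv.toConv S'.f =
      WithConv.toConv (r.toLinearMap ∘ₗ (TensorProduct.rid k H).toLinearMap ∘ₗ
          TensorProduct.map LinearMap.id counit) *
        WithConv.toConv (S.act ∘ₗ TensorProduct.map LinearMap.id r.toLinearMap) *
        WithConv.toConv S.f *
        WithConv.toConv (HopfAlgebra.antipode k ∘ₗ r.toLinearMap ∘ₗ LinearMap.mul' k H)

variable (k A H)

/-- Isomorphism of crossed products as Hopf algebras. -/
def isoSetoid : Setoid (CrossedSystem k A H) where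
  r S S' := Nonempty (S.Product ≃ₐc[k] S'.Product)
  iseqv := ⟨fun _ => ⟨BialgEquiv.refl k _⟩, fun ⟨φ⟩ => ⟨φ.symm⟩, fun ⟨φ⟩ ⟨ψ⟩ => ⟨φ.trans ψ⟩⟩

end CrossedSystem

variable (k A H)

/-- `H²(H, A)`: crossed systems modulo the relation of being cohomologous. -/
def HTwo : Type (max v w) := Quot (CrossedSystem.Cohomologous (k := k) (A := A) (H := H))

/-- `Crp(H, A)`: the set of types of Hopf algebra isomorphism of the crossed products `A # H`. -/
def Crp : Type (max v w) := Quotient (CrossedSystem.isoSetoid k A H)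

variable {k A H}

/-- The class of a crossed system in `H²(H, A)`. -/
def HTwo.mk (S : CrossedSystem k A H) : HTwo k A H := Quot.mk _ S

/-- The class of the crossed product of a crossed system in `Crp(H, A)`. -/
def Crp.mk (S : CrossedSystem k A H) : Crp k A H := Quotient.mk _ S

end Crossed

/-- The relation `q ∼ q'` on `k`: `α q = β² q'` for some `α ∈ 𝔽ₚˣ`, `β ∈ kˣ`. -/
def simSetoid (k : Type u) [Field k] (p : ℕ) [Fact p.Prime] [CharP k p] : Setoid k where
  r q q' := ∃ (α : (ZMod p)ˣ) (β : kˣ), ZMod.castHom (dvd_refl p) k α * q = (β : k) ^ 2 * q'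
  iseqv := by
    refine ⟨fun q => ⟨1, 1, by simp⟩, ?_, ?_⟩
    · rintro q q' ⟨α, β, h⟩
      refine ⟨α⁻¹, β⁻¹, ?_⟩
      have h1 : ZMod.castHom (dvd_refl p) k ((α⁻¹ : (ZMod p)ˣ) : ZMod p) *
          ZMod.castHom (dvd_refl p) k (α : ZMod p) = 1 := by
        rw [← map_mul, Units.inv_mul, map_one]
      have h2 : ((β⁻¹ : kˣ) : k) * (β : k) = 1 := Units.inv_mul β
      have h3 : q = ZMod.castHom (dvd_refl p) k ((α⁻¹ : (ZMod p)ˣ) : ZMod p) *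
          ((β : k) ^ 2 * q') := by rw [← h, ← mul_assoc, h1, one_mul]
      generalize ZMod.castHom (dvd_refl p) k ((α⁻¹ : (ZMod p)ˣ) : ZMod p) = a at *
      rw [h3]
      linear_combination (-(a * q')) * (((β⁻¹ : kˣ) : k) * (β : k) + 1) * h2
    · rintro q q' q'' ⟨α, β, h⟩ ⟨α', β', h'⟩
      refine ⟨α' * α, β * β', ?_⟩
      rw [Units.val_mul, map_mul, mul_assoc, h, Units.val_mul, mul_pow, mul_assoc, ← h']
      ring

end HopfCrossed

end

/-! Write `A` for `k⟨y | y ^ p = y⟩`. The theorem rests on two rigidity facts.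

The first is that a crossed system over `H₄` has one free parameter. Multiplicativity of the
coproduct of `A # H` forces `h₁ ⊗ (h₂ ▷ c) = h₂ ⊗ (h₁ ▷ c)`, makes `f` a coalgebra map, and gives
`f` a similar symmetry (`comm_crossTwist`, `comul_f`, `comm_crossCocycle`). Since `Δ(x) = x ⊗ 1 + g
⊗ x` is far from symmetric, comparing coefficients makes the action trivial and all values of `f` on
pairs involving only `g` and one `x` trivial; associativity then expresses the rest through `z =
f(x, x)` (`f_eq`). This `z` is primitive, hence `z = q y`. Conversely each `q` occurs: the crossed
product is `A ⊗ H₄` deformed by `x² = q y` (`ofPrimitive`). The same comparison shows that a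
cocentral `r` is `η ε`, so being cohomologous is equality, and `q` itself is the invariant in (3).

The second is that the coalgebra `A ⊗ H₄`, shared by all crossed products, has few special elements.
Evaluation at the points of the prime field identifies `A` with the functions on `ZMod p`, the
coproduct being dual to addition (`ev_comul`). An element of `A ⊗ H₄` is then a function `ZMod p →
H₄`, and coalgebra conditions become functional equations. They show that the grouplikes are `1` and
`g`, the primitives are the multiples of `y`, and the `g`-skew primitives are spanned by `1 - g` and
`x`. So an isomorphism of crossed products fixes `g`, sends `y` to `α y` with `α` in the prime field
(because `y ^ p = y`), and sends `x` to `β x` (it anticommutes with `g`, and `2 ≠ 0`). Applying it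
to `x² = q y` gives `α q = β² q'`, and every such pair `(α, β)` comes from a rescaling. This yields
(2) and the automorphism groups.

For `q ≠ 0` one has `y = q⁻¹ x²`, so `g` and `x` generate the crossed product and satisfy the
relations of `A_(q)`. The resulting surjection is an isomorphism because `A_(q)` is spanned by the
`4p` elements `gⁱ xʲ` with `i < 2`, `j < 2p`. -/

noncomputable section

namespace HopfCrossed

universe u v w

/-! ### Applying the counit to one tensor factor -/

section Contraction

open Coalgebra TensorProduct

variable {k : Type u} [Field k] {A : Type v} [Ring A] [HopfAlgebra k A]
  {H : Type w} [Ring H] [HopfAlgebra k H]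

/-- `a ⊗ h ↦ ε(h) a`. -/
def contractR (k : Type u) [Field k] (A : Type v) [AddCommGroup A] [Module k A]
    (H : Type w) [AddCommGroup H] [Module k H] [Coalgebra k H] : A ⊗[k] H →ₗ[k] A :=
  (TensorProduct.rid k A).toLinearMap ∘ₗ TensorProduct.map LinearMap.id counit

/-- `a ⊗ h ↦ ε(a) h`. -/
def contractL (k : Type u) [Field k] (A : Type v) [AddCommGroup A] [Module k A] [Coalgebra k A]
    (H : Type w) [AddCommGroup H] [Module k H] : A ⊗[k] H →ₗ[k] H :=
  (TensorProduct.lid k H).toLinearMap ∘ₗ TensorProduct.map counit LinearMap.id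

@[simp] lemma contractR_tmul (a : A) (h : H) :
    contractR k A H (a ⊗ₜ h) = counit (R := k) h • a := rfl

@[simp] lemma contractL_tmul (a : A) (h : H) :
    contractL k A H (a ⊗ₜ h) = counit (R := k) a • h := rfl

lemma contractR_comul {C : Type v} [AddCommGroup C] [Module k C] [Coalgebra k C] (c : C) :
    contractR k C C (comul c) = c :=
  (congrArg (TensorProduct.rid k C) (Coalgebra.lTensor_counit_comul (R := k) c)).trans
    (one_smul k c)

lemma contractL_comul {C : Type v} [AddCommGroup C] [Module k C] [Coalgebra k C] (c : C) :
    contractL k C C (comul c) = c :=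
  (congrArg (TensorProduct.lid k C) (Coalgebra.rTensor_counit_comul (R := k) c)).trans
    (one_smul k c)

end Contraction

/-! ### Coordinates on `H₄`, and `k⟨y | y ^ p = y⟩` as functions on the prime field -/

section Tools

open Coalgebra TensorProduct

namespace H4

variable {k : Type u} [Field k]

@[simp] lemma g_re : (g k).re = 0 := rfl
@[simp] lemma g_imI : (g k).imI = 1 := rfl
@[simp] lemma g_imJ : (g k).imJ = 0 := rfl
@[simp] lemma g_imK : (g k).imK = 0 := rfl
@[simp] lemma x_re : (x k).re = 0 := rfl
@[simp] lemma x_imI : (x k).imI = 0 := rfl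
@[simp] lemma x_imJ : (x k).imJ = 1 := rfl
@[simp] lemma x_imK : (x k).imK = 0 := rfl

lemma g_mul_g_mul (h : H4 k) : g k * (g k * h) = h := by
  rw [← mul_assoc, g_mul_g, one_mul]

lemma x_mul_g_mul (h : H4 k) : x k * (g k * h) = -(g k * (x k * h)) := by
  rw [← mul_assoc, x_mul_g, neg_mul, mul_assoc]

/-- The expansion in the basis `1, g, x, gx`. -/
lemma eq_sum (h : H4 k) :
    h = h.re • (1 : H4 k) + h.imI • g k + h.imJ • x k + h.imK • (g k * x k) := by
  ext <;> simp [g, x]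

lemma linearMap_ext {M : Type*} [AddCommGroup M] [Module k M] {L L' : H4 k →ₗ[k] M}
    (h1 : L 1 = L' 1) (hg : L (g k) = L' (g k)) (hx : L (x k) = L' (x k))
    (hgx : L (g k * x k) = L' (g k * x k)) : L = L' := by
  ext h
  rw [eq_sum h]
  simp only [map_add, map_smul, h1, hg, hx, hgx]

/-- Bilinear maps on `H₄` that agree on the basis are equal. -/
lemma bilin_ext {M : Type*} [AddCommGroup M] [Module k M] {L L' : H4 k ⊗[k] H4 k →ₗ[k] M}
    (h : ∀ i j : Fin 4, L (![1, g k, x k, g k * x k] i ⊗ₜ ![1, g k, x k, g k * x k] j) =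
      L' (![1, g k, x k, g k * x k] i ⊗ₜ ![1, g k, x k, g k * x k] j)) : L = L' := by
  refine Module.Basis.ext ((basis k).tensorProduct (basis k)) fun ij => ?_
  rw [Module.Basis.tensorProduct_apply', basis_eq]
  exact h _ _

lemma comul_gx : comul (R := k) (g k * x k) =
    (g k * x k) ⊗ₜ[k] g k + 1 ⊗ₜ[k] (g k * x k) := by
  rw [Bialgebra.comul_mul, comul_g, comul_x]
  simp [mul_add, g_mul_g]

lemma comul_apply (h : H4 k) : comul (R := k) h = h.re • (1 ⊗ₜ[k] 1) + h.imI • (g k ⊗ₜ[k] g k) +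
    h.imJ • (x k ⊗ₜ[k] 1 + g k ⊗ₜ[k] x k) +
    h.imK • ((g k * x k) ⊗ₜ[k] g k + 1 ⊗ₜ[k] (g k * x k)) := by
  conv_lhs => rw [eq_sum h]
  simp only [map_add, map_smul, comul_g, comul_x, comul_gx, Bialgebra.comul_one,
    Algebra.TensorProduct.one_def]

lemma counit_apply (h : H4 k) : counit (R := k) h = h.re + h.imI := by
  conv_lhs => rw [eq_sum h]
  simp [map_add, map_smul]

/-- The product of two linear functionals. -/
def pairing (φ ψ : H4 k →ₗ[k] k) : H4 k ⊗[k] H4 k →ₗ[k] k :=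
  LinearMap.mul' k k ∘ₗ TensorProduct.map φ ψ

@[simp] lemma pairing_tmul (φ ψ : H4 k →ₗ[k] k) (a b : H4 k) :
    pairing φ ψ (a ⊗ₜ b) = φ a * ψ b := rfl

/-- The coordinate functionals. -/
def coord (k : Type u) [Field k] : Fin 4 → (H4 k →ₗ[k] k) :=
  ![QuaternionAlgebra.reₗ 1 0 0, QuaternionAlgebra.imIₗ 1 0 0, QuaternionAlgebra.imJₗ 1 0 0,
    QuaternionAlgebra.imKₗ 1 0 0]

/-- The coefficients of `1 ⊗ g`, `x ⊗ x` and `gx ⊗ gx` vanish in every `Δ(h)`, so in `h ⊗ h` they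
kill the product of the first two coordinates and the squares of the other two. The counit fixes the
coordinate that survives. -/
lemma eq_one_or_g {h : H4 k} (hc : comul (R := k) h = h ⊗ₜ h) (he : counit (R := k) h = 1) :
    h = 1 ∨ h = g k := by
  rw [comul_apply] at hc
  rw [counit_apply] at he
  have h01 := congrArg (pairing (coord k 0) (coord k 1)) hc
  have h22 := congrArg (pairing (coord k 2) (coord k 2)) hc
  have h33 := congrArg (pairing (coord k 3) (coord k 3)) hc
  simp [coord] at h01 h22 h33
  rcases h01 with h0 | h0 <;> rw [h0] at he
  · right
    ext <;> simp_all
  · left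
    ext <;> simp_all

/-- The terms `g ⊗ g`, `g ⊗ x` and `gx ⊗ g` of `Δ(h)` are absent from `h ⊗ 1 + 1 ⊗ h`, and the
coefficient of `1 ⊗ 1` is doubled there. -/
lemma eq_zero_of_primitive {h : H4 k} (hc : comul (R := k) h = h ⊗ₜ 1 + 1 ⊗ₜ h) : h = 0 := by
  rw [comul_apply] at hc
  have h00 := congrArg (pairing (coord k 0) (coord k 0)) hc
  have h11 := congrArg (pairing (coord k 1) (coord k 1)) hc
  have h12 := congrArg (pairing (coord k 1) (coord k 2)) hc
  have h31 := congrArg (pairing (coord k 3) (coord k 1)) hc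
  simp [coord] at h00 h11 h12 h31
  ext <;> simp_all

/-- The coefficient of `g ⊗ 1` makes the `g`-coordinate the negative of the constant one, and that
of `gx ⊗ g` kills the `gx`-coordinate. -/
lemma eq_of_skewPrimitive {h : H4 k} (hc : comul (R := k) h = h ⊗ₜ 1 + g k ⊗ₜ h) :
    h = h.re • (1 - g k) + h.imJ • x k := by
  rw [comul_apply] at hc
  have h11 := congrArg (pairing (coord k 1) (coord k 1)) hc
  have h10 := congrArg (pairing (coord k 1) (coord k 0)) hc
  have h31 := congrArg (pairing (coord k 3) (coord k 1)) hc
  simp [coord] at h11 h10 h31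
  ext <;> simp [h31]
  linear_combination -h10

end H4

namespace PrimAlg

variable {k : Type u} [Field k] {p : ℕ}

lemma finrank_eq (hp : 1 < p) : Module.finrank k (PrimAlg k p) = p := by
  have hne : (Polynomial.X ^ p - Polynomial.X : k[X]) ≠ 0 :=
    FiniteField.X_pow_card_sub_X_ne_zero k hp
  rw [(AdjoinRoot.powerBasis hne).finrank, AdjoinRoot.powerBasis_dim,
    FiniteField.X_pow_card_sub_X_natDegree_eq k hp]

variable [hp : Fact p.Prime]

instance : Module.Finite k (PrimAlg k p) :=
  Module.finite_of_finrank_pos (by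
    rw [finrank_eq hp.out.one_lt]
    exact hp.out.pos)

instance : Nontrivial (PrimAlg k p) :=
  Module.nontrivial_of_finrank_pos (R := k) (by
    rw [finrank_eq hp.out.one_lt]
    exact hp.out.pos)

variable [CharP k p]

/-- The inclusion of the prime field. -/
abbrev primeField (k : Type u) [Field k] (p : ℕ) [CharP k p] : ZMod p →+* k :=
  ZMod.castHom (dvd_refl p) k

lemma primeField_pow (t : ZMod p) : primeField k p t ^ p = primeField k p t := by
  rw [← map_pow, ZMod.pow_card]

/-- The elements of the prime field are the roots of `X ^ p - X`. -/
lemma exists_primeField_eq {c : k} (hc : c ^ p = c) : ∃ t : ZMod p, primeField k p t = c := by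
  classical
  let P : k[X] := Polynomial.X ^ p - Polynomial.X
  have hne : P ≠ 0 := FiniteField.X_pow_card_sub_X_ne_zero k hp.out.one_lt
  have hdeg : P.natDegree = p := FiniteField.X_pow_card_sub_X_natDegree_eq k hp.out.one_lt
  have hsub : Finset.univ.image (primeField k p) ⊆ P.roots.toFinset := by
    intro c hc
    obtain ⟨t, -, rfl⟩ := Finset.mem_image.1 hc
    rw [Multiset.mem_toFinset, Polynomial.mem_roots hne]
    simp [P, Polynomial.IsRoot, -ZMod.castHom_apply, primeField_pow]
  have heq : Finset.univ.image (primeField k p) = P.roots.toFinset := by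
    -- The image already has `p` elements and a polynomial of degree `p` has at most `p` roots.
    refine Finset.eq_of_subset_of_card_le hsub ?_
    rw [Finset.card_image_of_injective _ (primeField k p).injective, Finset.card_univ, ZMod.card]
    exact (Multiset.toFinset_card_le _).trans ((Polynomial.card_roots' P).trans hdeg.le)
  have hmem : c ∈ P.roots.toFinset := by
    rw [Multiset.mem_toFinset, Polynomial.mem_roots hne]
    simp [P, Polynomial.IsRoot, hc]
  rw [← heq] at hmem
  obtain ⟨t, -, ht⟩ := Finset.mem_image.1 hmem
  exact ⟨t, ht⟩

/-- Evaluation at an element of the prime field. -/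
def ev (k : Type u) [Field k] {p : ℕ} [Fact p.Prime] [CharP k p] (t : ZMod p) :
    PrimAlg k p →ₐ[k] k :=
  lift (primeField k p t) (primeField_pow t)

@[simp] lemma ev_y (t : ZMod p) : ev k t (y k p) = primeField k p t := lift_y _ _

/-- An element of `k⟨y | y ^ p = y⟩` is determined by its values on the prime field. -/
lemma eq_zero_of_ev {a : PrimAlg k p} (h : ∀ t : ZMod p, ev k t a = 0) : a = 0 := by
  obtain ⟨P, rfl⟩ := AdjoinRoot.mk_surjective a
  have hm : (Polynomial.X ^ p - Polynomial.X : k[X]).Monic :=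
    Polynomial.monic_X_pow_sub (by
      rw [Polynomial.degree_X]
      exact_mod_cast hp.out.one_lt)
  -- Pass to the remainder modulo `X ^ p - X`: it has degree less than `p` and vanishes at `p`
  -- distinct points.
  have hmod : AdjoinRoot.mk (Polynomial.X ^ p - Polynomial.X) P =
      AdjoinRoot.mk (Polynomial.X ^ p - Polynomial.X) (P %ₘ (Polynomial.X ^ p - Polynomial.X)) := by
    rw [AdjoinRoot.mk_eq_mk]
    exact ⟨P /ₘ (Polynomial.X ^ p - Polynomial.X),
      sub_eq_of_eq_add' (Polynomial.modByMonic_add_div P _).symm⟩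
  rw [hmod] at h ⊢
  set Q := P %ₘ (Polynomial.X ^ p - Polynomial.X) with hQ
  have hev : ∀ t : ZMod p, Q.eval (primeField k p t) = 0 := by
    intro t
    rw [← h t]
    change _ = AdjoinRoot.liftAlgHom _ _ _ _ _
    rw [AdjoinRoot.liftAlgHom_mk]
    rfl
  have hdeg : Q.natDegree < Fintype.card (ZMod p) := by
    rw [ZMod.card, ← FiniteField.X_pow_card_sub_X_natDegree_eq k hp.out.one_lt]
    refine Polynomial.natDegree_modByMonic_lt _ hm ?_
    intro h1
    have := FiniteField.X_pow_card_sub_X_natDegree_eq k hp.out.one_lt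
    rw [h1, Polynomial.natDegree_one] at this
    exact hp.out.ne_zero this.symm
  rw [Polynomial.eq_zero_of_natDegree_lt_card_of_eval_eq_zero Q (primeField k p).injective hev hdeg,
    map_zero]

/-- This makes the coproduct dual to addition on `ZMod p`. Both sides are algebra maps, so agreement
on `y` suffices. -/
lemma ev_comul (s t : ZMod p) : (LinearMap.mul' k k ∘ₗ
    TensorProduct.map (ev k s).toLinearMap (ev k t).toLinearMap) ∘ₗ comul =
    (ev k (p := p) (s + t)).toLinearMap := by
  have h : ((Algebra.TensorProduct.lmul' k).comp (Algebra.TensorProduct.map (ev k s) (ev k t))).comp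
      (Bialgebra.comulAlgHom k (PrimAlg k p)) = ev k (s + t) := by
    apply hom_ext
    simp
  exact congrArg AlgHom.toLinearMap h

lemma ev_zero : (ev k (0 : ZMod p)).toLinearMap = counit (R := k) (A := PrimAlg k p) := by
  have h : ev k (0 : ZMod p) = Bialgebra.counitAlgHom k (PrimAlg k p) := by
    apply hom_ext
    simp
  exact congrArg AlgHom.toLinearMap h

lemma y_ne_zero : y k p ≠ 0 := by
  intro h
  have := congrArg (ev k (1 : ZMod p)) h
  simp at this

/-- A function on `ZMod p` that is additive is multiplication by a constant. -/
lemma additive_eq {F : ZMod p → k} (hF : ∀ s t, F (s + t) = F s + F t) (t : ZMod p) :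
    F t = primeField k p t * F 1 := by
  let F' : ZMod p →+ k := AddMonoidHom.mk' F hF
  obtain ⟨n, rfl⟩ := ZMod.natCast_zmod_surjective t
  have : F' (n • (1 : ZMod p)) = n • F' 1 := map_nsmul F' n 1
  rw [nsmul_eq_mul, nsmul_eq_mul, mul_one] at this
  rw [map_natCast]
  exact this

/-- A primitive element is an additive function on `ZMod p`, hence linear, and `y` is the identity
function. -/
lemma eq_smul_y_of_primitive {a : PrimAlg k p} (ha : comul (R := k) a = a ⊗ₜ 1 + 1 ⊗ₜ a) :
    ∃ c : k, a = c • y k p := by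
  have hF : ∀ s t : ZMod p, ev k (s + t) a = ev k s a + ev k t a := by
    intro s t
    have := LinearMap.congr_fun (ev_comul (k := k) s t) a
    rw [LinearMap.comp_apply, ha] at this
    simpa using this.symm
  refine ⟨ev k 1 a, sub_eq_zero.1 (eq_zero_of_ev fun t => ?_)⟩
  rw [map_sub, map_smul, ev_y, smul_eq_mul, additive_eq (F := fun t => ev k t a) hF t, mul_comm, sub_self]

end PrimAlg

end Tools

/-! ### Primitive, grouplike and skew primitive elements of `A ⊗ H₄` -/

section Slices

open Coalgebra TensorProduct PrimAlg

lemma map_contract_left {k : Type u} [Field k] {A : Type v} [AddCommGroup A] [Module k A]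
    {H : Type w} [AddCommGroup H] [Module k H] (φ ψ : A →ₗ[k] k) (P : A ⊗[k] A) (Q : H ⊗[k] H) :
    TensorProduct.map ((TensorProduct.lid k H).toLinearMap ∘ₗ TensorProduct.map φ LinearMap.id)
      ((TensorProduct.lid k H).toLinearMap ∘ₗ TensorProduct.map ψ LinearMap.id)
      (TensorProduct.AlgebraTensorModule.tensorTensorTensorComm k k k k A A H H (P ⊗ₜ Q)) =
    (LinearMap.mul' k k (TensorProduct.map φ ψ P)) • Q := by
  induction P with
  | zero => simp
  | add P P' h h' => simp only [add_tmul, map_add, h, h', add_smul]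
  | tmul a b =>
    induction Q with
    | zero => simp
    | add P P' h h' => simp only [tmul_add, map_add, h, h', smul_add]
    | tmul c d => simp [smul_tmul', tmul_smul, smul_smul, mul_comm]

variable {k : Type u} [Field k] {p : ℕ}

/-- The `i`-th component of an element of `A ⊗ H₄`. -/
def component (k : Type u) [Field k] (p : ℕ) (i : Fin 4) :
    PrimAlg k p ⊗[k] H4 k →ₗ[k] PrimAlg k p :=
  (TensorProduct.rid k (PrimAlg k p)).toLinearMap ∘ₗ TensorProduct.map LinearMap.id (H4.coord k i)

lemma component_tmul (i : Fin 4) (a : PrimAlg k p) (h : H4 k) :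
    component k p i (a ⊗ₜ h) = H4.coord k i h • a := rfl

lemma eq_sum_component (z : PrimAlg k p ⊗[k] H4 k) :
    z = component k p 0 z ⊗ₜ 1 + component k p 1 z ⊗ₜ H4.g k + component k p 2 z ⊗ₜ H4.x k +
      component k p 3 z ⊗ₜ (H4.g k * H4.x k) := by
  induction z with
  | zero => simp
  | add z z' h h' =>
    conv_lhs => rw [h, h']
    simp only [map_add, add_tmul]
    abel
  | tmul a h =>
    conv_lhs => rw [H4.eq_sum h]
    simp only [component_tmul, H4.coord, tmul_add, tmul_smul, smul_tmul']
    rfl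

variable [Fact p.Prime] [CharP k p]

/-- Evaluation of the first factor of `A ⊗ H₄` at an element of the prime field. -/
def slice (t : ZMod p) : PrimAlg k p ⊗[k] H4 k →ₗ[k] H4 k :=
  (TensorProduct.lid k (H4 k)).toLinearMap ∘ₗ TensorProduct.map (ev k t).toLinearMap LinearMap.id

@[simp] lemma slice_tmul (t : ZMod p) (a : PrimAlg k p) (h : H4 k) :
    slice t (a ⊗ₜ h) = ev k t a • h := rfl

lemma ev_component (i : Fin 4) (t : ZMod p) (z : PrimAlg k p ⊗[k] H4 k) :
    ev k t (component k p i z) = H4.coord k i (slice t z) := by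
  induction z with
  | zero => simp
  | add z z' h h' => simp only [map_add, h, h']
  | tmul a h => simp [component_tmul, mul_comm]

/-- The slices lose nothing: each of the four components lies in `A` and is determined by its values
on the prime field. -/
lemma eq_of_slice {z z' : PrimAlg k p ⊗[k] H4 k} (h : ∀ t : ZMod p, slice t z = slice t z') :
    z = z' := by
  have hc : ∀ i, component k p i (z - z') = 0 := fun i =>
    eq_zero_of_ev fun t => by rw [ev_component, map_sub, h, sub_self, map_zero]
  rw [← sub_eq_zero, eq_sum_component (z - z')]
  simp [hc]

/-- With `z` read as a function `ZMod p → H₄`, this turns a condition on `Δ(z)` into a functional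
equation in `s` and `t`. -/
lemma comul_slice (s t : ZMod p) (z : PrimAlg k p ⊗[k] H4 k) :
    comul (R := k) (slice (s + t) z) = TensorProduct.map (slice s) (slice t) (comul (R := k) z) := by
  induction z with
  | zero => simp
  | add z z' h h' => simp only [map_add, h, h']
  | tmul a h =>
    rw [TensorProduct.comul_tmul]
    refine Eq.trans ?_ (map_contract_left _ _ _ _).symm
    rw [slice_tmul, map_smul]
    congr 1
    exact (LinearMap.congr_fun (ev_comul s t) a).symm

lemma counit_slice_zero (z : PrimAlg k p ⊗[k] H4 k) :
    counit (R := k) (slice (0 : ZMod p) z) = counit (R := k) z := by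
  induction z with
  | zero => simp
  | add z z' h h' => simp only [map_add, h, h']
  | tmul a h =>
    rw [TensorProduct.counit_tmul, slice_tmul, map_smul, ← ev_zero]
    simp [mul_comm]

/-- The primitive elements of `A ⊗ H₄`. -/
lemma eq_of_primitive {z : PrimAlg k p ⊗[k] H4 k}
    (hz : comul (R := k) z = z ⊗ₜ (1 ⊗ₜ 1) + (1 ⊗ₜ 1) ⊗ₜ z) :
    ∃ c : k, z = c • (y k p ⊗ₜ 1) := by
  have h1 : ∀ s t : ZMod p, comul (R := k) (slice (s + t) z) =
      slice s z ⊗ₜ 1 + 1 ⊗ₜ slice t z := by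
    intro s t
    rw [comul_slice, hz]
    simp
  -- Apply `ε ⊗ id` to the functional equation.
  have h2 : ∀ s t : ZMod p, slice (s + t) z = counit (R := k) (slice s z) • 1 + slice t z := by
    intro s t
    have := congrArg (contractL k (H4 k) (H4 k)) (h1 s t)
    rwa [contractL_comul, map_add, contractL_tmul, contractL_tmul, Bialgebra.counit_one,
      one_smul] at this
  -- At `s = t = 0` the slice is a primitive element of `H₄`.
  have h0 : slice (0 : ZMod p) z = 0 := H4.eq_zero_of_primitive (by simpa using h1 0 0)
  have h3 : ∀ s : ZMod p, slice s z = counit (R := k) (slice s z) • 1 := fun s => by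
    simpa [h0] using h2 s 0
  have h4 : ∀ s t : ZMod p, counit (R := k) (slice (s + t) z) =
      counit (R := k) (slice s z) + counit (R := k) (slice t z) := fun s t => by
    simpa using congrArg (counit (R := k)) (h2 s t)
  refine ⟨counit (R := k) (slice (1 : ZMod p) z), eq_of_slice fun t => ?_⟩
  rw [h3, additive_eq (F := fun s => counit (R := k) (slice s z)) h4 t, map_smul, slice_tmul, ev_y,
    smul_smul, mul_comm]

/-- The grouplike elements of `A ⊗ H₄`. -/
lemma eq_of_grouplike {z : PrimAlg k p ⊗[k] H4 k} (hz : comul (R := k) z = z ⊗ₜ z)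
    (he : counit (R := k) z = 1) : z = 1 ⊗ₜ 1 ∨ z = 1 ⊗ₜ H4.g k := by
  have h1 : ∀ s t : ZMod p, comul (R := k) (slice (s + t) z) = slice s z ⊗ₜ slice t z := by
    intro s t
    rw [comul_slice, hz, TensorProduct.map_tmul]
  have h2 : ∀ s t : ZMod p, slice (s + t) z = counit (R := k) (slice s z) • slice t z := by
    intro s t
    have := congrArg (contractL k (H4 k) (H4 k)) (h1 s t)
    rwa [contractL_comul, contractL_tmul] at this
  have h0 : counit (R := k) (slice (0 : ZMod p) z) = 1 := by rw [counit_slice_zero, he]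
  have h3 : ∀ s t : ZMod p, counit (R := k) (slice (s + t) z) =
      counit (R := k) (slice s z) * counit (R := k) (slice t z) := fun s t => by
    simpa using congrArg (counit (R := k)) (h2 s t)
  have h4 : ∀ (s : ZMod p) (n : ℕ), counit (R := k) (slice (n • s) z) =
      counit (R := k) (slice s z) ^ n := by
    intro s n
    induction n with
    | zero => simpa using h0
    | succ n ih => rw [succ_nsmul, h3, ih, pow_succ]
  -- The counit of the slices is a character `c` of `ZMod p`, so `c(s) ^ p = 1`. In characteristic
  -- `p` this reads `(c(s) - 1) ^ p = 0`, and the character is trivial.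
  have h5 : ∀ s : ZMod p, counit (R := k) (slice s z) = 1 := by
    intro s
    have := h4 s p
    rw [nsmul_eq_mul, CharP.cast_eq_zero, zero_mul, h0] at this
    have h6 : (counit (R := k) (slice s z) - 1) ^ p = 0 := by
      rw [sub_pow_char, one_pow, ← this, sub_self]
    exact sub_eq_zero.1 (pow_eq_zero_iff (Fact.out : p.Prime).ne_zero |>.1 h6)
  have h6 : ∀ t : ZMod p, slice t z = slice (0 : ZMod p) z := fun t => by
    simpa [h5] using h2 t 0
  rcases H4.eq_one_or_g (by simpa using h1 0 0) h0 with h | h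
  · exact .inl (eq_of_slice fun t => by rw [h6, h]; simp)
  · exact .inr (eq_of_slice fun t => by rw [h6, h]; simp)

/-- The skew primitive elements of `A ⊗ H₄`. -/
lemma eq_of_skewPrimitive {z : PrimAlg k p ⊗[k] H4 k}
    (hz : comul (R := k) z = z ⊗ₜ (1 ⊗ₜ 1) + (1 ⊗ₜ H4.g k) ⊗ₜ z) :
    ∃ c d : k, z = c • (1 ⊗ₜ 1 - 1 ⊗ₜ H4.g k) + d • (1 ⊗ₜ H4.x k) := by
  have h1 : ∀ s t : ZMod p, comul (R := k) (slice (s + t) z) =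
      slice s z ⊗ₜ 1 + H4.g k ⊗ₜ slice t z := by
    intro s t
    rw [comul_slice, hz]
    simp
  have h2 : ∀ s t : ZMod p, slice (s + t) z = counit (R := k) (slice s z) • 1 + slice t z := by
    intro s t
    have := congrArg (contractL k (H4 k) (H4 k)) (h1 s t)
    rwa [contractL_comul, map_add, contractL_tmul, contractL_tmul, H4.counit_g,
      one_smul] at this
  have h3 : ∀ s t : ZMod p, slice (s + t) z = slice s z + counit (R := k) (slice t z) • H4.g k := by
    intro s t
    have := congrArg (contractR k (H4 k) (H4 k)) (h1 s t)
    rwa [contractR_comul, map_add, contractR_tmul, contractR_tmul, Bialgebra.counit_one,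
      one_smul] at this
  -- Expand the slice at `s` once as `s + 0` by `ε ⊗ id` and once as `0 + s` by `id ⊗ ε`. The same
  -- scalar then multiplies `1` and `g`, so it is zero.
  have h4 : ∀ s : ZMod p, counit (R := k) (slice s z) = 0 := by
    intro s
    have h := (h2 s 0).symm.trans ((congrArg (fun r => slice r z) (add_comm s 0)).trans (h3 0 s))
    rw [add_comm, add_right_inj] at h
    simpa using congrArg QuaternionAlgebra.re h
  have h5 : ∀ t : ZMod p, slice t z = slice (0 : ZMod p) z := fun t => by
    simpa [h4] using h2 t 0
  have h6 := H4.eq_of_skewPrimitive (h := slice (0 : ZMod p) z) (by simpa using h1 0 0)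
  refine ⟨(slice (0 : ZMod p) z).re, (slice (0 : ZMod p) z).imJ, eq_of_slice fun t => ?_⟩
  rw [h5, map_add, map_smul, map_smul, map_sub, slice_tmul, slice_tmul, slice_tmul, map_one,
    one_smul, one_smul, one_smul]
  exact h6

end Slices

/-! ### Coalgebra constraints on an arbitrary crossed system -/

section General

open Coalgebra TensorProduct

variable {k : Type u} [Field k] {A : Type v} [Ring A] [HopfAlgebra k A]
  {H : Type w} [Ring H] [HopfAlgebra k H]

lemma counit_contractR (z : A ⊗[k] H) :
    counit (R := k) (contractR k A H z) = counit (R := k) z := by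
  induction z with
  | zero => simp
  | add z z' h h' => simp only [map_add, h, h']
  | tmul a h => simp

/-- Keeping the `H`-leg of the first copy and the `A`-leg of the second leaves only the flip.
Applied to the coproduct of a product in `A # H`, this extracts the symmetry conditions on the
action and on the cocycle. -/
lemma contractLR_comul (z : A ⊗[k] H) :
    TensorProduct.map (contractL k A H) (contractR k A H) (comul z) =
      TensorProduct.comm k A H z := by
  have key : ∀ (P : A ⊗[k] A) (Q : H ⊗[k] H),
      TensorProduct.map (contractL k A H) (contractR k A H)
        (AlgebraTensorModule.tensorTensorTensorComm k k k k A A H H (P ⊗ₜ Q)) =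
      contractR k H H Q ⊗ₜ contractL k A A P := by
    intro P Q
    induction P with
    | zero => simp
    | add P P' h h' => simp only [add_tmul, tmul_add, map_add, h, h']
    | tmul a b =>
      induction Q with
      | zero => simp
      | add P P' h h' => simp only [tmul_add, add_tmul, map_add, h, h']
      | tmul c d => simp [smul_tmul', tmul_smul, smul_smul, mul_comm]
  induction z with
  | zero => simp
  | add z z' h h' => simp only [map_add, h, h']
  | tmul a h =>
    rw [TensorProduct.comul_tmul, key, contractR_comul, contractL_comul, TensorProduct.comm_tmul]

/-- The map `id ⊗ ε` is comultiplicative. It carries the coalgebra property from the cocycle part of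
the multiplication to `f`. -/
lemma contractRR_comul (z : A ⊗[k] H) :
    TensorProduct.map (contractR k A H) (contractR k A H) (comul z) =
      comul (contractR k A H z) := by
  have key : ∀ (P : A ⊗[k] A) (Q : H ⊗[k] H),
      TensorProduct.map (contractR k A H) (contractR k A H)
        (AlgebraTensorModule.tensorTensorTensorComm k k k k A A H H (P ⊗ₜ Q)) =
      counit (R := k) (contractR k H H Q) • P := by
    intro P Q
    induction P with
    | zero => simp
    | add P P' h h' => simp only [add_tmul, smul_add, map_add, h, h']
    | tmul a b =>
      induction Q with
      | zero => simp
      | add P P' h h' => simp only [tmul_add, add_smul, map_add, h, h']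
      | tmul c d => simp [smul_tmul', tmul_smul, smul_smul, mul_comm]
  induction z with
  | zero => simp
  | add z z' h h' => simp only [map_add, h, h']
  | tmul a h =>
    rw [TensorProduct.comul_tmul, key, contractR_comul, contractR_tmul, map_smul]

lemma contractR_crossTwist (act : H ⊗[k] A →ₗ[k] A) (h : H) (c : A) :
    contractR k A H (crossTwist act (h ⊗ₜ c)) = act (h ⊗ₜ c) := by
  have key : ∀ Q : H ⊗[k] H, contractR k A H (TensorProduct.map act LinearMap.id
      (TensorProduct.rightComm k H H A (Q ⊗ₜ c))) = act (contractR k H H Q ⊗ₜ c) := by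
    intro Q
    induction Q with
    | zero => simp
    | add P P' h h' => simp only [add_tmul, map_add, h, h']
    | tmul a b =>
      rw [contractR_tmul, ← smul_tmul', map_smul]
      simp
  have := key (comul h)
  rw [contractR_comul] at this
  simpa [crossTwist] using this

lemma contractL_crossTwist (act : H ⊗[k] A →ₗ[k] A)
    (hact : ∀ (h : H) (c : A), counit (R := k) (act (h ⊗ₜ c)) =
      counit (R := k) h * counit (R := k) c) (h : H) (c : A) :
    contractL k A H (crossTwist act (h ⊗ₜ c)) = counit (R := k) c • h := by
  have key : ∀ Q : H ⊗[k] H, contractL k A H (TensorProduct.map act LinearMap.id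
      (TensorProduct.rightComm k H H A (Q ⊗ₜ c))) = counit (R := k) c • contractL k H H Q := by
    intro Q
    induction Q with
    | zero => simp
    | add P P' h h' => simp only [add_tmul, smul_add, map_add, h, h']
    | tmul a b => simp [hact, smul_smul, mul_comm]
  have := key (comul h)
  rw [contractL_comul] at this
  simpa [crossTwist] using this

lemma contractR_crossCocycle (f : H ⊗[k] H →ₗ[k] A) (w : H ⊗[k] H) :
    contractR k A H (crossCocycle f w) = f w := by
  have hc : ∀ w : H ⊗[k] H, counit (R := k) (LinearMap.mul' k H w) = counit (R := k) w := by
    intro w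
    induction w with
    | zero => simp
    | add P P' h h' => simp only [map_add, h, h']
    | tmul a b => simp [mul_comm]
  have key : ∀ Q : (H ⊗[k] H) ⊗[k] (H ⊗[k] H), contractR k A H (TensorProduct.map f
      (LinearMap.mul' k H) Q) = f (contractR k _ _ Q) := by
    intro Q
    induction Q with
    | zero => simp
    | add P P' h h' => simp only [map_add, h, h']
    | tmul a b => rw [TensorProduct.map_tmul, contractR_tmul, hc, contractR_tmul, map_smul]
  exact (key _).trans (congrArg f (contractR_comul w))

lemma contractL_crossCocycle (f : H ⊗[k] H →ₗ[k] A)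
    (hf : ∀ w, counit (R := k) (f w) = counit (R := k) w) (w : H ⊗[k] H) :
    contractL k A H (crossCocycle f w) = LinearMap.mul' k H w := by
  have key : ∀ Q : (H ⊗[k] H) ⊗[k] (H ⊗[k] H), contractL k A H (TensorProduct.map f
      (LinearMap.mul' k H) Q) = LinearMap.mul' k H (contractL k _ _ Q) := by
    intro Q
    induction Q with
    | zero => simp
    | add P P' h h' => simp only [map_add, h, h']
    | tmul a b => rw [TensorProduct.map_tmul, contractL_tmul, hf, contractL_tmul, map_smul]
  exact (key _).trans (congrArg _ (contractL_comul w))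

lemma crossLeft_one (z : A ⊗[k] H) : crossLeft (1 ⊗ₜ z) = z := by
  induction z with
  | zero => simp
  | add z z' h h' => simp only [tmul_add, map_add, h, h']
  | tmul a h => simp [crossLeft]

lemma crossTwist_one (act : H ⊗[k] A →ₗ[k] A)
    (hact : ∀ h : H, act (h ⊗ₜ 1) = algebraMap k A (counit h)) (h : H) :
    crossTwist act (h ⊗ₜ 1) = 1 ⊗ₜ h := by
  have key : ∀ Q : H ⊗[k] H, TensorProduct.map act LinearMap.id
      (TensorProduct.rightComm k H H A (Q ⊗ₜ 1)) = 1 ⊗ₜ contractL k H H Q := by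
    intro Q
    induction Q with
    | zero => simp
    | add P P' h h' => simp only [add_tmul, tmul_add, map_add, h, h']
    | tmul a b => simp [hact, Algebra.algebraMap_eq_smul_one, smul_tmul']
  have := key (comul h)
  rw [contractL_comul] at this
  simpa [crossTwist] using this

/-- These products isolate the cocycle, as those in `crossMul_twist` isolate the action. -/
lemma crossMul_one_one (act : H ⊗[k] A →ₗ[k] A) (f : H ⊗[k] H →ₗ[k] A)
    (hact : ∀ h : H, act (h ⊗ₜ 1) = algebraMap k A (counit h)) (h h' : H) :
    crossMul act f ((1 ⊗ₜ h) ⊗ₜ (1 ⊗ₜ h')) = crossCocycle f (h ⊗ₜ h') := by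
  simp only [crossMul, LinearMap.comp_apply, LinearEquiv.coe_coe, TensorProduct.assoc_tmul,
    TensorProduct.map_tmul, LinearMap.id_apply, TensorProduct.assoc_symm_tmul,
    crossTwist_one act hact, crossLeft_one]

lemma crossMul_twist (act : H ⊗[k] A →ₗ[k] A) (f : H ⊗[k] H →ₗ[k] A)
    (hf : ∀ h : H, crossCocycle f (h ⊗ₜ 1) = 1 ⊗ₜ h) (h : H) (c : A) :
    crossMul act f ((1 ⊗ₜ h) ⊗ₜ (c ⊗ₜ 1)) = crossTwist act (h ⊗ₜ c) := by
  simp only [crossMul, LinearMap.comp_apply, LinearEquiv.coe_coe, TensorProduct.assoc_tmul,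
    TensorProduct.map_tmul, LinearMap.id_apply, TensorProduct.assoc_symm_tmul, crossLeft_one]
  generalize crossTwist act (h ⊗ₜ c) = z
  induction z with
  | zero => simp
  | add z z' h h' => simp only [add_tmul, map_add, h, h']
  | tmul a h => simp [hf, crossLeft]

namespace CrossedSystem

variable (S : CrossedSystem k A H)

lemma cocycle_one (h : H) : crossCocycle S.f (h ⊗ₜ 1) = 1 ⊗ₜ h := by
  rw [← crossMul_one_one S.act S.f S.act_one, S.mul_one']

lemma one_cocycle (h : H) : crossCocycle S.f (1 ⊗ₜ h) = 1 ⊗ₜ h := by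
  rw [← crossMul_one_one S.act S.f S.act_one, S.one_mul']

lemma f_one (h : H) : S.f (h ⊗ₜ 1) = counit (R := k) h • 1 := by
  rw [← contractR_crossCocycle, cocycle_one, contractR_tmul]

lemma one_f (h : H) : S.f (1 ⊗ₜ h) = counit (R := k) h • 1 := by
  rw [← contractR_crossCocycle, one_cocycle, contractR_tmul]

lemma counit_act (h : H) (c : A) :
    counit (R := k) (S.act (h ⊗ₜ c)) = counit (R := k) h * counit (R := k) c := by
  rw [← contractR_crossTwist, counit_contractR, ← crossMul_twist S.act S.f S.cocycle_one,
    S.counit_mul']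
  simp

lemma counit_f (w : H ⊗[k] H) : counit (R := k) (S.f w) = counit (R := k) w := by
  induction w with
  | zero => simp
  | add z z' h h' => simp only [map_add, h, h']
  | tmul h h' =>
    rw [← contractR_crossCocycle, counit_contractR, ← crossMul_one_one S.act S.f S.act_one,
      S.counit_mul']
    simp [mul_comm]

/-- `h₁ ⊗ (h₂ ▷ c) = h₂ ⊗ (h₁ ▷ c)`. -/
lemma comm_crossTwist (h : H) (c : A) : TensorProduct.comm k A H (crossTwist S.act (h ⊗ₜ c)) =
    TensorProduct.map LinearMap.id ((curry S.act).flip c) (comul h) := by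
  -- The left-hand side is the contracted coproduct of `(1 # h)(c # 1)`, expanded by
  -- multiplicativity; the contraction removes the action from the first tensor leg and the `H`-part
  -- from the second.
  have key : ∀ (Q : H ⊗[k] H) (P : A ⊗[k] A),
      TensorProduct.map (contractL k A H) (contractR k A H)
        (TensorProduct.map (crossMul S.act S.f) (crossMul S.act S.f)
        (TensorProduct.tensorTensorTensorComm k (A ⊗[k] H) (A ⊗[k] H) (A ⊗[k] H) (A ⊗[k] H)
          (AlgebraTensorModule.tensorTensorTensorComm k k k k A A H H ((1 ⊗ₜ 1) ⊗ₜ Q) ⊗ₜ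
            AlgebraTensorModule.tensorTensorTensorComm k k k k A A H H (P ⊗ₜ (1 ⊗ₜ 1))))) =
      TensorProduct.map LinearMap.id ((curry S.act).flip (contractL k A A P)) Q := by
    intro Q P
    induction Q with
    | zero => simp
    | add P P' h h' => simp only [tmul_add, add_tmul, map_add, h, h']
    | tmul h h' =>
      induction P with
      | zero => simp
      | add P P' h h' => simp only [tmul_add, add_tmul, map_add, h, h', TensorProduct.map_tmul,
          LinearMap.add_apply]
      | tmul c c' =>
        simp only [AlgebraTensorModule.tensorTensorTensorComm_tmul,
          TensorProduct.tensorTensorTensorComm_tmul, TensorProduct.map_tmul,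
          crossMul_twist S.act S.f S.cocycle_one, contractR_crossTwist,
          contractL_crossTwist S.act S.counit_act]
        simp [smul_tmul']
  rw [← contractLR_comul, ← crossMul_twist S.act S.f S.cocycle_one, S.comul_mul',
    TensorProduct.comul_tmul, TensorProduct.comul_tmul, Bialgebra.comul_one, Bialgebra.comul_one,
    Algebra.TensorProduct.one_def, Algebra.TensorProduct.one_def, key, contractL_comul]

lemma comul_crossCocycle (w : H ⊗[k] H) : comul (R := k) (crossCocycle S.f w) =
    TensorProduct.map (crossCocycle S.f) (crossCocycle S.f) (comul w) := by
  have key : ∀ Q Q' : H ⊗[k] H,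
        (TensorProduct.map (crossMul S.act S.f) (crossMul S.act S.f)
        (TensorProduct.tensorTensorTensorComm k (A ⊗[k] H) (A ⊗[k] H) (A ⊗[k] H) (A ⊗[k] H)
          (AlgebraTensorModule.tensorTensorTensorComm k k k k A A H H ((1 ⊗ₜ 1) ⊗ₜ Q) ⊗ₜ
            AlgebraTensorModule.tensorTensorTensorComm k k k k A A H H ((1 ⊗ₜ 1) ⊗ₜ Q')))) =
      TensorProduct.map (crossCocycle S.f) (crossCocycle S.f)
        (AlgebraTensorModule.tensorTensorTensorComm k k k k H H H H (Q ⊗ₜ Q')) := by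
    intro Q P
    induction Q with
    | zero => simp
    | add P P' h h' => simp only [tmul_add, add_tmul, map_add, h, h']
    | tmul h h' =>
      induction P with
      | zero => simp
      | add P P' h h' => simp only [tmul_add, map_add, h, h']
      | tmul c c' =>
        simp only [AlgebraTensorModule.tensorTensorTensorComm_tmul,
          TensorProduct.tensorTensorTensorComm_tmul, TensorProduct.map_tmul,
          crossMul_one_one S.act S.f S.act_one]
  induction w with
  | zero => simp
  | add P P' h h' => simp only [map_add, h, h']
  | tmul h h' =>
    rw [← crossMul_one_one S.act S.f S.act_one, S.comul_mul', TensorProduct.comul_tmul,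
      TensorProduct.comul_tmul, TensorProduct.comul_tmul, Bialgebra.comul_one,
      Algebra.TensorProduct.one_def, key]

/-- Contracting the `H`-leg of `crossCocycle` returns `f`, and both maps involved respect the
coproduct. -/
lemma comul_f (w : H ⊗[k] H) :
    comul (R := k) (S.f w) = TensorProduct.map S.f S.f (comul w) := by
  rw [← contractR_crossCocycle, ← contractRR_comul, comul_crossCocycle, TensorProduct.map_map]
  congr 2 <;> exact LinearMap.ext fun w => contractR_crossCocycle S.f w

/-- `f(h₁, h'₁) ⊗ h₂ h'₂ = f(h₂, h'₂) ⊗ h₁ h'₁`. -/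
lemma comm_crossCocycle (w : H ⊗[k] H) : TensorProduct.comm k A H (crossCocycle S.f w) =
    TensorProduct.map (LinearMap.mul' k H) S.f (comul w) := by
  rw [← contractLR_comul, comul_crossCocycle, TensorProduct.map_map]
  congr 2
  · exact LinearMap.ext fun w => contractL_crossCocycle S.f S.counit_f w
  · exact LinearMap.ext fun w => contractR_crossCocycle S.f w

end CrossedSystem

end General

/-! ### Crossed systems with trivial action -/

section TrivialAction

open Coalgebra TensorProduct

variable {k : Type u} [Field k] {A : Type v} [Ring A] [HopfAlgebra k A]
  {H : Type w} [Ring H] [HopfAlgebra k H]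

/-- The trivial action `h ▷ a = ε(h) a`. -/
def trivialAct (k : Type u) [Field k] (A : Type v) [AddCommGroup A] [Module k A]
    (H : Type w) [AddCommGroup H] [Module k H] [Coalgebra k H] : H ⊗[k] A →ₗ[k] A :=
  (TensorProduct.lid k A).toLinearMap ∘ₗ TensorProduct.map counit LinearMap.id

@[simp] lemma trivialAct_tmul (h : H) (a : A) :
    trivialAct k A H (h ⊗ₜ a) = counit (R := k) h • a := rfl

lemma crossTwist_trivialAct (h : H) (c : A) : crossTwist (trivialAct k A H) (h ⊗ₜ c) = c ⊗ₜ h := by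
  have key : ∀ Q : H ⊗[k] H, TensorProduct.map (trivialAct k A H) LinearMap.id
      (TensorProduct.rightComm k H H A (Q ⊗ₜ c)) = c ⊗ₜ contractL k H H Q := by
    intro Q
    induction Q with
    | zero => simp
    | add P P' h h' => simp only [add_tmul, tmul_add, map_add, h, h']
    | tmul a b => simp [smul_tmul']
  have := key (comul h)
  rw [contractL_comul] at this
  simpa [crossTwist] using this

lemma crossLeft_tmul_eq (a : A) (z : A ⊗[k] H) : crossLeft (a ⊗ₜ z) = (a ⊗ₜ 1) * z := by
  induction z with
  | zero => simp
  | add z z' h h' => simp only [tmul_add, mul_add, map_add, h, h']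
  | tmul c h => simp [crossLeft]

/-- The product on the right is that of the ordinary tensor algebra. The crossed system axioms other
than associativity thereby become conditions on `crossCocycle f` alone. -/
lemma crossMul_trivialAct (f : H ⊗[k] H →ₗ[k] A) (a c : A) (h h' : H) :
    crossMul (trivialAct k A H) f ((a ⊗ₜ h) ⊗ₜ (c ⊗ₜ h')) =
      ((a * c) ⊗ₜ 1) * crossCocycle f (h ⊗ₜ h') := by
  simp only [crossMul, LinearMap.comp_apply, LinearEquiv.coe_coe, TensorProduct.assoc_tmul,
    TensorProduct.map_tmul, LinearMap.id_apply, TensorProduct.assoc_symm_tmul,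
    crossTwist_trivialAct, crossLeft_tmul_eq]
  rw [← mul_assoc, Algebra.TensorProduct.tmul_mul_tmul, mul_one]

variable (f : H ⊗[k] H →ₗ[k] A)

lemma counit_crossMul_trivialAct
    (hf : ∀ w, counit (R := k) (crossCocycle f w) = counit (R := k) w) (u v : A ⊗[k] H) :
    counit (R := k) (crossMul (trivialAct k A H) f (u ⊗ₜ v)) =
      counit (R := k) u * counit (R := k) v := by
  induction u with
  | zero => simp
  | add z z' h h' => simp only [add_tmul, map_add, h, h', add_mul]
  | tmul a h =>
    induction v with
    | zero => simp
    | add z z' h h' => simp only [tmul_add, map_add, h, h', mul_add]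
    | tmul c h' =>
      rw [crossMul_trivialAct, Bialgebra.counit_mul, hf]
      simp
      ring

lemma comul_mul_tmul (u v : A ⊗[k] H) : comul (R := k) (u * v) = comul u * comul v := by
  exact Bialgebra.comul_mul u v

lemma comul_crossMul_trivialAct (hf : ∀ w, comul (R := k) (crossCocycle f w) =
      TensorProduct.map (crossCocycle f) (crossCocycle f) (comul w)) (u v : A ⊗[k] H) :
    comul (R := k) (crossMul (trivialAct k A H) f (u ⊗ₜ v)) =
    TensorProduct.map (crossMul (trivialAct k A H) f) (crossMul (trivialAct k A H) f)
      (TensorProduct.tensorTensorTensorComm k (A ⊗[k] H) (A ⊗[k] H) (A ⊗[k] H) (A ⊗[k] H)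
        (comul u ⊗ₜ comul v)) := by
  have key : ∀ (P P' : A ⊗[k] A) (Q Q' : H ⊗[k] H),
      TensorProduct.map (crossMul (trivialAct k A H) f) (crossMul (trivialAct k A H) f)
        (TensorProduct.tensorTensorTensorComm k (A ⊗[k] H) (A ⊗[k] H) (A ⊗[k] H) (A ⊗[k] H)
          (AlgebraTensorModule.tensorTensorTensorComm k k k k A A H H (P ⊗ₜ Q) ⊗ₜ
            AlgebraTensorModule.tensorTensorTensorComm k k k k A A H H (P' ⊗ₜ Q'))) =
      AlgebraTensorModule.tensorTensorTensorComm k k k k A A H H ((P * P') ⊗ₜ (1 ⊗ₜ 1)) *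
        TensorProduct.map (crossCocycle f) (crossCocycle f)
          (AlgebraTensorModule.tensorTensorTensorComm k k k k H H H H (Q ⊗ₜ Q')) := by
    intro P P' Q Q'
    induction P with
    | zero => simp
    | add _ _ h h' => simp only [add_tmul, map_add, add_mul, h, h']
    | tmul a b =>
    induction P' with
    | zero => simp
    | add _ _ h h' => simp only [tmul_add, add_tmul, map_add, mul_add, add_mul, h, h']
    | tmul c d =>
    induction Q with
    | zero => simp
    | add _ _ h h' => simp only [tmul_add, add_tmul, map_add, mul_add, h, h']
    | tmul h h' =>
    induction Q' with
    | zero => simp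
    | add _ _ h h' => simp only [tmul_add, map_add, mul_add, h, h']
    | tmul l l' =>
      simp only [AlgebraTensorModule.tensorTensorTensorComm_tmul,
        TensorProduct.tensorTensorTensorComm_tmul, TensorProduct.map_tmul,
        Algebra.TensorProduct.tmul_mul_tmul, crossMul_trivialAct]
  induction u with
  | zero => simp
  | add z z' h h' => simp only [add_tmul, map_add, h, h']
  | tmul a h =>
    induction v with
    | zero => simp
    | add z z' h h' => simp only [tmul_add, map_add, h, h']
    | tmul c h' =>
      have h1 : comul (R := k) ((a * c) ⊗ₜ[k] (1 : H)) =
          AlgebraTensorModule.tensorTensorTensorComm k k k k A A H H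
            ((comul a * comul c) ⊗ₜ (1 ⊗ₜ 1)) := by
        rw [TensorProduct.comul_tmul, Bialgebra.comul_mul, Bialgebra.comul_one,
          Algebra.TensorProduct.one_def]
      have h2 : comul (R := k) (crossMul (trivialAct k A H) f ((a ⊗ₜ h) ⊗ₜ (c ⊗ₜ h'))) =
          comul ((a * c) ⊗ₜ[k] (1 : H)) * comul (crossCocycle f (h ⊗ₜ h')) :=
        (congrArg comul (crossMul_trivialAct f a c h h')).trans (comul_mul_tmul _ _)
      have h3 := congrArg (fun X => TensorProduct.map (crossMul (trivialAct k A H) f)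
        (crossMul (trivialAct k A H) f) (TensorProduct.tensorTensorTensorComm k (A ⊗[k] H)
          (A ⊗[k] H) (A ⊗[k] H) (A ⊗[k] H) X))
        (congrArg₂ (fun X Y => X ⊗ₜ[k] Y) (TensorProduct.comul_tmul (R := k) (S := k) a h)
          (TensorProduct.comul_tmul (R := k) (S := k) c h'))
      have h4 := congrArg (TensorProduct.map (crossCocycle f) (crossCocycle f))
        (TensorProduct.comul_tmul (R := k) (S := k) h h')
      exact h2.trans ((congrArg₂ (· * ·) h1 ((hf _).trans h4)).trans
        ((key _ _ _ _).symm.trans h3.symm))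

/-- With trivial action the `A`- and `H`-parts separate, so `S_A ⊗ S_H` is an antipode as soon as
the cocycle part is trivial on `S(h₁) ⊗ h₂`. -/
lemma crossMul_antipode_rTensor (hf : ∀ h : H, crossCocycle f
      ((HopfAlgebra.antipode k).rTensor H (comul h)) = counit (R := k) h • (1 ⊗ₜ 1))
    (u : A ⊗[k] H) :
    crossMul (trivialAct k A H) f
      ((TensorProduct.map (HopfAlgebra.antipode k (A := A)) (HopfAlgebra.antipode k)).rTensor _
        (comul u)) = counit (R := k) u • (1 ⊗ₜ 1) := by
  have key : ∀ (P : A ⊗[k] A) (Q : H ⊗[k] H),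
      crossMul (trivialAct k A H) f
        ((TensorProduct.map (HopfAlgebra.antipode k (A := A)) (HopfAlgebra.antipode k)).rTensor _
          (AlgebraTensorModule.tensorTensorTensorComm k k k k A A H H (P ⊗ₜ Q))) =
      (LinearMap.mul' k A ((HopfAlgebra.antipode k).rTensor A P) ⊗ₜ 1) *
        crossCocycle f ((HopfAlgebra.antipode k).rTensor H Q) := by
    intro P Q
    induction P with
    | zero => simp
    | add _ _ h h' => simp only [add_tmul, map_add, add_mul, h, h']
    | tmul a b =>
    induction Q with
    | zero => simp
    | add _ _ h h' => simp only [tmul_add, map_add, mul_add, h, h']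
    | tmul h h' =>
      simp only [AlgebraTensorModule.tensorTensorTensorComm_tmul, LinearMap.rTensor_tmul,
        TensorProduct.map_tmul, crossMul_trivialAct, LinearMap.mul'_apply]
  induction u with
  | zero => simp
  | add z z' h h' => simp only [map_add, h, h', add_smul]
  | tmul a h =>
    rw [TensorProduct.comul_tmul, key, hf, HopfAlgebra.mul_antipode_rTensor_comul_apply]
    simp [Algebra.algebraMap_eq_smul_one, smul_tmul', smul_smul, mul_comm]

lemma crossMul_antipode_lTensor (hf : ∀ h : H, crossCocycle f
      ((HopfAlgebra.antipode k).lTensor H (comul h)) = counit (R := k) h • (1 ⊗ₜ 1))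
    (u : A ⊗[k] H) :
    crossMul (trivialAct k A H) f
      ((TensorProduct.map (HopfAlgebra.antipode k (A := A)) (HopfAlgebra.antipode k)).lTensor _
        (comul u)) = counit (R := k) u • (1 ⊗ₜ 1) := by
  have key : ∀ (P : A ⊗[k] A) (Q : H ⊗[k] H),
      crossMul (trivialAct k A H) f
        ((TensorProduct.map (HopfAlgebra.antipode k (A := A)) (HopfAlgebra.antipode k)).lTensor _
          (AlgebraTensorModule.tensorTensorTensorComm k k k k A A H H (P ⊗ₜ Q))) =
      (LinearMap.mul' k A ((HopfAlgebra.antipode k).lTensor A P) ⊗ₜ 1) *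
        crossCocycle f ((HopfAlgebra.antipode k).lTensor H Q) := by
    intro P Q
    induction P with
    | zero => simp
    | add _ _ h h' => simp only [add_tmul, map_add, add_mul, h, h']
    | tmul a b =>
    induction Q with
    | zero => simp
    | add _ _ h h' => simp only [tmul_add, map_add, mul_add, h, h']
    | tmul h h' =>
      simp only [AlgebraTensorModule.tensorTensorTensorComm_tmul, LinearMap.lTensor_tmul,
        TensorProduct.map_tmul, crossMul_trivialAct, LinearMap.mul'_apply]
  induction u with
  | zero => simp
  | add z z' h h' => simp only [map_add, h, h', add_smul]
  | tmul a h =>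
    rw [TensorProduct.comul_tmul, key, hf, HopfAlgebra.mul_antipode_lTensor_comul_apply]
    simp [Algebra.algebraMap_eq_smul_one, smul_tmul', smul_smul, mul_comm]

lemma trivialAct_mul (h : H) (a b : A) : trivialAct k A H (h ⊗ₜ (a * b)) =
    LinearMap.mul' k A (TensorProduct.map ((curry (trivialAct k A H)).flip a)
      ((curry (trivialAct k A H)).flip b) (comul h)) := by
  have key : ∀ Q : H ⊗[k] H, LinearMap.mul' k A (TensorProduct.map
      ((curry (trivialAct k A H)).flip a) ((curry (trivialAct k A H)).flip b) Q) =
      counit (R := k) (contractL k H H Q) • (a * b) := by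
    intro Q
    induction Q with
    | zero => simp
    | add _ _ h h' => simp only [map_add, add_smul, h, h']
    | tmul h h' => simp [smul_smul, mul_comm]
  rw [key, contractL_comul, trivialAct_tmul]

/-- A crossed system with trivial action, given by a cocycle. -/
def CrossedSystem.ofCocycle
    (h1 : ∀ h : H, crossCocycle f (1 ⊗ₜ h) = 1 ⊗ₜ h)
    (h2 : ∀ h : H, crossCocycle f (h ⊗ₜ 1) = 1 ⊗ₜ h)
    (h3 : ∀ u v w : A ⊗[k] H, crossMul (trivialAct k A H) f
      (crossMul (trivialAct k A H) f (u ⊗ₜ v) ⊗ₜ w) =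
        crossMul (trivialAct k A H) f (u ⊗ₜ crossMul (trivialAct k A H) f (v ⊗ₜ w)))
    (h4 : ∀ w, counit (R := k) (crossCocycle f w) = counit (R := k) w)
    (h5 : ∀ w, comul (R := k) (crossCocycle f w) =
      TensorProduct.map (crossCocycle f) (crossCocycle f) (comul w))
    (h6 : ∀ h : H, crossCocycle f
      ((HopfAlgebra.antipode k).rTensor H (comul h)) = counit (R := k) h • (1 ⊗ₜ 1))
    (h7 : ∀ h : H, crossCocycle f
      ((HopfAlgebra.antipode k).lTensor H (comul h)) = counit (R := k) h • (1 ⊗ₜ 1)) :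
    CrossedSystem k A H where
  act := trivialAct k A H
  f := f
  act_one h := by rw [trivialAct_tmul, Algebra.algebraMap_eq_smul_one]
  one_act a := by rw [trivialAct_tmul, Bialgebra.counit_one, one_smul]
  act_mul := trivialAct_mul
  one_mul' u := by
    induction u with
    | zero => simp
    | add _ _ h h' => simp only [tmul_add, map_add, h, h']
    | tmul a h => rw [crossMul_trivialAct, h1]; simp
  mul_one' u := by
    induction u with
    | zero => simp
    | add _ _ h h' => simp only [add_tmul, map_add, h, h']
    | tmul a h => rw [crossMul_trivialAct, h2]; simp
  mul_assoc' := h3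
  counit_mul' := counit_crossMul_trivialAct f h4
  comul_mul' := comul_crossMul_trivialAct f h5
  exists_antipode := ⟨_, crossMul_antipode_rTensor f h6, crossMul_antipode_lTensor f h7⟩

end TrivialAction

/-! ### The deformation `x² = z` of `A ⊗ H₄` -/

section SweedlerCocycle

open Coalgebra TensorProduct H4

variable {k : Type u} [Field k] {A : Type v} [Ring A] [HopfAlgebra k A]

/-- The bilinear form `B` on `H₄` with `B(gⁱx, gʲx) = (-1)ʲ` that vanishes on `1` and `g`. -/
def sweedlerForm (k : Type u) [Field k] : H4 k ⊗[k] H4 k →ₗ[k] k :=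
  pairing (coord k 2 + coord k 3) (coord k 2 - coord k 3)

/-- The bilinear map `h ⊗ h' ↦ B(h₁, h'₁) h₂h'₂`. -/
def sweedlerTail (k : Type u) [Field k] : H4 k ⊗[k] H4 k →ₗ[k] H4 k :=
  LinearMap.toSpanSingleton k (H4 k) 1 ∘ₗ
      (pairing (coord k 2) (coord k 2) - pairing (coord k 3) (coord k 3)) +
    LinearMap.toSpanSingleton k (H4 k) (g k) ∘ₗ
      (pairing (coord k 3) (coord k 2) - pairing (coord k 2) (coord k 3))

@[simp] lemma sweedlerForm_tmul (h h' : H4 k) :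
    sweedlerForm k (h ⊗ₜ h') = (h.imJ + h.imK) * (h'.imJ - h'.imK) := rfl

@[simp] lemma sweedlerTail_tmul (h h' : H4 k) : sweedlerTail k (h ⊗ₜ h') =
    (h.imJ * h'.imJ - h.imK * h'.imK) • (1 : H4 k) +
      (h.imK * h'.imJ - h.imJ * h'.imK) • g k := rfl

/-- The cocycle `f(h, h') = ε(h) ε(h') + B(h, h') z`. -/
def sweedlerCocycle (z : A) : H4 k ⊗[k] H4 k →ₗ[k] A :=
  LinearMap.toSpanSingleton k A 1 ∘ₗ pairing counit counit +
    LinearMap.toSpanSingleton k A z ∘ₗ sweedlerForm k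

@[simp] lemma sweedlerCocycle_tmul (z : A) (h h' : H4 k) : sweedlerCocycle z (h ⊗ₜ h') =
    (counit (R := k) h * counit (R := k) h') • (1 : A) +
      ((h.imJ + h.imK) * (h'.imJ - h'.imK)) • z := rfl

/-- The second term records the rule `(gⁱx)(gʲx) = (-1)ʲ gⁱ⁺ʲ z`, which is what `x² = z` gives in
place of `x² = 0`. The identity is checked on the sixteen pairs of basis elements. -/
lemma crossCocycle_sweedlerCocycle_tmul (z : A) (h h' : H4 k) :
    crossCocycle (sweedlerCocycle z) (h ⊗ₜ h') =
      1 ⊗ₜ (h * h') + z ⊗ₜ sweedlerTail k (h ⊗ₜ h') := by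
  have : crossCocycle (sweedlerCocycle z) =
      TensorProduct.mk k A (H4 k) 1 ∘ₗ LinearMap.mul' k (H4 k) +
        TensorProduct.mk k A (H4 k) z ∘ₗ sweedlerTail k := by
    refine bilin_ext fun i j => ?_
    fin_cases i <;> fin_cases j <;>
    simp [crossCocycle, TensorProduct.comul_tmul, comul_gx, -Bialgebra.comul_mul, tmul_add, add_tmul,
      mul_assoc, g_mul_g, g_mul_g_mul, x_mul_g, x_mul_x, x_mul_g_mul, tmul_neg, neg_tmul,
      Algebra.TensorProduct.one_def]
  exact LinearMap.congr_fun this (h ⊗ₜ h')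


/-- This is the part of associativity that is linear in `z`. -/
lemma sweedlerTail_cocycle (a b c : H4 k) :
    sweedlerTail k (a ⊗ₜ b) * c + sweedlerTail k ((a * b) ⊗ₜ c) =
      a * sweedlerTail k (b ⊗ₜ c) + sweedlerTail k (a ⊗ₜ (b * c)) := by
  ext <;> simp <;> ring

/-- The tail takes values in the span of `1` and `g`, where it vanishes as an argument. Hence no
`z²` terms occur in associativity. -/
lemma sweedlerTail_sweedlerTail_left (a b c : H4 k) :
    sweedlerTail k (sweedlerTail k (a ⊗ₜ b) ⊗ₜ c) = 0 := by
  ext <;> simp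

lemma sweedlerTail_sweedlerTail_right (a b c : H4 k) :
    sweedlerTail k (a ⊗ₜ sweedlerTail k (b ⊗ₜ c)) = 0 := by
  ext <;> simp

lemma crossMul_sweedlerCocycle (z : A) (a c : A) (h h' : H4 k) :
    crossMul (trivialAct k A (H4 k)) (sweedlerCocycle z) ((a ⊗ₜ h) ⊗ₜ (c ⊗ₜ h')) =
      (a * c) ⊗ₜ (h * h') + (a * c * z) ⊗ₜ sweedlerTail k (h ⊗ₜ h') := by
  rw [crossMul_trivialAct, crossCocycle_sweedlerCocycle_tmul, mul_add,
    Algebra.TensorProduct.tmul_mul_tmul, Algebra.TensorProduct.tmul_mul_tmul, mul_one, one_mul,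
    one_mul]

/-- Sort by powers of `z`: the constant terms are associativity of `A ⊗ H₄`, the linear terms are
`sweedlerTail_cocycle`, and there are no quadratic ones. Centrality of `z` lets the powers be
collected. -/
lemma crossMul_sweedlerCocycle_assoc (z : A) (hz : ∀ a : A, z * a = a * z)
    (u v w : A ⊗[k] H4 k) :
    crossMul (trivialAct k A (H4 k)) (sweedlerCocycle z)
      (crossMul (trivialAct k A (H4 k)) (sweedlerCocycle z) (u ⊗ₜ v) ⊗ₜ w) =
    crossMul (trivialAct k A (H4 k)) (sweedlerCocycle z)
      (u ⊗ₜ crossMul (trivialAct k A (H4 k)) (sweedlerCocycle z) (v ⊗ₜ w)) := by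
  induction u with
  | zero => simp only [zero_tmul, map_zero]
  | add _ _ h h' => simp only [add_tmul, map_add, h, h']
  | tmul a l =>
  induction v with
  | zero => simp only [zero_tmul, tmul_zero, map_zero]
  | add _ _ h h' => simp only [add_tmul, tmul_add, map_add, h, h']
  | tmul b m =>
  induction w with
  | zero => simp only [tmul_zero, map_zero]
  | add _ _ h h' => simp only [tmul_add, map_add, h, h']
  | tmul c n =>
    have h1 : ∀ d e : A, d * z * e = d * e * z := fun d e => by rw [mul_assoc, hz, mul_assoc]
    simp only [crossMul_sweedlerCocycle, add_tmul, tmul_add, map_add,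
      sweedlerTail_sweedlerTail_left, sweedlerTail_sweedlerTail_right, tmul_zero, add_zero]
    have h2 := congrArg (fun t => (a * b * c * z) ⊗ₜ[k] t) (sweedlerTail_cocycle l m n)
    simp only [tmul_add] at h2
    rw [h1, mul_assoc l, ← mul_assoc a (b * c) z, ← mul_assoc a b c, add_assoc, add_assoc,
      add_comm (_ ⊗ₜ[k] sweedlerTail k ((l * m) ⊗ₜ n)), h2,
      add_comm (_ ⊗ₜ[k] sweedlerTail k (l ⊗ₜ (m * n)))]

lemma counit_crossCocycle_sweedlerCocycle (z : A) (hz : counit (R := k) z = 0)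
    (w : H4 k ⊗[k] H4 k) :
    counit (R := k) (crossCocycle (sweedlerCocycle z) w) = counit (R := k) w := by
  induction w with
  | zero => simp
  | add _ _ h h' => simp only [map_add, h, h']
  | tmul h h' =>
    rw [crossCocycle_sweedlerCocycle_tmul]
    simp [hz, mul_comm]

lemma comul_crossCocycle_sweedlerCocycle (z : A) (hz : comul (R := k) z = z ⊗ₜ 1 + 1 ⊗ₜ z)
    (w : H4 k ⊗[k] H4 k) : comul (R := k) (crossCocycle (sweedlerCocycle z) w) =
      TensorProduct.map (crossCocycle (sweedlerCocycle z)) (crossCocycle (sweedlerCocycle z))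
        (comul w) := by
  have : comul (R := k) ∘ₗ crossCocycle (sweedlerCocycle z) =
      TensorProduct.map (crossCocycle (sweedlerCocycle z)) (crossCocycle (sweedlerCocycle z)) ∘ₗ
        comul := by
    refine bilin_ext fun i j => ?_
    fin_cases i <;> fin_cases j <;>
    simp [crossCocycle_sweedlerCocycle_tmul, TensorProduct.comul_tmul, comul_gx,
      -Bialgebra.comul_mul, tmul_add, add_tmul, hz,
      mul_assoc, g_mul_g, g_mul_g_mul, x_mul_g, x_mul_x, x_mul_g_mul, tmul_neg, neg_tmul,
      Algebra.TensorProduct.one_def] <;> abel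
  exact LinearMap.congr_fun this w

lemma antipode_g : HopfAlgebra.antipode k (g k) = g k := by
  change antiLin antipodeHom (g k) = _
  simp [antipodeHom]

lemma antipode_x : HopfAlgebra.antipode k (x k) = -(g k * x k) := by
  change antiLin antipodeHom (x k) = _
  simp [antipodeHom]

lemma antipode_gx : HopfAlgebra.antipode k (g k * x k) = x k := by
  change antiLin antipodeHom (g k * x k) = _
  simp [antipodeHom, x_mul_g, mul_assoc, g_mul_g_mul]

/-- The crossed system with trivial action and `f(x, x) = z`, for a central primitive `z`. -/
def CrossedSystem.ofPrimitive (z : A) (hz : ∀ a : A, z * a = a * z)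
    (hc : comul (R := k) z = z ⊗ₜ 1 + 1 ⊗ₜ z) (he : counit (R := k) z = 0) :
    CrossedSystem k A (H4 k) :=
  CrossedSystem.ofCocycle (sweedlerCocycle z)
    (fun h => by rw [crossCocycle_sweedlerCocycle_tmul]; simp)
    (fun h => by rw [crossCocycle_sweedlerCocycle_tmul]; simp)
    (crossMul_sweedlerCocycle_assoc z hz)
    (counit_crossCocycle_sweedlerCocycle z he)
    (comul_crossCocycle_sweedlerCocycle z hc)
    (by
      have : crossCocycle (sweedlerCocycle z) ∘ₗ (HopfAlgebra.antipode k).rTensor (H4 k) ∘ₗ comul =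
          LinearMap.toSpanSingleton k (A ⊗[k] H4 k) (1 ⊗ₜ 1) ∘ₗ counit := by
        apply linearMap_ext <;>
        simp [crossCocycle_sweedlerCocycle_tmul, comul_gx, -Bialgebra.comul_mul, antipode_g,
          antipode_x, antipode_gx, g_mul_g, x_mul_g, tmul_neg,
          Algebra.TensorProduct.one_def]
      exact LinearMap.congr_fun this)
    (by
      have : crossCocycle (sweedlerCocycle z) ∘ₗ (HopfAlgebra.antipode k).lTensor (H4 k) ∘ₗ comul =
          LinearMap.toSpanSingleton k (A ⊗[k] H4 k) (1 ⊗ₜ 1) ∘ₗ counit := by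
        apply linearMap_ext <;>
        simp [crossCocycle_sweedlerCocycle_tmul, comul_gx, -Bialgebra.comul_mul, antipode_g,
          antipode_x, antipode_gx, mul_assoc, g_mul_g, g_mul_g_mul, x_mul_g, tmul_neg,
          Algebra.TensorProduct.one_def]
      exact LinearMap.congr_fun this)

end SweedlerCocycle

/-! ### Every crossed system over `H₄` is determined by `f(x, x)` -/

section Determination

open Coalgebra TensorProduct H4

variable {k : Type u} [Field k] {A : Type v} [Ring A] [HopfAlgebra k A]

/-- The `i`-th component of an element of `H₄ ⊗ A`. -/
def leftComponent (k : Type u) [Field k] (A : Type v) [AddCommGroup A] [Module k A] (i : Fin 4) :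
    H4 k ⊗[k] A →ₗ[k] A :=
  (TensorProduct.lid k A).toLinearMap ∘ₗ TensorProduct.map (coord k i) LinearMap.id

@[simp] lemma leftComponent_tmul (i : Fin 4) (h : H4 k) (a : A) :
    leftComponent k A i (h ⊗ₜ a) = coord k i h • a := rfl

namespace CrossedSystem

variable (S : CrossedSystem k A (H4 k))

/-- For `h = x` the symmetry `comm_crossTwist` reads `1 ⊗ (x ▷ c) + x ⊗ (g ▷ c) = x ⊗ c + g ⊗ (x ▷
c)`. The coefficient of `g` gives this lemma and that of `x` gives `act_g`; `act_gx` comes from `h =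
gx` in the same way. -/
lemma act_x (c : A) : S.act (x k ⊗ₜ c) = 0 := by
  have h := congrArg (leftComponent k A 1) (S.comm_crossTwist (x k) c)
  simpa [crossTwist, coord, add_tmul] using h.symm

lemma act_g (c : A) : S.act (g k ⊗ₜ c) = c := by
  have h := congrArg (leftComponent k A 2) (S.comm_crossTwist (x k) c)
  simpa [crossTwist, coord, add_tmul, S.one_act] using h

lemma act_gx (c : A) : S.act ((g k * x k) ⊗ₜ c) = 0 := by
  have h := congrArg (leftComponent k A 0) (S.comm_crossTwist (g k * x k) c)
  simpa [crossTwist, coord, add_tmul, comul_gx, -Bialgebra.comul_mul] using h.symm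

/-- The action of a crossed system over Sweedler's Hopf algebra is trivial. -/
lemma act_eq : S.act = trivialAct k A (H4 k) := by
  apply TensorProduct.ext
  apply linearMap_ext <;> ext c
  · simp [S.one_act]
  · simp [S.act_g]
  · simp [S.act_x]
  · simp [S.act_gx]

/-- For the pair `(g, x)` the symmetry of the cocycle reads `g ⊗ f(g, x) + gx ⊗ f(g, g) = gx ⊗ 1 + 1
⊗ f(g, x)`. Its coefficients of `1` and `gx` give this lemma and `f_g_g`; the next values are found
likewise. -/
lemma f_g_x : S.f (g k ⊗ₜ x k) = 0 := by
  have h := congrArg (leftComponent k A 0) (S.comm_crossCocycle (g k ⊗ₜ x k))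
  simpa [crossCocycle, TensorProduct.comul_tmul, coord, tmul_add, g_mul_g] using h.symm

lemma f_g_g : S.f (g k ⊗ₜ g k) = 1 := by
  have h := congrArg (leftComponent k A 3) (S.comm_crossCocycle (g k ⊗ₜ x k))
  simpa [crossCocycle, TensorProduct.comul_tmul, coord, tmul_add, g_mul_g, S.f_one] using h

lemma f_x_g : S.f (x k ⊗ₜ g k) = 0 := by
  have h := congrArg (leftComponent k A 0) (S.comm_crossCocycle (x k ⊗ₜ g k))
  simpa [crossCocycle, TensorProduct.comul_tmul, coord, add_tmul, g_mul_g, x_mul_g] using h.symm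

lemma f_g_gx : S.f (g k ⊗ₜ (g k * x k)) = 0 := by
  have h := congrArg (leftComponent k A 0) (S.comm_crossCocycle (g k ⊗ₜ (g k * x k)))
  simpa [crossCocycle, TensorProduct.comul_tmul, coord, tmul_add, g_mul_g, comul_gx, g_mul_g_mul,
    -Bialgebra.comul_mul] using h

lemma f_gx_g : S.f ((g k * x k) ⊗ₜ g k) = 0 := by
  have h := congrArg (leftComponent k A 0) (S.comm_crossCocycle ((g k * x k) ⊗ₜ g k))
  simpa [crossCocycle, TensorProduct.comul_tmul, coord, add_tmul, g_mul_g, comul_gx, g_mul_g_mul,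
    x_mul_g, mul_assoc, -Bialgebra.comul_mul] using h

/-- Among the four terms of `Δ(x ⊗ x)` the two mixed ones contain `f(x, g)` or `f(g, x)`, which
vanish. -/
lemma comul_f_x_x : comul (R := k) (S.f (x k ⊗ₜ x k)) =
    S.f (x k ⊗ₜ x k) ⊗ₜ 1 + 1 ⊗ₜ S.f (x k ⊗ₜ x k) := by
  rw [S.comul_f]
  simp [TensorProduct.comul_tmul, tmul_add, add_tmul, S.f_g_x, S.f_x_g, S.f_g_g, S.f_one]

/-- The product of two elements of `1 # H`. -/
lemma crossMul_one_tmul (h h' : H4 k) :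
    crossMul S.act S.f ((1 ⊗ₜ h) ⊗ₜ (1 ⊗ₜ h')) = crossCocycle S.f (h ⊗ₜ h') :=
  crossMul_one_one S.act S.f S.act_one h h'

lemma cocycle_g_g : crossCocycle S.f (g k ⊗ₜ g k) = 1 ⊗ₜ 1 := by
  simp [crossCocycle, TensorProduct.comul_tmul, S.f_g_g, g_mul_g]

lemma cocycle_g_x : crossCocycle S.f (g k ⊗ₜ x k) = 1 ⊗ₜ (g k * x k) := by
  simp [crossCocycle, TensorProduct.comul_tmul, tmul_add, S.f_g_g, S.f_g_x]

lemma cocycle_x_g : crossCocycle S.f (x k ⊗ₜ g k) = -(1 ⊗ₜ (g k * x k)) := by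
  simp [crossCocycle, TensorProduct.comul_tmul, add_tmul, S.f_g_g, S.f_x_g, x_mul_g, tmul_neg]

lemma cocycle_x_x : crossCocycle S.f (x k ⊗ₜ x k) = S.f (x k ⊗ₜ x k) ⊗ₜ 1 := by
  simp [crossCocycle, TensorProduct.comul_tmul, tmul_add, add_tmul, S.f_g_g, S.f_x_g, S.f_g_x,
    x_mul_x]

lemma act_left (h : H4 k) (z : A) :
    crossMul S.act S.f ((1 ⊗ₜ h) ⊗ₜ (z ⊗ₜ 1)) = z ⊗ₜ h := by
  rw [crossMul_twist S.act S.f S.cocycle_one, act_eq, crossTwist_trivialAct]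

lemma crossMul_tmul_one (h : H4 k) (z : A) :
    crossMul S.act S.f ((z ⊗ₜ 1) ⊗ₜ (1 ⊗ₜ h)) = z ⊗ₜ h := by
  rw [act_eq, crossMul_trivialAct, S.one_cocycle]
  simp

/-- Associativity of `(1 # g)(1 # x)(1 # x)`. The other two values also come from associativity, by
writing `gx` as a product. -/
lemma cocycle_gx_x : crossCocycle S.f ((g k * x k) ⊗ₜ x k) = S.f (x k ⊗ₜ x k) ⊗ₜ g k := by
  have h := S.mul_assoc' (1 ⊗ₜ g k) (1 ⊗ₜ x k) (1 ⊗ₜ x k)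
  rwa [S.crossMul_one_tmul, S.crossMul_one_tmul, S.cocycle_g_x, S.cocycle_x_x,
    S.crossMul_one_tmul, S.act_left] at h

lemma cocycle_x_gx : crossCocycle S.f (x k ⊗ₜ (g k * x k)) = -(S.f (x k ⊗ₜ x k) ⊗ₜ g k) := by
  have h := S.mul_assoc' (1 ⊗ₜ x k) (1 ⊗ₜ g k) (1 ⊗ₜ x k)
  rw [S.crossMul_one_tmul, S.crossMul_one_tmul, S.cocycle_g_x, S.cocycle_x_g, neg_tmul, map_neg,
    S.crossMul_one_tmul, S.crossMul_one_tmul, S.cocycle_gx_x] at h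
  exact h.symm

lemma cocycle_gx_gx :
    crossCocycle S.f ((g k * x k) ⊗ₜ (g k * x k)) = -(S.f (x k ⊗ₜ x k) ⊗ₜ 1) := by
  have h := S.mul_assoc' (1 ⊗ₜ g k) (1 ⊗ₜ x k) (1 ⊗ₜ (g k * x k))
  -- The product `g (z g)` is rewritten as `(g z) g = (z g) g = z g² = z`, the trivial action
  -- letting `g` pass `z`.
  have h' := S.mul_assoc' (1 ⊗ₜ g k) (S.f (x k ⊗ₜ x k) ⊗ₜ 1) (1 ⊗ₜ g k)
  have h'' := S.mul_assoc' (S.f (x k ⊗ₜ x k) ⊗ₜ 1) (1 ⊗ₜ g k) (1 ⊗ₜ g k)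
  rw [S.crossMul_one_tmul, S.crossMul_one_tmul, S.cocycle_g_x, S.cocycle_x_gx, tmul_neg, map_neg,
    S.crossMul_one_tmul] at h
  rw [S.act_left, S.crossMul_tmul_one] at h'
  rw [S.crossMul_tmul_one, S.crossMul_one_tmul, S.cocycle_g_g, S.mul_one'] at h''
  rw [h, ← h', h'']

/-- A crossed system over Sweedler's Hopf algebra is determined by `f(x, x)`. -/
lemma f_eq : S.f = sweedlerCocycle (S.f (x k ⊗ₜ x k)) := by
  have h1 := congrArg (contractR k A (H4 k)) S.cocycle_gx_x
  have h2 := congrArg (contractR k A (H4 k)) S.cocycle_x_gx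
  have h3 := congrArg (contractR k A (H4 k)) S.cocycle_gx_gx
  rw [contractR_crossCocycle] at h1 h2 h3
  refine bilin_ext fun i j => ?_
  fin_cases i <;> fin_cases j <;>
  simp [S.f_one, S.one_f, S.f_g_g, S.f_x_g, S.f_g_x, S.f_g_gx, S.f_gx_g, h1, h2, h3]

lemma ext_f_x_x {S S' : CrossedSystem k A (H4 k)} (h : S.f (x k ⊗ₜ x k) = S'.f (x k ⊗ₜ x k)) :
    S = S' :=
  CrossedSystem.ext (S.act_eq.trans S'.act_eq.symm)
    (S.f_eq.trans ((congrArg sweedlerCocycle h).trans S'.f_eq.symm))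

lemma ofPrimitive_f_x_x (z : A) (hz : ∀ a : A, z * a = a * z)
    (hc : comul (R := k) z = z ⊗ₜ 1 + 1 ⊗ₜ z) (he : counit (R := k) z = 0) :
    (ofPrimitive z hz hc he).f (x k ⊗ₜ x k) = z := by
  change sweedlerCocycle z (x k ⊗ₜ x k) = z
  simp

end CrossedSystem

end Determination

/-! ### Cohomologous systems are equal; relations in the crossed product -/

section Cohomology

open Coalgebra TensorProduct H4

variable {k : Type u} [Field k] {A : Type v} [Ring A] [HopfAlgebra k A]

/-- A unitary cocentral coalgebra map on Sweedler's Hopf algebra is trivial. -/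
lemma cocentral_eq (r : H4 k →ₗc[k] A) (h1 : r 1 = 1)
    (hr : ∀ h : H4 k, TensorProduct.map r.toLinearMap LinearMap.id (comul (R := k) h) =
      TensorProduct.map r.toLinearMap LinearMap.id
        (TensorProduct.comm k (H4 k) (H4 k) (comul (R := k) h))) :
    r.toLinearMap = Algebra.linearMap k A ∘ₗ counit := by
  have e : ∀ (i : Fin 4) (h : H4 k),
      leftComponent k A i (TensorProduct.comm k A (H4 k)
        (TensorProduct.map r.toLinearMap LinearMap.id (comul (R := k) h))) =
      leftComponent k A i (TensorProduct.comm k A (H4 k)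
        (TensorProduct.map r.toLinearMap LinearMap.id
          (TensorProduct.comm k (H4 k) (H4 k) (comul (R := k) h)))) :=
    fun i h => by rw [hr]
  -- Cocentrality at `x` reads `r(x) ⊗ 1 + r(g) ⊗ x = 1 ⊗ x + r(x) ⊗ g`. The coefficients of `1` and
  -- `x` give `r(x) = 0` and `r(g) = 1`; the coefficient of `1` at `gx` gives `r(gx) = 0`.
  have hx := e 0 (x k)
  have hg := e 2 (x k)
  have hgx := e 0 (g k * x k)
  rw [comul_gx] at hgx
  simp [coord, h1] at hx hg hgx
  apply linearMap_ext
  · simpa using h1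
  · simpa using hg
  · simpa using hx
  · simpa using hgx.symm

namespace CrossedSystem

/-- Cohomologous crossed systems over Sweedler's Hopf algebra are equal. -/
lemma cohomologous_iff (S S' : CrossedSystem k A (H4 k)) : Cohomologous S S' ↔ S = S' := by
  -- For `r = η ε` every convolution factor except `f` is the convolution unit.
  have hconv : ∀ r : H4 k →ₗ[k] A, r = Algebra.linearMap k A ∘ₗ counit →
      WithConv.toConv (r ∘ₗ (TensorProduct.rid k (H4 k)).toLinearMap ∘ₗ
          TensorProduct.map LinearMap.id counit) *
        WithConv.toConv (S.act ∘ₗ TensorProduct.map LinearMap.id r) *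
        WithConv.toConv S.f *
        WithConv.toConv (HopfAlgebra.antipode k ∘ₗ r ∘ₗ LinearMap.mul' k (H4 k)) =
      WithConv.toConv S.f := by
    rintro r rfl
    have e1 : (Algebra.linearMap k A ∘ₗ counit) ∘ₗ (TensorProduct.rid k (H4 k)).toLinearMap ∘ₗ
        TensorProduct.map LinearMap.id counit =
        Algebra.linearMap k A ∘ₗ counit (R := k) (A := H4 k ⊗[k] H4 k) := by
      ext; simp
    have e2 : S.act ∘ₗ TensorProduct.map LinearMap.id (Algebra.linearMap k A ∘ₗ counit) =
        Algebra.linearMap k A ∘ₗ counit (R := k) (A := H4 k ⊗[k] H4 k) := by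
      apply TensorProduct.ext'
      intro h h'
      simp [act_eq, Algebra.algebraMap_eq_smul_one, smul_smul, mul_comm]
    have e3 : HopfAlgebra.antipode k ∘ₗ (Algebra.linearMap k A ∘ₗ counit) ∘ₗ
        LinearMap.mul' k (H4 k) =
        Algebra.linearMap k A ∘ₗ counit (R := k) (A := H4 k ⊗[k] H4 k) := by
      apply TensorProduct.ext'
      intro h h'
      simp [Algebra.algebraMap_eq_smul_one, mul_comm]
    rw [e1, e2, e3, ← LinearMap.convOne_def, one_mul, one_mul, mul_one]
  constructor
  · rintro ⟨r, h1, hr, -, hf⟩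
    rw [hconv _ (cocentral_eq r h1 hr)] at hf
    exact ext_f_x_x (DFunLike.congr_fun (WithConv.toConv_injective hf).symm _)
  · rintro rfl
    have hact : ∀ r : H4 k →ₗ[k] A, r = Algebra.linearMap k A ∘ₗ counit → ∀ a : A,
        WithConv.toConv ((curry S.act).flip a) =
          WithConv.toConv r * WithConv.toConv ((curry S.act).flip a) *
            WithConv.toConv (HopfAlgebra.antipode k ∘ₗ r) := by
      rintro r rfl a
      have e3 : HopfAlgebra.antipode k ∘ₗ (Algebra.linearMap k A ∘ₗ counit) =
          Algebra.linearMap k A ∘ₗ counit (R := k) (A := H4 k) := by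
        ext h
        simp [Algebra.algebraMap_eq_smul_one]
      rw [e3, ← LinearMap.convOne_def, one_mul, mul_one]
    let r : H4 k →ₗc[k] A :=
      (((Bialgebra.unitBialgHom k A).comp (Bialgebra.counitBialgHom k (H4 k))) : H4 k →ₐc[k] A)
    have hr : r.toLinearMap = Algebra.linearMap k A ∘ₗ counit := rfl
    refine ⟨r, ?_, fun h => ?_, hact _ hr, (hconv _ hr).symm⟩
    · change algebraMap k A (counit (R := k) (1 : H4 k)) = 1
      simp
    · rw [hr]
      have : TensorProduct.map (Algebra.linearMap k A ∘ₗ counit (R := k) (A := H4 k))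
          (LinearMap.id (R := k) (M := H4 k)) ∘ₗ comul =
          TensorProduct.map (Algebra.linearMap k A ∘ₗ counit (R := k) (A := H4 k))
          (LinearMap.id (R := k) (M := H4 k)) ∘ₗ
            (TensorProduct.comm k (H4 k) (H4 k)).toLinearMap ∘ₗ comul := by
        apply linearMap_ext <;>
        simp [comul_gx, -Bialgebra.comul_mul, Algebra.TensorProduct.one_def]
      exact LinearMap.congr_fun this h

/-- The relation coincides with equality by `cohomologous_iff`. -/
lemma cohomologous_equivalence :
    Equivalence (Cohomologous (k := k) (A := A) (H := H4 k)) := by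
  have : Cohomologous (k := k) (A := A) (H := H4 k) = Eq := by
    funext S S'
    exact propext (cohomologous_iff S S')
  rw [this]
  exact eq_equivalence

/-- The inclusion of `A` into the crossed product. -/
def incl (S : CrossedSystem k A (H4 k)) : A →ₐ[k] S.Product :=
  AlgHom.ofLinearMap (S.toProduct.toLinearMap ∘ₗ (TensorProduct.mk k A (H4 k)).flip 1) rfl
    (fun a c => by
      change S.toProduct ((a * c) ⊗ₜ 1) = crossMul S.act S.f ((a ⊗ₜ 1) ⊗ₜ (c ⊗ₜ 1))
      rw [act_eq, crossMul_trivialAct, S.one_cocycle]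
      simp only [Algebra.TensorProduct.tmul_mul_tmul, mul_one]
      rfl)

/-- The element `1 # g` of the crossed product. -/
def gen_g (S : CrossedSystem k A (H4 k)) : S.Product := S.toProduct (1 ⊗ₜ g k)

/-- The element `1 # x` of the crossed product. -/
def gen_x (S : CrossedSystem k A (H4 k)) : S.Product := S.toProduct (1 ⊗ₜ x k)

variable (S : CrossedSystem k A (H4 k))

lemma gen_g_mul_gen_g : S.gen_g * S.gen_g = 1 := by
  change crossMul S.act S.f ((1 ⊗ₜ g k) ⊗ₜ (1 ⊗ₜ g k)) = _
  rw [crossMul_one_tmul, cocycle_g_g]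
  rfl

lemma gen_g_mul_gen_x : S.gen_g * S.gen_x = S.toProduct (1 ⊗ₜ (g k * x k)) := by
  change crossMul S.act S.f ((1 ⊗ₜ g k) ⊗ₜ (1 ⊗ₜ x k)) = _
  rw [crossMul_one_tmul, cocycle_g_x]
  rfl

lemma gen_x_mul_gen_g : S.gen_x * S.gen_g = -(S.gen_g * S.gen_x) := by
  rw [gen_g_mul_gen_x]
  change crossMul S.act S.f ((1 ⊗ₜ x k) ⊗ₜ (1 ⊗ₜ g k)) = _
  rw [crossMul_one_tmul, cocycle_x_g]
  rfl

lemma gen_x_mul_gen_x : S.gen_x * S.gen_x = S.incl (S.f (x k ⊗ₜ x k)) := by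
  change crossMul S.act S.f ((1 ⊗ₜ x k) ⊗ₜ (1 ⊗ₜ x k)) = _
  rw [crossMul_one_tmul, cocycle_x_x]
  rfl

lemma incl_mul (a : A) (h : H4 k) : S.incl a * S.toProduct (1 ⊗ₜ h) = S.toProduct (a ⊗ₜ h) :=
  S.crossMul_tmul_one h a

lemma comul_gen_g : comul (R := k) S.gen_g = S.gen_g ⊗ₜ S.gen_g := by
  change comul (R := k) ((1 : A) ⊗ₜ[k] g k) = (1 ⊗ₜ g k) ⊗ₜ (1 ⊗ₜ g k)
  rw [TensorProduct.comul_tmul, Bialgebra.comul_one, comul_g, Algebra.TensorProduct.one_def]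
  rfl

lemma counit_gen_g : counit (R := k) S.gen_g = 1 := by
  change counit (R := k) ((1 : A) ⊗ₜ[k] g k) = 1
  simp

lemma comul_gen_x : comul (R := k) S.gen_x = S.gen_x ⊗ₜ 1 + S.gen_g ⊗ₜ S.gen_x := by
  have h : comul (R := k) ((1 : A) ⊗ₜ[k] x k) = ((1 : A) ⊗ₜ[k] x k) ⊗ₜ[k] ((1 : A) ⊗ₜ[k] 1) +
      ((1 : A) ⊗ₜ[k] g k) ⊗ₜ[k] ((1 : A) ⊗ₜ[k] x k) := by
    simp [TensorProduct.comul_tmul, Algebra.TensorProduct.one_def, tmul_add]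
  exact h

lemma counit_gen_x : counit (R := k) S.gen_x = 0 := by
  change counit (R := k) ((1 : A) ⊗ₜ[k] x k) = 0
  simp

lemma comul_incl {z : A} (hz : comul (R := k) z = z ⊗ₜ 1 + 1 ⊗ₜ z) :
    comul (R := k) (S.incl z) = S.incl z ⊗ₜ 1 + 1 ⊗ₜ S.incl z := by
  have h : comul (R := k) (z ⊗ₜ[k] (1 : H4 k)) = (z ⊗ₜ[k] 1) ⊗ₜ[k] ((1 : A) ⊗ₜ[k] 1) +
      ((1 : A) ⊗ₜ[k] 1) ⊗ₜ[k] (z ⊗ₜ[k] 1) := by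
    simp [TensorProduct.comul_tmul, Algebra.TensorProduct.one_def, add_tmul, hz]
  exact h

/-- The crossed product is generated by `A`, `g` and `x`. -/
lemma subalgebra_eq_top (T : Subalgebra k S.Product) (hA : ∀ a, S.incl a ∈ T)
    (hg : S.gen_g ∈ T) (hx : S.gen_x ∈ T) : T = ⊤ := by
  rw [eq_top_iff]
  rintro u -
  have key : ∀ v : A ⊗[k] H4 k, S.toProduct v ∈ T := by
    intro v
    induction v with
    | zero => rw [map_zero]; exact zero_mem T
    | add _ _ h h' => rw [map_add]; exact add_mem h h'
    | tmul a h =>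
      rw [← incl_mul]
      refine mul_mem (hA a) ?_
      rw [H4.eq_sum h]
      simp only [tmul_add, tmul_smul, map_add, map_smul]
      refine add_mem (add_mem (add_mem ?_ ?_) ?_) ?_ <;> refine Subalgebra.smul_mem _ ?_ _
      · exact one_mem T
      · exact hg
      · exact hx
      · rw [← gen_g_mul_gen_x]
        exact mul_mem hg hx
  exact key u

end CrossedSystem

end Cohomology

/-! ### Maps between crossed products induced by rescaling -/

section ProductMap

open Coalgebra TensorProduct H4

variable {k : Type u} [Field k]

/-- The algebra map `g ↦ g`, `x ↦ β x` of Sweedler's Hopf algebra. -/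
def H4.scaleAlgHom (β : k) : H4 k →ₐ[k] H4 k :=
  H4.lift (g k) (β • x k) (g_mul_g k) (by simp [x_mul_x])
    (by rw [smul_mul_assoc, x_mul_g, mul_smul_comm, smul_neg])

@[simp] lemma H4.scaleAlgHom_g (β : k) : H4.scaleAlgHom β (g k) = g k := H4.lift_g _ _ _ _ _

@[simp] lemma H4.scaleAlgHom_x (β : k) : H4.scaleAlgHom β (x k) = β • x k := H4.lift_x _ _ _ _ _

/-- The rescaling `g ↦ g`, `x ↦ β x` of Sweedler's Hopf algebra. -/
def H4.scale (β : k) : H4 k →ₐc[k] H4 k :=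
  BialgHom.ofAlgHom (H4.scaleAlgHom β)
    (H4.hom_ext (by simp) (by simp))
    (H4.hom_ext (by simp) (by simp [tmul_smul, smul_tmul']))

@[simp] lemma H4.scale_g (β : k) : H4.scale β (g k) = g k := H4.scaleAlgHom_g β

@[simp] lemma H4.scale_x (β : k) : H4.scale β (x k) = β • x k := H4.scaleAlgHom_x β

lemma H4.scale_apply (β : k) (h : H4 k) : H4.scale β h =
    h.re • (1 : H4 k) + h.imI • g k + (β * h.imJ) • x k + (β * h.imK) • (g k * x k) := by
  conv_lhs => rw [H4.eq_sum h]
  simp [smul_smul, mul_comm]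

/-- The tail is linear in the `x`-part of each argument, so each contributes one factor `β`. -/
lemma sweedlerTail_scale (β : k) (h h' : H4 k) :
    sweedlerTail k (H4.scale β h ⊗ₜ H4.scale β h') = β ^ 2 • sweedlerTail k (h ⊗ₜ h') := by
  rw [sweedlerTail_tmul, sweedlerTail_tmul, H4.scale_apply, H4.scale_apply]
  ext <;> simp <;> ring

/-- The values of the tail lie in the span of `1` and `g`, which the rescaling fixes. -/
lemma scale_sweedlerTail (β : k) (h h' : H4 k) :
    H4.scale β (sweedlerTail k (h ⊗ₜ h')) = sweedlerTail k (h ⊗ₜ h') := by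
  simp

variable {A : Type v} [Ring A] [HopfAlgebra k A]

namespace CrossedSystem

lemma crossMul_eq (S : CrossedSystem k A (H4 k)) (a c : A) (h h' : H4 k) :
    crossMul S.act S.f ((a ⊗ₜ h) ⊗ₜ (c ⊗ₜ h')) =
      (a * c) ⊗ₜ (h * h') + (a * c * S.f (x k ⊗ₜ x k)) ⊗ₜ sweedlerTail k (h ⊗ₜ h') := by
  have h1 := S.act_eq
  have h2 := S.f_eq
  -- The right-hand side of `h2` contains `S.f` itself; freezing its value at `x ⊗ x` lets `h2` be
  -- used as a rewriting rule.
  generalize S.f (x k ⊗ₜ x k) = z at *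
  rw [h1, h2, crossMul_sweedlerCocycle]

/-- The morphism of crossed products induced by an endomorphism of `A` and a rescaling of `x`. -/
def productMap (S S' : CrossedSystem k A (H4 k)) (φ : A →ₐc[k] A) (β : k)
    (hφ : φ (S.f (x k ⊗ₜ x k)) = β ^ 2 • S'.f (x k ⊗ₜ x k)) : S.Product →ₐc[k] S'.Product :=
  { (Coalgebra.TensorProduct.map (φ : A →ₗc[k] A) (H4.scale β : H4 k →ₗc[k] H4 k) :
      A ⊗[k] H4 k →ₗc[k] A ⊗[k] H4 k) with
    map_one' := by
      change φ 1 ⊗ₜ[k] H4.scale β (1 : H4 k) = (1 : A) ⊗ₜ[k] (1 : H4 k)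
      rw [map_one, map_one]
    map_mul' := by
      have key : ∀ u v : A ⊗[k] H4 k, TensorProduct.map (φ : A →ₗ[k] A)
          (H4.scale β : H4 k →ₗ[k] H4 k) (crossMul S.act S.f (u ⊗ₜ v)) =
          crossMul S'.act S'.f (TensorProduct.map (φ : A →ₗ[k] A)
            (H4.scale β : H4 k →ₗ[k] H4 k) u ⊗ₜ TensorProduct.map (φ : A →ₗ[k] A)
              (H4.scale β : H4 k →ₗ[k] H4 k) v) := by
        intro u v
        induction u with
        | zero => simp only [zero_tmul, map_zero]
        | add _ _ h h' => simp only [add_tmul, map_add, h, h']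
        | tmul a h =>
        induction v with
        | zero => simp only [tmul_zero, map_zero]
        | add _ _ h h' => simp only [tmul_add, map_add, h, h']
        | tmul c h' =>
          rw [crossMul_eq, map_add, TensorProduct.map_tmul, TensorProduct.map_tmul,
            TensorProduct.map_tmul, TensorProduct.map_tmul]
          change φ (a * c) ⊗ₜ[k] H4.scale β (h * h') +
            φ (a * c * S.f (x k ⊗ₜ x k)) ⊗ₜ[k] H4.scale β (sweedlerTail k (h ⊗ₜ h')) =
            crossMul S'.act S'.f ((φ a ⊗ₜ H4.scale β h) ⊗ₜ (φ c ⊗ₜ H4.scale β h'))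
          -- The factor `β²` that `hφ` produces in `A` moves across the tensor sign to match the
          -- `β²` of the rescaled tail.
          rw [crossMul_eq, scale_sweedlerTail, sweedlerTail_scale, map_mul, map_mul φ (a * c),
            map_mul, map_mul, hφ, mul_smul_comm, smul_tmul]
      exact key }

/-- The crossed product is the tensor product if `f(x, x) = 0`. -/
def productEquivTensor (S : CrossedSystem k A (H4 k)) (hS : S.f (x k ⊗ₜ x k) = 0) :
    S.Product ≃ₐc[k] A ⊗[k] H4 k :=
  { (CoalgEquiv.refl k (A ⊗[k] H4 k) : A ⊗[k] H4 k ≃ₗc[k] A ⊗[k] H4 k) with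
    map_mul' := by
      have key : ∀ u v : A ⊗[k] H4 k, crossMul S.act S.f (u ⊗ₜ v) = u * v := by
        intro u v
        induction u with
        | zero => simp only [zero_tmul, map_zero, zero_mul]
        | add _ _ h h' => simp only [add_tmul, map_add, add_mul, h, h']
        | tmul a h =>
        induction v with
        | zero => simp only [tmul_zero, map_zero, mul_zero]
        | add _ _ h h' => simp only [tmul_add, map_add, mul_add, h, h']
        | tmul c h' =>
          rw [crossMul_eq, hS, mul_zero, zero_tmul, add_zero, Algebra.TensorProduct.tmul_mul_tmul]
      exact key }

end CrossedSystem

end ProductMap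

/-! ### Isomorphisms between crossed products -/

section Classification

open Coalgebra TensorProduct PrimAlg

variable {k : Type u} [Field k] {p : ℕ}

lemma two_ne_zero_of_char [CharP k p] (h3 : 3 ≤ p) : (2 : k) ≠ 0 := by
  intro h
  have : ((2 : ℕ) : k) = 0 := by exact_mod_cast h
  rw [CharP.cast_eq_zero_iff k p] at this
  exact absurd (Nat.le_of_dvd two_pos this) (by omega)

lemma tmul_ne_zero_of_ne {a : PrimAlg k p} (ha : a ≠ 0) (i : Fin 4) {h : H4 k}
    (hh : H4.coord k i h ≠ 0) : a ⊗ₜ[k] h ≠ 0 := by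
  intro h0
  have := congrArg (component k p i) h0
  rw [component_tmul, map_zero, smul_eq_zero] at this
  exact this.elim hh ha

variable [hp : Fact p.Prime] [CharP k p]

/-- The algebra map `y ↦ c y`, for `c` in the prime field. -/
def PrimAlg.scaleAlgHom (c : ZMod p) : PrimAlg k p →ₐ[k] PrimAlg k p :=
  PrimAlg.lift (primeField k p c • y k p) (by rw [smul_pow, y_pow, primeField_pow])

@[simp] lemma PrimAlg.scaleAlgHom_y (c : ZMod p) :
    PrimAlg.scaleAlgHom c (y k p) = primeField k p c • y k p := PrimAlg.lift_y _ _

/-- The rescaling `y ↦ c y`, for `c` in the prime field. -/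
def PrimAlg.scale (c : ZMod p) : PrimAlg k p →ₐc[k] PrimAlg k p :=
  BialgHom.ofAlgHom (PrimAlg.scaleAlgHom c)
    (PrimAlg.hom_ext (by simp))
    (PrimAlg.hom_ext (by simp [tmul_smul, smul_tmul']))

@[simp] lemma PrimAlg.scale_y (c : ZMod p) :
    PrimAlg.scale c (y k p) = primeField k p c • y k p := PrimAlg.scaleAlgHom_y c

/-- The crossed system with `f(x, x) = q y`. -/
def crossedSystem (p : ℕ) [Fact p.Prime] [CharP k p] (q : k) :
    CrossedSystem k (PrimAlg k p) (H4 k) :=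
  CrossedSystem.ofPrimitive (q • y k p) (fun a => mul_comm _ a)
    (by rw [map_smul, comul_y, smul_add, smul_tmul', tmul_smul])
    (by rw [map_smul, counit_y, smul_zero])

lemma crossedSystem_f (q : k) :
    (crossedSystem p q).f (H4.x k ⊗ₜ H4.x k) = q • y k p :=
  CrossedSystem.ofPrimitive_f_x_x _ _ _ _

lemma exists_eq_crossedSystem (S : CrossedSystem k (PrimAlg k p) (H4 k)) :
    ∃ q : k, S = crossedSystem p q := by
  obtain ⟨q, hq⟩ := eq_smul_y_of_primitive S.comul_f_x_x
  exact ⟨q, CrossedSystem.ext_f_x_x (hq.trans (crossedSystem_f q).symm)⟩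

lemma smul_y_injective : Function.Injective (fun q : k => q • y k p) :=
  smul_left_injective k y_ne_zero

/-- The element `y # 1` of the crossed product. -/
def gen_y (S : CrossedSystem k (PrimAlg k p) (H4 k)) : S.Product := S.incl (y k p)

lemma gen_y_pow (S : CrossedSystem k (PrimAlg k p) (H4 k)) : gen_y S ^ p = gen_y S := by
  rw [gen_y, ← map_pow, y_pow]

lemma gen_y_ne_zero (S : CrossedSystem k (PrimAlg k p) (H4 k)) : gen_y S ≠ 0 :=
  tmul_ne_zero_of_ne y_ne_zero 0 (by simp [H4.coord])

lemma gen_x_ne_zero (S : CrossedSystem k (PrimAlg k p) (H4 k)) : S.gen_x ≠ 0 :=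
  tmul_ne_zero_of_ne one_ne_zero 2 (by simp [H4.coord])

lemma gen_g_ne_one (S : CrossedSystem k (PrimAlg k p) (H4 k)) : S.gen_g ≠ 1 := by
  intro h
  have h' : (1 : PrimAlg k p) ⊗ₜ[k] (H4.g k - 1) = 0 := by
    rw [tmul_sub]
    exact sub_eq_zero.2 h
  exact tmul_ne_zero_of_ne one_ne_zero 1 (by simp [H4.coord]) h'

lemma gen_x_mul_gen_x_crossedSystem (q : k) : (crossedSystem p q).gen_x * (crossedSystem p q).gen_x =
    q • gen_y (crossedSystem p q) := by
  rw [CrossedSystem.gen_x_mul_gen_x, crossedSystem_f, map_smul, gen_y]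

section Iso

variable {B : Type v} [Ring B] [HopfAlgebra k B] (S : CrossedSystem k (PrimAlg k p) (H4 k))
  (φ : B ≃ₐc[k] S.Product)

/-- The image is grouplike in `A ⊗ H₄`, where `g` is the only grouplike besides `1`. Here and below
the source is an arbitrary `B`, so that the lemmas serve for `A_(q)` as well as for crossed
products. -/
lemma map_grouplike {G : B} (hG : comul (R := k) G = G ⊗ₜ G) (he : counit (R := k) G = 1)
    (hG1 : G ≠ 1) : φ G = S.gen_g := by
  have h1 : comul (R := k) (φ G) = φ G ⊗ₜ φ G := by
    rw [← CoalgHomClass.map_comp_comul_apply, hG]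
    rfl
  have h2 : counit (R := k) (φ G) = 1 := (CoalgHomClass.counit_comp_apply φ G).trans he
  rcases eq_of_grouplike (z := S.toProduct.symm (φ G)) h1 h2 with h | h
  · exact absurd (EquivLike.injective φ (h.trans (map_one φ).symm)) hG1
  · exact h

lemma map_primitive {Y : B} (hY : comul (R := k) Y = Y ⊗ₜ 1 + 1 ⊗ₜ Y) :
    ∃ c : k, φ Y = c • gen_y S := by
  have h1 : comul (R := k) (φ Y) = φ Y ⊗ₜ 1 + 1 ⊗ₜ φ Y := by
    rw [← CoalgHomClass.map_comp_comul_apply, hY, map_add, TensorProduct.map_tmul,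
      TensorProduct.map_tmul]
    exact congrArg₂ (fun a b => φ Y ⊗ₜ[k] a + b ⊗ₜ[k] φ Y) (map_one φ) (map_one φ)
  exact eq_of_primitive (z := S.toProduct.symm (φ Y)) h1

/-- The image has the form `c (1 - g) + d x` and anticommutes with `g`. Since `(1 - g) g + g (1 - g)
= 2 (g - 1)` and `2 ≠ 0`, the scalar `c` vanishes. -/
lemma map_skewPrimitive (h3 : 3 ≤ p) {G X : B} (hG : comul (R := k) G = G ⊗ₜ G)
    (he : counit (R := k) G = 1) (hG1 : G ≠ 1) (hX : comul (R := k) X = X ⊗ₜ 1 + G ⊗ₜ X)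
    (hXG : X * G = -(G * X)) : ∃ d : k, φ X = d • S.gen_x := by
  have hφG := map_grouplike S φ hG he hG1
  have h1 : comul (R := k) (φ X) = φ X ⊗ₜ 1 + S.gen_g ⊗ₜ φ X := by
    rw [← CoalgHomClass.map_comp_comul_apply, hX, map_add, TensorProduct.map_tmul,
      TensorProduct.map_tmul]
    exact congrArg₂ (fun a b => φ X ⊗ₜ[k] a + b ⊗ₜ[k] φ X) (map_one φ) hφG
  obtain ⟨c, d, h2⟩ := eq_of_skewPrimitive (z := S.toProduct.symm (φ X)) h1
  have h4 : φ X = c • (1 - S.gen_g) + d • S.gen_x := h2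
  have h5 : φ X * S.gen_g = -(S.gen_g * φ X) := by
    rw [← hφG, ← map_mul, ← map_mul, hXG, map_neg]
  rw [h4] at h5
  have h6 : (c * 2) • (S.gen_g - 1) = 0 := by
    have h7 : (c • (1 - S.gen_g) + d • S.gen_x) * S.gen_g +
        S.gen_g * (c • (1 - S.gen_g) + d • S.gen_x) = (c * 2) • (S.gen_g - 1) := by
      simp only [add_mul, mul_add, smul_mul_assoc, mul_smul_comm, sub_mul, mul_sub, one_mul,
        mul_one, S.gen_g_mul_gen_g, S.gen_x_mul_gen_g]
      module
    rw [← h7, h5, neg_add_cancel]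
  have h8 : c = 0 := by
    rcases smul_eq_zero.1 h6 with h | h
    · exact (mul_eq_zero.1 h).resolve_right (two_ne_zero_of_char h3)
    · exact absurd (sub_eq_zero.1 h) (gen_g_ne_one S)
  exact ⟨d, by rw [h4, h8, zero_smul, zero_add]⟩

/-- The relation `Y ^ p = Y` forces `c ^ p = c` on the scalar of `map_primitive`, so it lies in the
prime field. -/
lemma exists_unit_eq_of_pow {Y : B} (hY0 : Y ≠ 0) (hY : comul (R := k) Y = Y ⊗ₜ 1 + 1 ⊗ₜ Y)
    (hYp : Y ^ p = Y) : ∃ α : (ZMod p)ˣ, φ Y = primeField k p α • gen_y S := by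
  obtain ⟨c, hc⟩ := map_primitive S φ hY
  have h1 : c ^ p = c := by
    have h2 : (φ Y) ^ p = φ Y := by rw [← map_pow, hYp]
    rw [hc, smul_pow, gen_y_pow] at h2
    exact smul_left_injective k (gen_y_ne_zero S) h2
  obtain ⟨t, rfl⟩ := exists_primeField_eq h1
  have ht : t ≠ 0 := by
    rintro rfl
    rw [map_zero, zero_smul] at hc
    exact hY0 (EquivLike.injective φ (hc.trans (map_zero φ).symm))
  exact ⟨Units.mk0 t ht, hc⟩

lemma exists_unit_eq_of_skewPrimitive (h3 : 3 ≤ p) {G X : B} (hG : comul (R := k) G = G ⊗ₜ G)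
    (he : counit (R := k) G = 1) (hG1 : G ≠ 1) (hX : comul (R := k) X = X ⊗ₜ 1 + G ⊗ₜ X)
    (hXG : X * G = -(G * X)) (hX0 : X ≠ 0) : ∃ β : kˣ, φ X = (β : k) • S.gen_x := by
  obtain ⟨d, hd⟩ := map_skewPrimitive S φ h3 hG he hG1 hX hXG
  have h0 : d ≠ 0 := by
    rintro rfl
    rw [zero_smul] at hd
    exact hX0 (EquivLike.injective φ (hd.trans (map_zero φ).symm))
  exact ⟨Units.mk0 d h0, hd⟩

end Iso

/-- Apply the isomorphism to `x² = q y`, using that it rescales `y` by `α` and `x` by `β`. -/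
lemma sim_of_equiv (h3 : 3 ≤ p) {q q' : k}
    (φ : (crossedSystem p q).Product ≃ₐc[k] (crossedSystem p q').Product) :
    (simSetoid k p).r q q' := by
  obtain ⟨α, hα⟩ := exists_unit_eq_of_pow _ φ (gen_y_ne_zero (crossedSystem p q))
    (CrossedSystem.comul_incl _ comul_y) (gen_y_pow _)
  obtain ⟨β, hβ⟩ := exists_unit_eq_of_skewPrimitive _ φ h3 (CrossedSystem.comul_gen_g _)
    (CrossedSystem.counit_gen_g _) (gen_g_ne_one _) (CrossedSystem.comul_gen_x _)
    (CrossedSystem.gen_x_mul_gen_g _) (gen_x_ne_zero _)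
  refine ⟨α, β, ?_⟩
  have h := congrArg φ (gen_x_mul_gen_x_crossedSystem (p := p) q)
  rw [map_mul, map_smul, hα, hβ, smul_mul_smul_comm, gen_x_mul_gen_x_crossedSystem, smul_smul,
    smul_smul] at h
  have h' := smul_left_injective k (gen_y_ne_zero _) h
  rw [mul_comm, pow_two]
  exact h'.symm

lemma scale_scale (α α' : ZMod p) (a : PrimAlg k p) :
    PrimAlg.scale α (PrimAlg.scale α' a) = PrimAlg.scale (α * α') a := by
  have : (PrimAlg.scaleAlgHom (k := k) α).comp (PrimAlg.scaleAlgHom α') =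
      PrimAlg.scaleAlgHom (α * α') := by
    apply PrimAlg.hom_ext
    rw [AlgHom.comp_apply, scaleAlgHom_y, map_smul, scaleAlgHom_y, scaleAlgHom_y, smul_smul,
      map_mul, mul_comm]
  exact DFunLike.congr_fun this a

lemma scale_one (a : PrimAlg k p) : PrimAlg.scale (1 : ZMod p) a = a := by
  have : PrimAlg.scaleAlgHom (k := k) (1 : ZMod p) = AlgHom.id k _ := by
    apply PrimAlg.hom_ext
    rw [scaleAlgHom_y, map_one, one_smul, AlgHom.id_apply]
  exact DFunLike.congr_fun this a

lemma H4.scale_scale (β β' : k) (h : H4 k) :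
    H4.scale β (H4.scale β' h) = H4.scale (β * β') h := by
  have : (H4.scaleAlgHom β).comp (H4.scaleAlgHom β') = H4.scaleAlgHom (β * β') := by
    apply H4.hom_ext
    · simp
    · simp [smul_smul, mul_comm]
  exact DFunLike.congr_fun this h

lemma H4.scale_one (h : H4 k) : H4.scale (1 : k) h = h := by
  have : H4.scaleAlgHom (1 : k) = AlgHom.id k _ := by
    apply H4.hom_ext
    · simp
    · simp
  exact DFunLike.congr_fun this h

/-- Rescaling `y` by `α` and `x` by `β`. -/
def tensorScale (α : ZMod p) (β : k) : PrimAlg k p ⊗[k] H4 k →ₐc[k] PrimAlg k p ⊗[k] H4 k :=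
  Bialgebra.TensorProduct.map (PrimAlg.scale α) (H4.scale β)

lemma tensorScale_tmul (α : ZMod p) (β : k) (a : PrimAlg k p) (h : H4 k) :
    tensorScale α β (a ⊗ₜ h) = PrimAlg.scale α a ⊗ₜ H4.scale β h := rfl

lemma tensorScale_tensorScale (α α' : ZMod p) (β β' : k) (u : PrimAlg k p ⊗[k] H4 k) :
    tensorScale α β (tensorScale α' β' u) = tensorScale (α * α') (β * β') u := by
  induction u with
  | zero => rw [map_zero, map_zero, map_zero]
  | add _ _ h h' => rw [map_add, map_add, map_add, h, h']
  | tmul a h =>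
    rw [tensorScale_tmul, tensorScale_tmul, tensorScale_tmul, scale_scale, H4.scale_scale]

lemma tensorScale_one (u : PrimAlg k p ⊗[k] H4 k) : tensorScale (1 : ZMod p) (1 : k) u = u := by
  induction u with
  | zero => rw [map_zero]
  | add _ _ h h' => rw [map_add, h, h']
  | tmul a h => rw [tensorScale_tmul, scale_one, H4.scale_one]

lemma tensorScale_bijective (α : (ZMod p)ˣ) (β : kˣ) :
    Function.Bijective (tensorScale (α : ZMod p) (β : k)) := by
  refine Function.bijective_iff_has_inverse.2
    ⟨tensorScale ((α⁻¹ : (ZMod p)ˣ) : ZMod p) ((β⁻¹ : kˣ) : k), fun u => ?_, fun u => ?_⟩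
  · rw [tensorScale_tensorScale, Units.inv_mul, Units.inv_mul, tensorScale_one]
  · rw [tensorScale_tensorScale, Units.mul_inv, Units.mul_inv, tensorScale_one]

/-- The relation `α q = β² q'` is exactly the condition under which rescaling `y` by `α` and `x` by
`β` respects the deformed products. -/
lemma equiv_of_sim {q q' : k} (h : (simSetoid k p).r q q') :
    Nonempty ((crossedSystem p q).Product ≃ₐc[k] (crossedSystem p q').Product) := by
  obtain ⟨α, β, h⟩ := h
  have hf : PrimAlg.scale (α : ZMod p) ((crossedSystem p q).f (H4.x k ⊗ₜ H4.x k)) =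
      (β : k) ^ 2 • (crossedSystem p q').f (H4.x k ⊗ₜ H4.x k) := by
    rw [crossedSystem_f, crossedSystem_f, map_smul, PrimAlg.scale_y, smul_smul, smul_smul, ← h,
      mul_comm]
  exact ⟨BialgEquiv.ofBijective (CrossedSystem.productMap _ _ _ _ hf) (tensorScale_bijective α β)⟩

lemma equiv_iff_sim (h3 : 3 ≤ p) (q q' : k) :
    Nonempty ((crossedSystem p q).Product ≃ₐc[k] (crossedSystem p q').Product) ↔
      (simSetoid k p).r q q' :=
  ⟨fun ⟨φ⟩ => sim_of_equiv h3 φ, equiv_of_sim⟩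

end Classification

/-! ### The isomorphism of `A_(q)` with a crossed product -/

section AqIso

open Coalgebra TensorProduct PrimAlg

variable {k : Type u} [Field k] {p : ℕ}

/-- `A_(q)` is spanned by the elements `gⁱxʲ` with `i < 2` and `j < 2p`. -/
lemma Aq.span_eq_top (hp : 1 < p) (q : k) :
    Submodule.span k (Set.range fun ij : Fin 2 × Fin (2 * p) =>
      Aq.g k p q ^ (ij.1 : ℕ) * Aq.x k p q ^ (ij.2 : ℕ)) = ⊤ := by
  set V := Submodule.span k (Set.range fun ij : Fin 2 × Fin (2 * p) =>
    Aq.g k p q ^ (ij.1 : ℕ) * Aq.x k p q ^ (ij.2 : ℕ)) with hV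
  have hmem : ∀ i j : ℕ, i < 2 → j < 2 * p → Aq.g k p q ^ i * Aq.x k p q ^ j ∈ V :=
    fun i j hi hj => Submodule.subset_span ⟨(⟨i, hi⟩, ⟨j, hj⟩), rfl⟩
  -- The exponent `2p` is allowed too: the defining relation lowers it to `2`, which is below `2p`.
  -- It arises when `x` multiplies a power with exponent `2p - 1`.
  have hmem' : ∀ i j : ℕ, i < 2 → j ≤ 2 * p → Aq.g k p q ^ i * Aq.x k p q ^ j ∈ V := by
    intro i j hi hj
    rcases hj.lt_or_eq with h | rfl
    · exact hmem i j hi h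
    · rw [Aq.x_pow, mul_smul_comm]
      exact V.smul_mem _ (hmem i 2 hi (by omega))
  have hg : ∀ v ∈ V, Aq.g k p q * v ∈ V := by
    intro v hv
    induction hv using Submodule.span_induction with
    | mem v hv =>
      obtain ⟨⟨i, j⟩, rfl⟩ := hv
      fin_cases i
      · simpa using hmem 1 j (by omega) j.2
      · simpa [← mul_assoc, Aq.g_mul_g] using hmem 0 j (by omega) j.2
    | zero => rw [mul_zero]; exact V.zero_mem
    | add _ _ _ _ h h' => rw [mul_add]; exact V.add_mem h h'
    | smul c _ _ h => rw [mul_smul_comm]; exact V.smul_mem c h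
  have hx : ∀ v ∈ V, Aq.x k p q * v ∈ V := by
    intro v hv
    induction hv using Submodule.span_induction with
    | mem v hv =>
      obtain ⟨⟨i, j⟩, rfl⟩ := hv
      fin_cases i
      · simpa [pow_succ'] using hmem' 0 (j + 1) (by omega) j.2
      · simpa [← mul_assoc, Aq.x_mul_g, pow_succ'] using V.neg_mem (hmem' 1 (j + 1) (by omega) j.2)
    | zero => rw [mul_zero]; exact V.zero_mem
    | add _ _ _ _ h h' => rw [mul_add]; exact V.add_mem h h'
    | smul c _ _ h => rw [mul_smul_comm]; exact V.smul_mem c h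
  -- The span is a left ideal, and it contains `1`.
  have hmul : ∀ b : Aq k p q, ∀ v ∈ V, b * v ∈ V := by
    intro b
    have hb : b ∈ Algebra.adjoin k {Aq.g k p q, Aq.x k p q} := by
      rw [Aq.adjoin_eq_top]
      exact Algebra.mem_top
    induction hb using Algebra.adjoin_induction with
    | mem b hb =>
      rcases hb with rfl | rfl
      · exact hg
      · exact hx
    | algebraMap r =>
      intro v hv
      rw [← Algebra.smul_def]
      exact V.smul_mem r hv
    | add b b' _ _ h h' =>
      intro v hv
      rw [add_mul]
      exact V.add_mem (h v hv) (h' v hv)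
    | mul b b' _ _ h h' =>
      intro v hv
      rw [mul_assoc]
      exact h _ (h' v hv)
  rw [eq_top_iff]
  intro b _
  have := hmul b _ (hmem 0 0 (by omega) (by omega))
  simpa using this

lemma Aq.finite (hp : 1 < p) (q : k) : Module.Finite k (Aq k p q) :=
  Module.Finite.of_fg_top (Submodule.fg_def.2 ⟨_, Set.finite_range _, Aq.span_eq_top hp q⟩)

lemma Aq.finrank_le (hp : 1 < p) (q : k) : Module.finrank k (Aq k p q) ≤ 4 * p := by
  have h := finrank_range_le_card (R := k) (fun ij : Fin 2 × Fin (2 * p) =>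
      Aq.g k p q ^ (ij.1 : ℕ) * Aq.x k p q ^ (ij.2 : ℕ))
  rw [Set.finrank, Aq.span_eq_top hp, finrank_top] at h
  simp only [Fintype.card_prod, Fintype.card_fin] at h
  omega

variable [hp : Fact p.Prime] [CharP k p]

lemma finrank_product (S : CrossedSystem k (PrimAlg k p) (H4 k)) :
    Module.finrank k S.Product = 4 * p := by
  change Module.finrank k (PrimAlg k p ⊗[k] H4 k) = 4 * p
  rw [Module.finrank_tensorProduct, PrimAlg.finrank_eq hp.out.one_lt, mul_comm,
    Module.finrank_eq_card_basis (H4.basis k), Fintype.card_fin]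

/-- From `x² = q y` and `y ^ p = y` one gets `x ^ (2p) = q ^ p y = q ^ (p - 1) x²`. -/
lemma gen_x_pow (q : k) : (crossedSystem p q).gen_x ^ (2 * p) =
    q ^ (p - 1) • (crossedSystem p q).gen_x ^ 2 := by
  rw [pow_mul, pow_two, gen_x_mul_gen_x_crossedSystem, smul_pow, gen_y_pow, smul_smul, ← pow_succ,
    Nat.sub_add_cancel hp.out.one_le]

/-- The canonical map from `A_(q)` to the crossed product, as an algebra map. -/
def aqAlgHom (p : ℕ) [Fact p.Prime] [CharP k p] (q : k) :
    Aq k p q →ₐ[k] (crossedSystem p q).Product :=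
  Aq.lift (crossedSystem p q).gen_g (crossedSystem p q).gen_x
    (by rw [pow_two, CrossedSystem.gen_g_mul_gen_g]) (gen_x_pow q)
    (CrossedSystem.gen_x_mul_gen_g _)

@[simp] lemma aqAlgHom_g (q : k) : aqAlgHom p q (Aq.g k p q) = (crossedSystem p q).gen_g :=
  Aq.lift_g _ _ _ _ _

@[simp] lemma aqAlgHom_x (q : k) : aqAlgHom p q (Aq.x k p q) = (crossedSystem p q).gen_x :=
  Aq.lift_x _ _ _ _ _

/-- The canonical map from `A_(q)` to the crossed product. -/
def aqHom (p : ℕ) [Fact p.Prime] [CharP k p] (q : k) :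
    Aq k p q →ₐc[k] (crossedSystem p q).Product :=
  BialgHom.ofAlgHom (aqAlgHom p q)
    (Aq.hom_ext (by simp [CrossedSystem.counit_gen_g]) (by simp [CrossedSystem.counit_gen_x]))
    (Aq.hom_ext (by simp [CrossedSystem.comul_gen_g]) (by simp [CrossedSystem.comul_gen_x]))

/-- The element `y = q⁻¹ x²` lies in the image. For `q = 0` this fails, as then `x² = 0` and the
image misses `y`. -/
lemma aqAlgHom_surjective {q : k} (hq : q ≠ 0) : Function.Surjective (aqAlgHom p q) := by
  rw [← AlgHom.range_eq_top]
  have hx : (crossedSystem p q).gen_x ∈ (aqAlgHom p q).range := ⟨Aq.x k p q, aqAlgHom_x q⟩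
  have hy : gen_y (crossedSystem p q) ∈ (aqAlgHom p q).range := by
    have h := (aqAlgHom p q).range.smul_mem (mul_mem hx hx) q⁻¹
    rwa [gen_x_mul_gen_x_crossedSystem, smul_smul, inv_mul_cancel₀ hq, one_smul] at h
  refine CrossedSystem.subalgebra_eq_top _ _ (fun a => ?_) ⟨Aq.g k p q, aqAlgHom_g q⟩ hx
  obtain ⟨P, rfl⟩ := AdjoinRoot.mk_surjective a
  have h : (crossedSystem p q).incl (AdjoinRoot.mk _ P) =
      Polynomial.aeval (gen_y (crossedSystem p q)) P := by
    rw [← AdjoinRoot.aeval_eq, gen_y, y, Polynomial.aeval_algHom_apply]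
  rw [h]
  exact Polynomial.aeval_mem_adjoin_singleton k _ |> fun h' =>
    (Algebra.adjoin_le (Set.singleton_subset_iff.2 hy)) h'

/-- The source has dimension at most `4p` and the target exactly `4p`, so the surjection is
injective. Linear independence of the monomials `gⁱ xʲ` need not be proved beforehand. -/
lemma aqHom_bijective {q : k} (hq : q ≠ 0) : Function.Bijective (aqHom p q) := by
  have := Aq.finite hp.out.one_lt q
  have : Module.Finite k (crossedSystem p q).Product :=
    inferInstanceAs (Module.Finite k (PrimAlg k p ⊗[k] H4 k))
  have hs : Function.Surjective (aqAlgHom p q).toLinearMap := aqAlgHom_surjective hq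
  have hd : Module.finrank k (Aq k p q) = Module.finrank k (crossedSystem p q).Product := by
    refine le_antisymm ?_ (LinearMap.finrank_le_finrank_of_surjective hs)
    rw [finrank_product]
    exact Aq.finrank_le hp.out.one_lt q
  exact ⟨(LinearMap.injective_iff_surjective_of_finrank_eq_finrank hd).2 hs, hs⟩

/-- `A_(q)` is a crossed product. -/
def aqEquiv {q : k} (hq : q ≠ 0) : Aq k p q ≃ₐc[k] (crossedSystem p q).Product :=
  BialgEquiv.ofBijective (aqHom p q) (aqHom_bijective hq)

lemma aqEquiv_g {q : k} (hq : q ≠ 0) : aqEquiv hq (Aq.g k p q) = (crossedSystem p q).gen_g :=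
  aqAlgHom_g q

lemma aqEquiv_x {q : k} (hq : q ≠ 0) : aqEquiv hq (Aq.x k p q) = (crossedSystem p q).gen_x :=
  aqAlgHom_x q

lemma Aq.finrank_eq {q : k} (hq : q ≠ 0) : Module.finrank k (Aq k p q) = 4 * p := by
  rw [← finrank_product (crossedSystem p q)]
  exact LinearEquiv.finrank_eq
    (LinearEquiv.ofBijective (aqAlgHom p q).toLinearMap (aqHom_bijective hq))

/-- The crossed system with `q = 0` gives the tensor product. -/
def tensorEquiv (k : Type u) [Field k] (p : ℕ) [Fact p.Prime] [CharP k p] :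
    (crossedSystem p (0 : k)).Product ≃ₐc[k] PrimAlg k p ⊗[k] H4 k :=
  CrossedSystem.productEquivTensor _ (by rw [crossedSystem_f, zero_smul])

end AqIso

/-! ### Automorphism groups -/

section Automorphisms

open Coalgebra TensorProduct PrimAlg

variable {k : Type u} [Field k] {p : ℕ} [hp : Fact p.Prime]

/-- The algebra map `g ↦ g`, `x ↦ β x` of `A_(q)`. -/
def Aq.scaleAlgHom (q : k) (β : rootsOfUnity (2 * (p - 1)) k) : Aq k p q →ₐ[k] Aq k p q :=
  Aq.lift (Aq.g k p q) (((β : kˣ) : k) • Aq.x k p q) (Aq.g_sq k p q)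
    (by
      have h : ((β : kˣ) : k) ^ (2 * p) = ((β : kˣ) : k) ^ 2 := by
        have h1 : ((β : kˣ) : k) ^ (2 * (p - 1)) = 1 := by
          rw [← Units.val_pow_eq_pow_val, (mem_rootsOfUnity _ _).1 β.2, Units.val_one]
        have h2 : 2 * p = 2 * (p - 1) + 2 := by
          have := hp.out.one_le
          omega
        rw [h2, pow_add, h1, one_mul]
      rw [smul_pow, smul_pow, Aq.x_pow, h, smul_comm])
    (by rw [smul_mul_assoc, Aq.x_mul_g, mul_smul_comm, smul_neg])

@[simp] lemma Aq.scaleAlgHom_g (q : k) (β : rootsOfUnity (2 * (p - 1)) k) :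
    Aq.scaleAlgHom q β (Aq.g k p q) = Aq.g k p q := Aq.lift_g _ _ _ _ _

@[simp] lemma Aq.scaleAlgHom_x (q : k) (β : rootsOfUnity (2 * (p - 1)) k) :
    Aq.scaleAlgHom q β (Aq.x k p q) = ((β : kˣ) : k) • Aq.x k p q := Aq.lift_x _ _ _ _ _

variable [CharP k p]

/-- The automorphism of `A ⊗ H₄` that rescales `y` by `α` and `x` by `β`. -/
def tensorAut (k : Type u) [Field k] (p : ℕ) [Fact p.Prime] [CharP k p] :
    (ZMod p)ˣ × kˣ →* ((PrimAlg k p ⊗[k] H4 k) ≃ₐc[k] (PrimAlg k p ⊗[k] H4 k)) where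
  toFun αβ := BialgEquiv.ofBijective (tensorScale (αβ.1 : ZMod p) (αβ.2 : k))
    (tensorScale_bijective αβ.1 αβ.2)
  map_one' := by
    apply DFunLike.ext
    exact tensorScale_one
  map_mul' αβ αβ' := by
    apply DFunLike.ext
    intro u
    exact (tensorScale_tensorScale _ _ _ _ u).symm

lemma tensorAut_apply (αβ : (ZMod p)ˣ × kˣ) (u : PrimAlg k p ⊗[k] H4 k) :
    tensorAut k p αβ u = tensorScale (αβ.1 : ZMod p) (αβ.2 : k) u := rfl

lemma tensorAut_injective : Function.Injective (tensorAut k p) := by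
  intro a b h
  have h1 := DFunLike.congr_fun h (y k p ⊗ₜ 1)
  have h2 := DFunLike.congr_fun h (1 ⊗ₜ H4.x k)
  rw [tensorAut_apply, tensorAut_apply, tensorScale_tmul, tensorScale_tmul, PrimAlg.scale_y,
    PrimAlg.scale_y, map_one, map_one, ← smul_tmul', ← smul_tmul'] at h1
  rw [tensorAut_apply, tensorAut_apply, tensorScale_tmul, tensorScale_tmul, H4.scale_x,
    H4.scale_x, map_one, map_one, tmul_smul, tmul_smul] at h2
  have h1' := smul_left_injective k (gen_y_ne_zero (crossedSystem p (0 : k))) h1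
  have h2' := smul_left_injective k (gen_x_ne_zero (crossedSystem p (0 : k))) h2
  exact Prod.ext (Units.ext ((primeField k p).injective h1')) (Units.ext h2')

/-- View `A ⊗ H₄` as the crossed product with `q = 0`. There `α q = β² q` is no constraint, so `α`
and `β` are independent. -/
lemma tensorAut_surjective (h3 : 3 ≤ p) : Function.Surjective (tensorAut k p) := by
  intro ψ
  have hG := CrossedSystem.comul_gen_g (crossedSystem p (0 : k))
  have he := CrossedSystem.counit_gen_g (crossedSystem p (0 : k))
  let φ : (crossedSystem p (0 : k)).Product ≃ₐc[k] (crossedSystem p (0 : k)).Product :=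
    ((tensorEquiv k p).trans ψ).trans (tensorEquiv k p).symm
  obtain ⟨α, hα⟩ := exists_unit_eq_of_pow _ φ (gen_y_ne_zero _)
    (CrossedSystem.comul_incl _ comul_y) (gen_y_pow _)
  obtain ⟨β, hβ⟩ := exists_unit_eq_of_skewPrimitive _ φ h3 hG he (gen_g_ne_one _)
    (CrossedSystem.comul_gen_x _) (CrossedSystem.gen_x_mul_gen_g _) (gen_x_ne_zero _)
  have hg := map_grouplike _ φ hG he (gen_g_ne_one _)
  -- The map underlying `tensorEquiv` is the identity of `A ⊗ H₄`, so the statements about `φ` are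
  -- statements about `ψ`.
  have hα' : ψ (y k p ⊗ₜ 1) = primeField k p α • (y k p ⊗ₜ 1) := hα
  have hβ' : ψ (1 ⊗ₜ H4.x k) = (β : k) • (1 ⊗ₜ H4.x k) := hβ
  have hg' : ψ (1 ⊗ₜ H4.g k) = 1 ⊗ₜ H4.g k := hg
  refine ⟨(α, β), ?_⟩
  have key : ((tensorScale (α : ZMod p) (β : k) :
      PrimAlg k p ⊗[k] H4 k →ₐ[k] PrimAlg k p ⊗[k] H4 k)) = (ψ : _ →ₐ[k] _) := by
    apply Algebra.TensorProduct.ext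
    · apply PrimAlg.hom_ext
      refine Eq.trans ?_ hα'.symm
      change tensorScale (α : ZMod p) (β : k) (y k p ⊗ₜ 1) = _
      rw [tensorScale_tmul, PrimAlg.scale_y, map_one, smul_tmul']
    · apply H4.hom_ext
      · refine Eq.trans ?_ hg'.symm
        change tensorScale (α : ZMod p) (β : k) (1 ⊗ₜ H4.g k) = _
        rw [tensorScale_tmul, H4.scale_g, map_one]
      · refine Eq.trans ?_ hβ'.symm
        change tensorScale (α : ZMod p) (β : k) (1 ⊗ₜ H4.x k) = _
        rw [tensorScale_tmul, H4.scale_x, map_one, tmul_smul]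
  apply DFunLike.ext
  exact fun u => DFunLike.congr_fun key u

/-- The rescaling `g ↦ g`, `x ↦ β x` of `A_(q)`. -/
def Aq.scale (q : k) (β : rootsOfUnity (2 * (p - 1)) k) : Aq k p q →ₐc[k] Aq k p q :=
  BialgHom.ofAlgHom (Aq.scaleAlgHom q β)
    (Aq.hom_ext (by simp) (by simp))
    (Aq.hom_ext (by simp) (by simp [tmul_smul, smul_tmul']))

lemma Aq.scale_scale (q : k) (β β' : rootsOfUnity (2 * (p - 1)) k) (u : Aq k p q) :
    Aq.scale q β (Aq.scale q β' u) = Aq.scale q (β * β') u := by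
  have : (Aq.scaleAlgHom q β).comp (Aq.scaleAlgHom q β') = Aq.scaleAlgHom (p := p) q (β * β') := by
    apply Aq.hom_ext
    · simp
    · simp [smul_smul, mul_comm]
  exact DFunLike.congr_fun this u

lemma Aq.scale_one (q : k) (u : Aq k p q) : Aq.scale q 1 u = u := by
  have : Aq.scaleAlgHom (p := p) q 1 = AlgHom.id k _ := by
    apply Aq.hom_ext
    · simp
    · simp
  exact DFunLike.congr_fun this u

/-- The automorphism of `A_(q)` that rescales `x` by `β`. -/
def aqAut (p : ℕ) [Fact p.Prime] [CharP k p] (q : k) :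
    rootsOfUnity (2 * (p - 1)) k →* (Aq k p q ≃ₐc[k] Aq k p q) where
  toFun β := BialgEquiv.ofBijective (Aq.scale q β) (Function.bijective_iff_has_inverse.2
    ⟨Aq.scale q β⁻¹, fun u => by rw [Aq.scale_scale, inv_mul_cancel, Aq.scale_one],
      fun u => by rw [Aq.scale_scale, mul_inv_cancel, Aq.scale_one]⟩)
  map_one' := by
    apply DFunLike.ext
    exact Aq.scale_one q
  map_mul' β β' := by
    apply DFunLike.ext
    intro u
    exact (Aq.scale_scale q _ _ u).symm

lemma Aq.x_ne_zero {q : k} (hq : q ≠ 0) : Aq.x k p q ≠ 0 := by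
  intro h
  have := aqEquiv_x (p := p) hq
  rw [h, map_zero] at this
  exact gen_x_ne_zero _ this.symm

lemma Aq.x_sq_ne_zero {q : k} (hq : q ≠ 0) : Aq.x k p q ^ 2 ≠ 0 := by
  intro h
  have := congrArg (aqEquiv (p := p) hq) h
  rw [map_zero, pow_two, map_mul, aqEquiv_x, gen_x_mul_gen_x_crossedSystem] at this
  exact (smul_eq_zero.1 this).elim hq (gen_y_ne_zero _)

lemma Aq.g_ne_one {q : k} (hq : q ≠ 0) : Aq.g k p q ≠ 1 := by
  intro h
  have := aqEquiv_g (p := p) hq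
  rw [h, map_one] at this
  exact gen_g_ne_one _ this.symm

lemma aqAut_injective {q : k} (hq : q ≠ 0) : Function.Injective (aqAut p q) := by
  intro a b h
  have h2 := DFunLike.congr_fun h (Aq.x k p q)
  have h3 : ((a : kˣ) : k) • Aq.x k p q = ((b : kˣ) : k) • Aq.x k p q :=
    ((Aq.scaleAlgHom_x q a).symm.trans h2).trans (Aq.scaleAlgHom_x q b)
  exact Subtype.ext (Units.ext (smul_left_injective k (Aq.x_ne_zero hq) h3))

lemma aqAut_surjective (h3 : 3 ≤ p) {q : k} (hq : q ≠ 0) : Function.Surjective (aqAut p q) := by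
  intro ψ
  have hG := Aq.comul_g (k := k) (p := p) (q := q)
  have he := Aq.counit_g (k := k) (p := p) (q := q)
  let φ : Aq k p q ≃ₐc[k] (crossedSystem p q).Product := ψ.trans (aqEquiv hq)
  obtain ⟨β, hβ⟩ := exists_unit_eq_of_skewPrimitive _ φ h3 hG he (Aq.g_ne_one hq)
    Aq.comul_x (Aq.x_mul_g k p q) (Aq.x_ne_zero hq)
  have hg : aqEquiv hq (ψ (Aq.g k p q)) = aqEquiv hq (Aq.g k p q) :=
    (map_grouplike _ φ hG he (Aq.g_ne_one hq)).trans (aqEquiv_g hq).symm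
  have hx : aqEquiv hq (ψ (Aq.x k p q)) = aqEquiv hq ((β : k) • Aq.x k p q) := by
    rw [map_smul, aqEquiv_x]
    exact hβ
  have hg' := EquivLike.injective (aqEquiv hq) hg
  have hx' := EquivLike.injective (aqEquiv hq) hx
  -- Compare both sides of the defining relation `x ^ (2p) = q ^ (p - 1) x²` under `x ↦ β x`.
  -- Cancelling `β²` afterwards leaves `β ^ (2 (p - 1)) = 1`.
  have hpow : (β : k) ^ (2 * p) = (β : k) ^ 2 := by
    have h := congrArg ψ (Aq.x_pow k p q)
    rw [map_smul, map_pow, map_pow, hx', smul_pow, smul_pow, Aq.x_pow, smul_smul, smul_smul,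
      mul_comm] at h
    exact mul_left_cancel₀ (pow_ne_zero _ hq) (smul_left_injective k (Aq.x_sq_ne_zero hq) h)
  have hroot : β ∈ rootsOfUnity (2 * (p - 1)) k := by
    rw [mem_rootsOfUnity]
    have h2 : 2 * p = 2 * (p - 1) + 2 := by omega
    rw [h2, pow_add] at hpow
    refine Units.ext ?_
    rw [Units.val_pow_eq_pow_val, Units.val_one]
    exact mul_right_cancel₀ (pow_ne_zero 2 β.ne_zero) (hpow.trans (one_mul _).symm)
  refine ⟨⟨β, hroot⟩, ?_⟩
  have key : Aq.scaleAlgHom q ⟨β, hroot⟩ = (ψ : Aq k p q →ₐ[k] Aq k p q) := by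
    apply Aq.hom_ext
    · rw [Aq.scaleAlgHom_g]
      exact hg'.symm
    · rw [Aq.scaleAlgHom_x]
      exact hx'.symm
  apply DFunLike.ext
  exact fun u => DFunLike.congr_fun key u

end Automorphisms

/-! ### The scalar `q` as an invariant -/

section Invariant

open Coalgebra TensorProduct PrimAlg

variable {k : Type u} [Field k] {p : ℕ} [hp : Fact p.Prime] [CharP k p]

/-- The scalar `q` with `f(x, x) = q y`. -/
def CrossedSystem.scalar (S : CrossedSystem k (PrimAlg k p) (H4 k)) : k :=
  Classical.choose (exists_eq_crossedSystem S)

lemma CrossedSystem.eq_crossedSystem_scalar (S : CrossedSystem k (PrimAlg k p) (H4 k)) :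
    S = crossedSystem p S.scalar :=
  Classical.choose_spec (exists_eq_crossedSystem S)

lemma CrossedSystem.f_x_x (S : CrossedSystem k (PrimAlg k p) (H4 k)) :
    S.f (H4.x k ⊗ₜ H4.x k) = S.scalar • y k p := by
  conv_lhs => rw [S.eq_crossedSystem_scalar]
  exact crossedSystem_f _

lemma crossedSystem_scalar (q : k) : (crossedSystem p q).scalar = q :=
  smul_y_injective ((crossedSystem p q).f_x_x.symm.trans (crossedSystem_f q))

lemma product_equiv_iff (h3 : 3 ≤ p) (S S' : CrossedSystem k (PrimAlg k p) (H4 k)) :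
    Nonempty (S.Product ≃ₐc[k] S'.Product) ↔ (simSetoid k p).r S.scalar S'.scalar := by
  rw [← equiv_iff_sim h3, ← S.eq_crossedSystem_scalar, ← S'.eq_crossedSystem_scalar]

/-- Isomorphism types of crossed products are classified by their scalars up to `∼`. -/
def crpEquiv (k : Type u) [Field k] (p : ℕ) [Fact p.Prime] [CharP k p] (h3 : 3 ≤ p) :
    Crp k (PrimAlg k p) (H4 k) ≃ Quotient (simSetoid k p) where
  toFun := Quotient.map' (s₁ := CrossedSystem.isoSetoid k (PrimAlg k p) (H4 k))
    (s₂ := simSetoid k p) CrossedSystem.scalar fun S S' h => (product_equiv_iff h3 S S').1 h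
  invFun := Quotient.map' (s₁ := simSetoid k p)
    (s₂ := CrossedSystem.isoSetoid k (PrimAlg k p) (H4 k)) (crossedSystem p)
    fun q q' h => (equiv_iff_sim h3 q q').2 h
  left_inv c := by
    induction c using Quotient.ind with
    | _ S => exact congrArg Crp.mk S.eq_crossedSystem_scalar.symm
  right_inv c := by
    induction c using Quotient.ind with
    | _ q => exact congrArg (Quotient.mk _) (crossedSystem_scalar q)

/-- This reduces the description of the classes in (2) to the models `tensorEquiv` and `aqEquiv` of
the standard crossed products. -/
lemma crpEquiv_mk_eq_iff (h3 : 3 ≤ p) (S : CrossedSystem k (PrimAlg k p) (H4 k)) (q : k) :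
    crpEquiv k p h3 (Crp.mk S) = Quotient.mk (simSetoid k p) q ↔
      Nonempty (S.Product ≃ₐc[k] (crossedSystem p q).Product) := by
  rw [product_equiv_iff h3, crossedSystem_scalar]
  exact Quotient.eq (r := simSetoid k p)

/-- Classes of crossed systems are classified by their scalars. -/
def hTwoEquiv (k : Type u) [Field k] (p : ℕ) [Fact p.Prime] [CharP k p] :
    HTwo k (PrimAlg k p) (H4 k) ≃ k where
  toFun := Quot.lift CrossedSystem.scalar fun S S' h =>
    congrArg CrossedSystem.scalar ((CrossedSystem.cohomologous_iff S S').1 h)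
  invFun q := HTwo.mk (crossedSystem p q)
  left_inv c := by
    induction c using Quot.ind with
    | _ S => exact congrArg HTwo.mk S.eq_crossedSystem_scalar.symm
  right_inv q := crossedSystem_scalar q

/-- The two alternatives are `q = 0` and `q ≠ 0` for the scalar of the crossed system. -/
lemma exists_product_equiv_iff (E : Type w) [Ring E] [HopfAlgebra k E] :
    (∃ S : CrossedSystem k (PrimAlg k p) (H4 k), Nonempty (E ≃ₐc[k] S.Product)) ↔
      (Nonempty (E ≃ₐc[k] (PrimAlg k p ⊗[k] H4 k)) ∨
        ∃ q : k, q ≠ 0 ∧ Nonempty (E ≃ₐc[k] Aq k p q)) := by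
  constructor
  · rintro ⟨S, ⟨φ⟩⟩
    obtain ⟨q, rfl⟩ := exists_eq_crossedSystem S
    by_cases hq : q = 0
    · subst hq
      exact .inl ⟨φ.trans (tensorEquiv k p)⟩
    · exact .inr ⟨q, hq, ⟨φ.trans (aqEquiv hq).symm⟩⟩
  · rintro (⟨⟨φ⟩⟩ | ⟨q, hq, ⟨φ⟩⟩)
    · exact ⟨_, ⟨φ.trans (tensorEquiv k p).symm⟩⟩
    · exact ⟨_, ⟨φ.trans (aqEquiv hq)⟩⟩

end Invariant

end HopfCrossed

end

theorem mainTheorem7 {k : Type*} [Field k] {p : ℕ} [Fact p.Prime] [CharP k p] (hp : 3 ≤ p) :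
    -- (1) the crossed products, their dimensions and their automorphism groups
    (∀ (E : Type*) [Ring E] [HopfAlgebra k E],
      (∃ S : HopfCrossed.CrossedSystem k (HopfCrossed.PrimAlg k p) (HopfCrossed.H4 k),
          Nonempty (E ≃ₐc[k] S.Product)) ↔
        (Nonempty (E ≃ₐc[k] (HopfCrossed.PrimAlg k p ⊗[k] HopfCrossed.H4 k)) ∨
          ∃ q : k, q ≠ 0 ∧ Nonempty (E ≃ₐc[k] HopfCrossed.Aq k p q))) ∧
    (∀ q : k, q ≠ 0 → Module.finrank k (HopfCrossed.Aq k p q) = 4 * p) ∧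
    Nonempty (((HopfCrossed.PrimAlg k p ⊗[k] HopfCrossed.H4 k) ≃ₐc[k]
        (HopfCrossed.PrimAlg k p ⊗[k] HopfCrossed.H4 k)) ≃* (ZMod p)ˣ × kˣ) ∧
    (∀ q : k, q ≠ 0 →
      Nonempty ((HopfCrossed.Aq k p q ≃ₐc[k] HopfCrossed.Aq k p q) ≃*
        rootsOfUnity (2 * (p - 1)) k)) ∧
    -- (2) the isomorphism types of crossed products
    (∃ e : HopfCrossed.Crp k (HopfCrossed.PrimAlg k p) (HopfCrossed.H4 k) ≃
        Quotient (HopfCrossed.simSetoid k p),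
      ∀ S : HopfCrossed.CrossedSystem k (HopfCrossed.PrimAlg k p) (HopfCrossed.H4 k),
        (e (HopfCrossed.Crp.mk S) = Quotient.mk (HopfCrossed.simSetoid k p) 0 ↔
          Nonempty (S.Product ≃ₐc[k] (HopfCrossed.PrimAlg k p ⊗[k] HopfCrossed.H4 k))) ∧
        ∀ q : k, q ≠ 0 →
          (e (HopfCrossed.Crp.mk S) = Quotient.mk (HopfCrossed.simSetoid k p) q ↔
            Nonempty (S.Product ≃ₐc[k] HopfCrossed.Aq k p q))) ∧
    -- (3) the equivalence classes of extensions
    Equivalence (HopfCrossed.CrossedSystem.Cohomologous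
      (k := k) (A := HopfCrossed.PrimAlg k p) (H := HopfCrossed.H4 k)) ∧
    (∃ e : HopfCrossed.HTwo k (HopfCrossed.PrimAlg k p) (HopfCrossed.H4 k) ≃ k,
      ∀ S : HopfCrossed.CrossedSystem k (HopfCrossed.PrimAlg k p) (HopfCrossed.H4 k),
        S.f (HopfCrossed.H4.x k ⊗ₜ HopfCrossed.H4.x k) =
          e (HopfCrossed.HTwo.mk S) • HopfCrossed.PrimAlg.y k p) := by
  open HopfCrossed in
  refine ⟨fun E _ _ => exists_product_equiv_iff E, fun q hq => Aq.finrank_eq hq,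
    ⟨(MulEquiv.ofBijective (tensorAut k p) ⟨tensorAut_injective, tensorAut_surjective hp⟩).symm⟩,
    fun q hq => ⟨(MulEquiv.ofBijective (aqAut p q)
      ⟨aqAut_injective hq, aqAut_surjective hp hq⟩).symm⟩,
    ⟨crpEquiv k p hp, fun S => ⟨?_, fun q hq => ?_⟩⟩,
    CrossedSystem.cohomologous_equivalence, ⟨hTwoEquiv k p, fun S => S.f_x_x⟩⟩
  · rw [crpEquiv_mk_eq_iff]
    exact ⟨fun ⟨φ⟩ => ⟨φ.trans (tensorEquiv k p)⟩, fun ⟨φ⟩ => ⟨φ.trans (tensorEquiv k p).symm⟩⟩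
  · rw [crpEquiv_mk_eq_iff]
    exact ⟨fun ⟨φ⟩ => ⟨φ.trans (aqEquiv hq).symm⟩, fun ⟨φ⟩ => ⟨φ.trans (aqEquiv hq)⟩⟩
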